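/- Let $\tau,\eta\in\mathbb C$ with $\mathrm{Im}\,\tau>0$, $\mathrm{Im}\,\eta>0$, and put $p=e^{2\pi i\tau}$, $q=e^{4\pi i\eta}$, $(t;p)_\infty=\prod_{k\ge0}(1-tp^k)$, $R(\tau)=p^{-1/8}/(i(p;p)_\infty)$ with $p^{-1/8}=e^{-\pi i\tau/4}$, and $$\Gamma(z)=\prod_{j,k\ge 0}\frac{1-e^{-2\pi iz}p^{j+1}q^{k+1}}{1-e^{2\pi iz}p^jq^k}.$$ Let $\theta_1(z|\tau)=-\sum_{n\in\mathbb Z}e^{\pi i(n+\frac12)^2\tau}e^{2\pi i(n+\frac12)(z+\frac12)}$, $\theta_2(z|\tau)=\theta_1(z+\frac12|\tau)$, $\theta_3(z|\tau)=e^{\pi i\tau/4+\pi iz}\theta_2(z+\frac\tau2|\tau)$, $\theta_4(z|\tau)=\theta_3(z+\frac12|\tau)$. A test function is an entire function $\Phi$ with $\Phi(z+1)=\Phi(z)$. For $\mathrm{Im}(-g\pm z)>0$ (and $\Gamma(-2g)\ne0$) the intertwining operator is $$[\mathrm M(g)\Phi](z)=\frac{(q;q)_\infty(p;p)_\infty}{2}\int_0^1\frac{\Gamma(z+x-g)\Gamma(z-x-g)\Gamma(-z+x-g)\Gamma(-z-x-g)}{\Gamma(-2g)\Gamma(2x)\Gamma(-2x)}\Phi(x)\,dx,$$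 and for other $g\in\mathbb C$ it is defined by meromorphic continuation in $g$ at fixed $z$ (removable singularities filled in, value $0$ at a pole). Let $P=e^{\frac12\partial_z}$, $(P\Phi)(z)=\Phi(z+\frac12)$. For $k\in\{3,4\}$ let $$\mathrm A_k(g)=e^{\pi iz^2/\eta}\frac{e^{\pi i\eta}}{R(\tau)\theta_1(2z|\tau)}\Big[\theta_k(z+g+\eta|\tfrac\tau2)e^{\eta\partial_z}-\theta_k(z-g-\eta|\tfrac\tau2)e^{-\eta\partial_z}\Big]e^{-\pi iz^2/\eta},$$ let $\mathrm B_k(g)$ be obtained from $\mathrm A_k(g)$ by exchanging $2\eta$ and $\tau$, and let $$\mathrm M^{(k)}(n\eta+m\tfrac\tau2)=\mathrm A_k((n-1)\eta+m\tfrac\tau2)\cdots\mathrm A_k(m\tfrac\tau2)\,\mathrm B_k((m-1)\tfrac\tau2)\cdots\mathrm B_k(0)\,\theta_k^{-m}(z|\eta)\,\theta_k^{-n}(z|\tfrac\tau2),$$ $$\mathrm M^{(k)}(n\eta+m\tfrac\tau2+\tfrac12)=\mathrm A_k((n-1)\eta+m\tfrac\tau2+\tfrac12)\cdots\mathrm A_k(m\tfrac\tau2+\tfrac12)\,\mathrm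 B_k((m-1)\tfrac\tau2+\tfrac12)\cdots\mathrm B_k(\tfrac12)\,\theta_k^{-m}(z+\tfrac12|\eta)\,\theta_k^{-n}(z+\tfrac12|\tfrac\tau2)\,P .$$ Then: 1. For every test function $\Phi$ and every $z\in\mathbb C$ the meromorphic continuation in $g$ to all of $\mathbb C$ exists and is unique. 2. For every even test function $\Phi$ and all $z$ outside a closed discrete set, $g\mapsto[\mathrm M(g)\Phi](z)$ is analytic at $g=\frac12$ and $\mathrm M(\frac12)\Phi=P\Phi$ at $z$. 3. For all $g\in\mathbb C$, as operators on functions of $z$: $\mathrm A_{3,4}(g+\frac12)=\mathrm A_{4,3}(g)$ and $\mathrm B_{3,4}(g+\frac12)=\mathrm B_{4,3}(g)$. Moreover, for all integers $n,m\ge0$: 4. $\mathrm M(n\eta+m\frac\tau2+\frac12)\Phi=\mathrm M(n\eta+m\frac\tau2)P\Phi$ for every test function $\Phi$. 5. $\mathrm M^{(3,4)}(n\eta+m\frac\tau2+\frac12)=\mathrm M^{(4,3)}(n\eta+m\frac\tau2)P$, as operators on functions of $z$. 6. $\mathrm M^{(k)}(n\eta+m\frac\tau2+\frac12)=\mathrm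 M^{(k)}(n\eta+m\frac\tau2)P$ for $k=3,4$ (the operators do not depend on $k$): for every function $\Phi$ both sides applied to $\Phi$ agree at all $z$ outside a closed discrete set. 7. Suppose that $1,2\eta,\tau$ are linearly independent over $\mathbb Q$. Then for every test function $\Phi$ and all $z$ outside a closed discrete set, $g\mapsto[\mathrm M(g)\Phi](z)$ is analytic at $g=n\eta+m\frac\tau2$ and at $g=n\eta+m\frac\tau2+\frac12$. If moreover $\Phi$ is even, then its values at these two points are $[\mathrm M^{(k)}(n\eta+m\frac\tau2)\Phi](z)$ and $[\mathrm M^{(k)}(n\eta+m\frac\tau2+\frac12)\Phi](z)$, for $k=3$ and for $k=4$. -/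

import Mathlib

open scoped Real Topology

noncomputable section

namespace EllipticDouble

/-! ### Jacobi theta functions -/

/-- `θ₁(z|τ)`. -/
def theta1 (z τ : ℂ) : ℂ :=
  -∑' n : ℤ, Complex.exp (π * Complex.I * ((n : ℂ) + 1 / 2) ^ 2 * τ) *
    Complex.exp (2 * π * Complex.I * ((n : ℂ) + 1 / 2) * (z + 1 / 2))

/-- `θ₂(z|τ)`. -/
def theta2 (z τ : ℂ) : ℂ := theta1 (z + 1 / 2) τ

/-- `θ₃(z|τ)`. -/
def theta3 (z τ : ℂ) : ℂ :=
  Complex.exp (π * Complex.I * τ / 4 + π * Complex.I * z) * theta2 (z + τ / 2) τ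

/-- `θ₄(z|τ)`. -/
def theta4 (z τ : ℂ) : ℂ := theta3 (z + 1 / 2) τ

/-- The index `k ∈ {3, 4}`. -/
inductive ThetaIndex : Type
  | three : ThetaIndex
  | four : ThetaIndex

/-- The exchange of `3` and `4`. -/
def ThetaIndex.swap : ThetaIndex → ThetaIndex
  | .three => .four
  | .four => .three

/-- `θ_k(z|τ)` for `k ∈ {3, 4}`. -/
def theta : ThetaIndex → ℂ → ℂ → ℂ
  | .three => theta3
  | .four => theta4

/-! ### q-products and the elliptic gamma function -/

/-- `(t;p)_∞ = ∏_{k ≥ 0} (1 - t p^k)`. -/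
def qPoch (t p : ℂ) : ℂ := ∏' k : ℕ, (1 - t * p ^ k)

/-- The base `e^{2πiτ}` attached to `τ`; so `p = base τ` and `q = base (2η)`. -/
def base (τ : ℂ) : ℂ := Complex.exp (2 * π * Complex.I * τ)

/-- The constant `R(τ) = p^{-1/8} / (i (p;p)_∞)`, `p = e^{2πiτ}`. -/
def constR (τ : ℂ) : ℂ :=
  Complex.exp (-(π * Complex.I * τ / 4)) / (Complex.I * qPoch (base τ) (base τ))

/-- The elliptic gamma function `Γ(z) = Γ(z|τ,2η)`. At a pole one of the factors has the value
`0` in Lean, so that `1 / Γ` has its correct value `0` there. -/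
def ellGamma (τ η z : ℂ) : ℂ :=
  ∏' nm : ℕ × ℕ,
    (1 - Complex.exp (-(2 * π * Complex.I * z)) *
        base τ ^ (nm.1 + 1) * base (2 * η) ^ (nm.2 + 1)) /
      (1 - Complex.exp (2 * π * Complex.I * z) * base τ ^ nm.1 * base (2 * η) ^ nm.2)

/-! ### The intertwining operator -/

/-- The integral
`(q;q)_∞ (p;p)_∞ / 2 · ∫₀¹ Γ(±z ± x - g) / Γ(-2g, ±2x) · Φ(x) dx`,
which converges for `Im(-g ± z) > 0`. -/
def intertwinerIntegral (τ η g : ℂ) (Φ : ℂ → ℂ) (z : ℂ) : ℂ :=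
  qPoch (base (2 * η)) (base (2 * η)) * qPoch (base τ) (base τ) / 2 *
    ∫ x in (0 : ℝ)..1,
      ellGamma τ η (z + x - g) * ellGamma τ η (z - x - g) *
        ellGamma τ η (-z + x - g) * ellGamma τ η (-z - x - g) /
      (ellGamma τ η (-2 * g) * ellGamma τ η (2 * x) * ellGamma τ η (-2 * x)) * Φ x

/-- `F` is the meromorphic continuation, in the spin `g ∈ ℂ`, of the integral
`intertwinerIntegral τ η g Φ z`, which defines the operator for `Im(-g ± z) > 0`
(where `Γ(-2g) = 0` the integral has a zero denominator). Normal form means: removable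
singularities are filled in, and the value at a pole is `0`. -/
def IsSpinContinuation (τ η : ℂ) (Φ : ℂ → ℂ) (z : ℂ) (F : ℂ → ℂ) : Prop :=
  MeromorphicNFOn F Set.univ ∧
    ∀ g : ℂ, 0 < (-g + z).im → 0 < (-g - z).im → ellGamma τ η (-2 * g) ≠ 0 →
      F g = intertwinerIntegral τ η g Φ z

open Classical in
/-- The intertwining operator: `intertwiner τ η g Φ z` is `[M(g)Φ](z)`, the integral where it
converges and its meromorphic continuation in `g` elsewhere. -/
def intertwiner (τ η g : ℂ) (Φ : ℂ → ℂ) (z : ℂ) : ℂ :=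
  if h : ∃ F : ℂ → ℂ, IsSpinContinuation τ η Φ z F then h.choose g else 0

/-- The half-period shift `P = e^{∂_z/2}`. -/
def halfShift (Φ : ℂ → ℂ) : ℂ → ℂ := fun z => Φ (z + 1 / 2)

/-- Holomorphic functions of `e^{2πiz}` on `ℂ \ {0}`: entire functions of `z` with period `1`. -/
def IsTestFunction (Φ : ℂ → ℂ) : Prop :=
  Differentiable ℂ Φ ∧ ∀ z, Φ (z + 1) = Φ z

/-! ### The difference operators -/

/-- The operator `A_k(g)`. -/
def opA (τ η : ℂ) (k : ThetaIndex) (g : ℂ) (Φ : ℂ → ℂ) : ℂ → ℂ := fun z =>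
  Complex.exp (π * Complex.I * z ^ 2 / η) *
    (Complex.exp (π * Complex.I * η) / constR τ / theta1 (2 * z) τ) *
    (theta k (z + g + η) (τ / 2) *
        (Complex.exp (-(π * Complex.I * (z + η) ^ 2 / η)) * Φ (z + η)) -
      theta k (z - g - η) (τ / 2) *
        (Complex.exp (-(π * Complex.I * (z - η) ^ 2 / η)) * Φ (z - η)))

/-- The operator `B_k(g)`. -/
def opB (τ η : ℂ) (k : ThetaIndex) (g : ℂ) (Φ : ℂ → ℂ) : ℂ → ℂ := fun z =>
  Complex.exp (2 * π * Complex.I * z ^ 2 / τ) *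
    (Complex.exp (π * Complex.I * (τ / 2)) / constR (2 * η) / theta1 (2 * z) (2 * η)) *
    (theta k (z + g + τ / 2) η *
        (Complex.exp (-(2 * π * Complex.I * (z + τ / 2) ^ 2 / τ)) * Φ (z + τ / 2)) -
      theta k (z - g - τ / 2) η *
        (Complex.exp (-(2 * π * Complex.I * (z - τ / 2) ^ 2 / τ)) * Φ (z - τ / 2)))

/-- `A_k(s + (n-1)η) ⋯ A_k(s + η) A_k(s)`. -/
def prodA (τ η : ℂ) (k : ThetaIndex) (s : ℂ) : ℕ → (ℂ → ℂ) → ℂ → ℂ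
  | 0, Φ => Φ
  | n + 1, Φ => opA τ η k (s + n * η) (prodA τ η k s n Φ)

/-- `B_k(s + (m-1)τ/2) ⋯ B_k(s + τ/2) B_k(s)`. -/
def prodB (τ η : ℂ) (k : ThetaIndex) (s : ℂ) : ℕ → (ℂ → ℂ) → ℂ → ℂ
  | 0, Φ => Φ
  | m + 1, Φ => opB τ η k (s + m * (τ / 2)) (prodB τ η k s m Φ)

/-- The factored difference operator `M^{(k)}(nη + mτ/2)`. -/
def factoredM (τ η : ℂ) (k : ThetaIndex) (n m : ℕ) (Φ : ℂ → ℂ) : ℂ → ℂ :=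
  prodA τ η k (m * (τ / 2)) n
    (prodB τ η k 0 m
      (fun z => (theta k z η ^ m)⁻¹ * (theta k z (τ / 2) ^ n)⁻¹ * Φ z))

/-- The factored difference operator `M^{(k)}(nη + mτ/2 + 1/2)`. -/
def factoredMHalf (τ η : ℂ) (k : ThetaIndex) (n m : ℕ) (Φ : ℂ → ℂ) : ℂ → ℂ :=
  prodA τ η k (m * (τ / 2) + 1 / 2) n
    (prodB τ η k (1 / 2) m
      (fun z => (theta k (z + 1 / 2) η ^ m)⁻¹ * (theta k (z + 1 / 2) (τ / 2) ^ n)⁻¹ *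
        halfShift Φ z))

end EllipticDouble

end

open EllipticDouble

/-!
By the reflection formula `1/(Γ(2x) Γ(-2x))` is entire, so the integrand of `M(g)` has its poles
at `x = ±(g - s)` modulo `1`, with shifts `s = ±z + jτ + 2kη`, `j, k ≥ 0`. Partial fractions
reduce the integral to integrals with poles on one side of the contour only. These are continued
in `g` by moving the contour, and each reduction costs a factor `1/(1 - e^{2πi(s + s' - 2g)})`,
singular exactly where the poles with shifts `s` and `s'` pinch the contour. At `g = mτ/2 + nη`
and for generic `z` the pinching produces simple poles in `g`, which the zero of `1/Γ(-2g)`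
cancels. Hence `M(g)Φ` is regular there, and for even `Φ` the value depends only on `Φ` at the
points `z + αη + βτ/2`, `|α| ≤ n`, `|β| ≤ m`. At `g = 0` this value is `Φ(z)`.

The three-term theta identity gives `M(g + η) θ_k(·|τ/2) = A_k(g) M(g)`, first where the integral
converges and then for all `g`; exchanging `2η` and `τ` gives the relation for `B_k`. Dividing by
`θ_k` leads out of the test functions, so `θ_k⁻¹ Φ` is replaced by a polynomial in `cos 2πx` with
the same values at the finitely many points which matter. Induction on `n` and `m` yields
`M = M^{(k)}` at `mτ/2 + nη` for incommensurate periods. In particular `M^{(3)} = M^{(4)}`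
there, and as the periods vary continuously and the incommensurate ones are dense,
`M^{(3)} = M^{(4)}` in general.

Translating `x` by `1/2` in the integral relates the spins `g` and `g + 1/2`, while translating
`z` by `1/2` exchanges `θ_3` and `θ_4`; this gives the statements about half-integer shifts.
-/

noncomputable section

namespace EllipticDouble

open Filter

/-- The character `e(u) = e^{2πiu}`. -/
def ee (u : ℂ) : ℂ := Complex.exp (2 * π * Complex.I * u)

lemma ee_zero : ee 0 = 1 := by simp [ee]

lemma ee_add (u v : ℂ) : ee (u + v) = ee u * ee v := by
  rw [ee, ee, ee, ← Complex.exp_add]; ring_nf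

lemma ee_neg (u : ℂ) : ee (-u) = (ee u)⁻¹ := by
  rw [ee, ee, ← Complex.exp_neg]; ring_nf

lemma ee_sub (u v : ℂ) : ee (u - v) = ee u / ee v := by
  rw [sub_eq_add_neg, ee_add, ee_neg, div_eq_mul_inv]

lemma ee_half : ee (1 / 2) = -1 := by
  rw [ee, ← Complex.exp_pi_mul_I]; ring_nf

lemma ee_ne_zero (u : ℂ) : ee u ≠ 0 := Complex.exp_ne_zero _

lemma ee_nat_mul (n : ℕ) (u : ℂ) : ee (n * u) = ee u ^ n := by
  rw [ee, ee, ← Complex.exp_nat_mul]; ring_nf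

lemma ee_one : ee 1 = 1 := by
  rw [ee, mul_one, Complex.exp_two_pi_mul_I]

lemma ee_add_one (u : ℂ) : ee (u + 1) = ee u := by rw [ee_add, ee_one, mul_one]

lemma ee_eq_one_iff (u : ℂ) : ee u = 1 ↔ ∃ n : ℤ, u = n := by
  rw [ee, Complex.exp_eq_one_iff]
  refine exists_congr fun n => ⟨fun h => ?_, fun h => by rw [h]; ring⟩
  have : (2 * π * Complex.I : ℂ) ≠ 0 := Complex.two_pi_I_ne_zero
  apply mul_left_cancel₀ this
  rw [h]; ring

lemma norm_ee (u : ℂ) : ‖ee u‖ = Real.exp (-(2 * π * u.im)) := by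
  rw [ee, Complex.norm_exp]
  congr 1
  simp [Complex.mul_re, Complex.mul_im]

lemma norm_ee_lt_one {u : ℂ} (hu : 0 < u.im) : ‖ee u‖ < 1 := by
  rw [norm_ee, Real.exp_lt_one_iff]
  have := Real.pi_pos
  nlinarith [mul_pos this hu]

lemma one_sub_ee_ne_zero {u : ℂ} (hu : u.im ≠ 0) : 1 - ee u ≠ 0 := by
  intro h
  obtain ⟨n, rfl⟩ := (ee_eq_one_iff u).1 (sub_eq_zero.1 h).symm
  simp at hu

lemma differentiable_ee : Differentiable ℂ ee := by unfold ee; fun_prop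

lemma hasDerivAt_ee (u : ℂ) : HasDerivAt ee (2 * π * Complex.I * ee u) u := by
  have := ((hasDerivAt_id u).const_mul (2 * π * Complex.I)).cexp
  refine this.congr_deriv ?_
  simp [ee, mul_comm]

lemma base_eq_ee (τ : ℂ) : base τ = ee τ := rfl

/-! ### Infinite products -/

lemma norm_pow_succ_lt_one {p : ℂ} (hp : ‖p‖ < 1) (k : ℕ) : ‖p ^ (k + 1)‖ < 1 := by
  rw [norm_pow]
  exact pow_lt_one₀ (norm_nonneg _) hp k.succ_ne_zero

lemma one_sub_pow_ne_zero {p : ℂ} (hp : ‖p‖ < 1) (k : ℕ) : 1 - p ^ (k + 1) ≠ 0 := fun h => by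
  have hlt := norm_pow_succ_lt_one hp k
  rw [← sub_eq_zero.1 h, norm_one] at hlt
  exact lt_irrefl _ hlt

lemma differentiable_tprod_one_add {ι : Type*} {f : ι → ℂ → ℂ} {a : ι → ℂ} {C : ℂ → ℝ}
    (ha : Summable fun i => ‖a i‖) (hC : Continuous C) (hf : ∀ i, Differentiable ℂ (f i))
    (hbound : ∀ i z, ‖f i z‖ ≤ C z * ‖a i‖) :
    Differentiable ℂ fun z => ∏' i, (1 + f i z) := by
  intro z
  have hopen : IsOpen {w | C w < C z + 1} := isOpen_lt hC continuous_const
  have hz : z ∈ {w | C w < C z + 1} := lt_add_one (C z)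
  have hprod := Summable.hasProdLocallyUniformlyOn_one_add hopen (ha.mul_left (C z + 1))
    (Eventually.of_forall fun i w hw => (hbound i w).trans
      (mul_le_mul_of_nonneg_right (le_of_lt hw) (norm_nonneg _)))
    fun i => (hf i).continuous.continuousOn
  refine ((hprod.differentiableOn (.of_forall fun s => ?_) hopen) z hz).differentiableAt
    (hopen.mem_nhds hz)
  simpa only [Finset.prod_fn] using
    DifferentiableOn.finsetProd fun i _ => ((hf i).const_add 1).differentiableOn

lemma summable_norm_geometric (t : ℂ) {p : ℂ} (hp : ‖p‖ < 1) :
    Summable fun k : ℕ => ‖-(t * p ^ k)‖ := by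
  simpa using (summable_geometric_of_lt_one (norm_nonneg _) hp).mul_left ‖t‖

lemma multipliable_qPoch (t : ℂ) {p : ℂ} (hp : ‖p‖ < 1) :
    Multipliable fun k : ℕ => 1 - t * p ^ k := by
  simpa [sub_eq_add_neg] using multipliable_one_add_of_summable (summable_norm_geometric t hp)

lemma tendsto_qPoch (t : ℂ) {p : ℂ} (hp : ‖p‖ < 1) :
    Tendsto (fun n : ℕ => ∏ k ∈ Finset.range n, (1 - t * p ^ k)) atTop (𝓝 (qPoch t p)) :=
  (multipliable_qPoch t hp).hasProd.tendsto_prod_nat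

lemma qPoch_eq_one_sub_mul (t : ℂ) {p : ℂ} (hp : ‖p‖ < 1) :
    qPoch t p = (1 - t) * qPoch (t * p) p := by
  have h1 := (tendsto_qPoch t hp).comp (tendsto_add_atTop_nat 1)
  have h2 := (tendsto_qPoch (t * p) hp).const_mul (1 - t)
  refine tendsto_nhds_unique h1 (h2.congr fun n => ?_)
  simp only [Function.comp, Finset.prod_range_succ']
  rw [pow_zero, mul_one, mul_comm]
  congr 1
  exact Finset.prod_congr rfl fun k _ => by ring

lemma qPoch_ne_zero {t p : ℂ} (hp : ‖p‖ < 1) (h : ∀ k : ℕ, t * p ^ k ≠ 1) : qPoch t p ≠ 0 := by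
  have := tprod_one_add_ne_zero_of_summable (f := fun k : ℕ => -(t * p ^ k))
    (fun k hk => h k (by linear_combination -hk)) (summable_norm_geometric t hp)
  simpa [qPoch, sub_eq_add_neg] using this

lemma qPoch_self_ne_zero {p : ℂ} (hp : ‖p‖ < 1) : qPoch p p ≠ 0 :=
  qPoch_ne_zero hp fun k hk =>
    one_sub_pow_ne_zero hp k (by rw [pow_succ', hk, sub_self])

lemma differentiable_qPoch_left {p : ℂ} (hp : ‖p‖ < 1) : Differentiable ℂ fun t => qPoch t p := by
  have h := differentiable_tprod_one_add (f := fun (k : ℕ) (t : ℂ) => -(t * p ^ k))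
    (a := fun k => p ^ k) (C := norm)
    (by simpa only [norm_pow] using summable_geometric_of_lt_one (norm_nonneg _) hp)
    continuous_norm (fun k => by fun_prop) fun k t => by rw [norm_neg, norm_mul]
  simpa only [qPoch, sub_eq_add_neg] using h

/-! ### The Jacobi triple product -/

/-- The finite `q`-Pochhammer symbol `(p;p)_n = ∏_{k=1}^n (1 - p^k)`. -/
def finPoch (p : ℂ) (n : ℕ) : ℂ := ∏ k ∈ Finset.range n, (1 - p ^ (k + 1))

lemma finPoch_succ (p : ℂ) (n : ℕ) : finPoch p (n + 1) = finPoch p n * (1 - p ^ (n + 1)) := by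
  rw [finPoch, Finset.prod_range_succ]; rfl

lemma finPoch_ne_zero {p : ℂ} (hp : ‖p‖ < 1) (n : ℕ) : finPoch p n ≠ 0 :=
  Finset.prod_ne_zero_iff.2 fun k _ => one_sub_pow_ne_zero hp k

lemma tendsto_finPoch {p : ℂ} (hp : ‖p‖ < 1) :
    Tendsto (finPoch p) atTop (𝓝 (qPoch p p)) :=
  (tendsto_qPoch p hp).congr fun n => Finset.prod_congr rfl fun k _ => by rw [pow_succ']

/-- The sum `∑ q^{j(j-1)/2} x^j / ((q;q)_i (q;q)_j)` over `i + j = M`, the expanded side of the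
finite `q`-binomial theorem divided by `(q;q)_M`. -/
def qBinomialSum (q x : ℂ) (M : ℕ) : ℂ :=
  ∑ ij ∈ Finset.HasAntidiagonal.antidiagonal M,
    q ^ (ij.2.choose 2) * x ^ ij.2 / (finPoch q ij.1 * finPoch q ij.2)

lemma qBinomialSum_succ {q : ℂ} (hq : ‖q‖ < 1) (x : ℂ) (M : ℕ) :
    (1 - q ^ (M + 1)) * qBinomialSum q x (M + 1) = (1 + x * q ^ M) * qBinomialSum q x M := by
  have hleft : ∑ ij ∈ Finset.HasAntidiagonal.antidiagonal (M + 1), (1 - q ^ ij.1) *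
      (q ^ (ij.2.choose 2) * x ^ ij.2 / (finPoch q ij.1 * finPoch q ij.2)) =
      qBinomialSum q x M := by
    rw [Finset.Nat.sum_antidiagonal_succ]
    simp only [pow_zero, sub_self, zero_mul, zero_add]
    refine Finset.sum_congr rfl fun ij _ => ?_
    rw [finPoch_succ]
    have := one_sub_pow_ne_zero hq ij.1
    have := finPoch_ne_zero hq ij.1
    have := finPoch_ne_zero hq ij.2
    field_simp
  have hright : ∑ ij ∈ Finset.HasAntidiagonal.antidiagonal (M + 1), q ^ ij.1 * (1 - q ^ ij.2) *
      (q ^ (ij.2.choose 2) * x ^ ij.2 / (finPoch q ij.1 * finPoch q ij.2)) =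
      x * q ^ M * qBinomialSum q x M := by
    rw [Finset.Nat.sum_antidiagonal_succ']
    simp only [pow_zero, sub_self, zero_mul, mul_zero, zero_add]
    rw [qBinomialSum, Finset.mul_sum]
    refine Finset.sum_congr rfl fun ij hij => ?_
    rw [finPoch_succ, Nat.choose_succ_succ' ij.2 1, Nat.choose_one_right,
      ← Finset.HasAntidiagonal.mem_antidiagonal.1 hij]
    have := one_sub_pow_ne_zero hq ij.2
    have := finPoch_ne_zero hq ij.1
    have := finPoch_ne_zero hq ij.2
    field_simp
    ring
  -- `1 - q^{i+j} = (1 - q^i) + q^i (1 - q^j)` splits the left-hand side.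
  rw [add_mul, one_mul, ← hright, ← hleft, ← Finset.sum_add_distrib, qBinomialSum, Finset.mul_sum]
  refine Finset.sum_congr rfl fun ij hij => ?_
  rw [← Finset.HasAntidiagonal.mem_antidiagonal.1 hij, pow_add]
  ring

lemma qBinomialSum_eq {q : ℂ} (hq : ‖q‖ < 1) (x : ℂ) (M : ℕ) :
    qBinomialSum q x M = (∏ k ∈ Finset.range M, (1 + x * q ^ k)) / finPoch q M := by
  induction M with
  | zero => simp [qBinomialSum, finPoch]
  | succ M ih =>
    have h1 := one_sub_pow_ne_zero hq M
    have h2 := finPoch_ne_zero hq M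
    apply mul_left_cancel₀ h1
    rw [qBinomialSum_succ hq, ih, finPoch_succ, Finset.prod_range_succ]
    field_simp

lemma prod_one_sub_ee_neg (u τ : ℂ) (N : ℕ) :
    ∏ k ∈ Finset.range N, (1 - ee (u - (k + 1) * τ)) =
      ee (N * (u + 1 / 2) - N * (N + 1) / 2 * τ) *
        ∏ k ∈ Finset.range N, (1 - ee ((k + 1) * τ - u)) := by
  induction N with
  | zero => simp [ee_zero]
  | succ N ih =>
    rw [Finset.prod_range_succ, Finset.prod_range_succ, ih]
    have h1 : ee (((N + 1 : ℕ) : ℂ) * (u + 1 / 2) - (N + 1 : ℕ) * ((N + 1 : ℕ) + 1) / 2 * τ) =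
        ee (N * (u + 1 / 2) - N * (N + 1) / 2 * τ) * (-ee (u - (N + 1) * τ)) := by
      rw [neg_eq_neg_one_mul, ← ee_half, ← ee_add, ← ee_add]
      congr 1; push_cast; ring
    have h2 : (-ee (u - (N + 1) * τ)) * (1 - ee ((N + 1) * τ - u)) =
        1 - ee (u - (N + 1) * τ) := by
      have : ee (u - (N + 1) * τ) * ee ((N + 1) * τ - u) = 1 := by
        rw [← ee_add, ← ee_zero]; congr 1; ring
      linear_combination this
    rw [h1, ← h2]
    ring

lemma prod_range_two_mul_one_add_ee (τ u : ℂ) (N : ℕ) :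
    ∏ k ∈ Finset.range (2 * N), (1 + ee (u + 1 / 2 - N * τ) * ee τ ^ k) =
      ee (N * (u + 1 / 2) - N * (N + 1) / 2 * τ) *
        ((∏ k ∈ Finset.range N, (1 - ee u * ee τ ^ k)) *
          ∏ k ∈ Finset.range N, (1 - ee (τ - u) * ee τ ^ k)) := by
  have hlow : ∏ k ∈ Finset.range N, (1 + ee (u + 1 / 2 - N * τ) * ee τ ^ k) =
      ∏ k ∈ Finset.range N, (1 - ee (u - (k + 1) * τ)) := by
    rw [← Finset.prod_range_reflect]
    refine Finset.prod_congr rfl fun k hk => ?_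
    have hk' := Finset.mem_range.1 hk
    rw [← ee_nat_mul, Nat.cast_sub (by omega), Nat.cast_sub (by omega), ← ee_add,
      sub_eq_add_neg 1, neg_eq_neg_one_mul, ← ee_half, ← ee_add]
    congr 2; push_cast; ring
  have hhigh : ∏ k ∈ Finset.range N, (1 + ee (u + 1 / 2 - N * τ) * ee τ ^ (N + k)) =
      ∏ k ∈ Finset.range N, (1 - ee u * ee τ ^ k) := by
    refine Finset.prod_congr rfl fun k _ => ?_
    rw [← ee_nat_mul, ← ee_nat_mul, ← ee_add, ← ee_add, sub_eq_add_neg 1, neg_eq_neg_one_mul,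
      ← ee_half, ← ee_add]
    congr 2; push_cast; ring
  have hrefl : ∏ k ∈ Finset.range N, (1 - ee ((k + 1) * τ - u)) =
      ∏ k ∈ Finset.range N, (1 - ee (τ - u) * ee τ ^ k) := by
    refine Finset.prod_congr rfl fun k _ => ?_
    rw [← ee_nat_mul, ← ee_add]
    congr 2; ring
  rw [two_mul, Finset.prod_range_add, hlow, prod_one_sub_ee_neg, hhigh, hrefl]
  ring

lemma ee_pow_choose_two_mul_ee_pow (τ u : ℂ) (N j : ℕ) :
    ee τ ^ j.choose 2 * ee (u + 1 / 2 - N * τ) ^ j =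
      ee (N * (u + 1 / 2) - N * (N + 1) / 2 * τ) *
        jacobiTheta₂_term (j - N) (u + 1 / 2 - τ / 2) τ := by
  rw [← ee_nat_mul, ← ee_nat_mul, ← ee_add, Nat.cast_choose_two, jacobiTheta₂_term]
  simp only [ee]
  rw [← Complex.exp_add]
  congr 1; push_cast; ring

lemma finite_triple_product {τ : ℂ} (hτ : 0 < τ.im) (u : ℂ) (N : ℕ) :
    ∑ n ∈ Finset.Icc (-N : ℤ) N, jacobiTheta₂_term n (u + 1 / 2 - τ / 2) τ /
        (finPoch (ee τ) (N - n).toNat * finPoch (ee τ) (N + n).toNat) =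
      (∏ k ∈ Finset.range N, (1 - ee u * ee τ ^ k)) *
        (∏ k ∈ Finset.range N, (1 - ee (τ - u) * ee τ ^ k)) / finPoch (ee τ) (2 * N) := by
  have h := qBinomialSum_eq (norm_ee_lt_one hτ) (ee (u + 1 / 2 - N * τ)) (2 * N)
  rw [prod_range_two_mul_one_add_ee, mul_div_assoc] at h
  refine mul_left_cancel₀ (ee_ne_zero (N * (u + 1 / 2) - N * (N + 1) / 2 * τ)) (Eq.trans ?_ h)
  rw [qBinomialSum, Finset.Nat.sum_antidiagonal_eq_sum_range_succ_mk, Finset.mul_sum]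
  refine Finset.sum_nbij' (fun n => (N - n).toNat) (fun j => (N : ℤ) - j) ?_ ?_ ?_ ?_ ?_
  · intro n hn; simp only [Finset.mem_Icc, Finset.mem_range] at *; omega
  · intro n hn; simp only [Finset.mem_Icc, Finset.mem_range] at *; omega
  · intro n hn; simp only [Finset.mem_Icc] at *; omega
  · intro n hn; simp only [Finset.mem_range] at *; omega
  · intro n hn
    have hbounds := Finset.mem_Icc.1 hn
    obtain ⟨j, rfl⟩ : ∃ j : ℕ, n = (j : ℤ) - N := ⟨(N + n).toNat, by omega⟩
    have hj : (N + ((j : ℤ) - N)).toNat = j := by omega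
    have hj' : 2 * N - (N - ((j : ℤ) - N)).toNat = j := by omega
    simp only [hj, hj']
    rw [ee_pow_choose_two_mul_ee_pow, mul_div_assoc']

lemma exists_norm_inv_finPoch_le {p : ℂ} (hp : ‖p‖ < 1) : ∃ C : ℝ, ∀ n, ‖(finPoch p n)⁻¹‖ ≤ C :=
  have hinv := (tendsto_finPoch hp).inv₀ (qPoch_self_ne_zero hp)
  have ⟨C, hC⟩ := (Metric.isBounded_range_of_tendsto _ hinv).exists_norm_le
  ⟨C, fun n => hC _ ⟨n, rfl⟩⟩

lemma tendsto_sum_div_finPoch {p : ℂ} (hp : ‖p‖ < 1) {T : ℤ → ℂ} (hT : Summable T) :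
    Tendsto (fun N : ℕ => ∑ n ∈ Finset.Icc (-N : ℤ) N,
        T n / (finPoch p (N - n).toNat * finPoch p (N + n).toNat)) atTop
      (𝓝 ((∑' n, T n) / (qPoch p p * qPoch p p))) := by
  obtain ⟨C, hC⟩ := exists_norm_inv_finPoch_le hp
  have hC0 : 0 ≤ C := (norm_nonneg _).trans (hC 0)
  have hlim := tendsto_finPoch hp
  have hne := qPoch_self_ne_zero hp
  set G : ℕ → ℤ → ℂ := fun N n => if n ∈ Finset.Icc (-N : ℤ) N then
    T n / (finPoch p (N - n).toNat * finPoch p (N + n).toNat) else 0 with hG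
  have hsum : ∀ N : ℕ, ∑' n, G N n = ∑ n ∈ Finset.Icc (-N : ℤ) N,
      T n / (finPoch p (N - n).toNat * finPoch p (N + n).toNat) := fun N => by
    rw [tsum_eq_sum fun n hn => if_neg hn]
    exact Finset.sum_congr rfl fun n hn => if_pos hn
  simp only [← hsum, ← tsum_div_const]
  refine tendsto_tsum_of_dominated_convergence (bound := fun n => ‖T n‖ * (C * C))
    (hT.norm.mul_right _) (fun n => ?_) (Eventually.of_forall fun N n => ?_)
  · have hsub : Tendsto (fun N : ℕ => ((N : ℤ) - n).toNat) atTop atTop :=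
      tendsto_atTop.2 fun b => by
        filter_upwards [eventually_ge_atTop (b + n.natAbs)] with N hN; omega
    have hadd : Tendsto (fun N : ℕ => ((N : ℤ) + n).toNat) atTop atTop :=
      tendsto_atTop.2 fun b => by
        filter_upwards [eventually_ge_atTop (b + n.natAbs)] with N hN; omega
    refine ((tendsto_const_nhds (x := T n)).div ((hlim.comp hsub).mul (hlim.comp hadd))
      (mul_ne_zero hne hne)).congr' ?_
    filter_upwards [eventually_ge_atTop n.natAbs] with N hN
    exact (if_pos (Finset.mem_Icc.2 ⟨by omega, by omega⟩)).symm
  · rw [hG]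
    dsimp only
    split_ifs
    · rw [div_eq_mul_inv, mul_inv, norm_mul, norm_mul]
      exact mul_le_mul_of_nonneg_left
        (mul_le_mul (hC _) (hC _) (norm_nonneg _) hC0) (norm_nonneg _)
    · rw [norm_zero]; positivity

theorem jacobi_triple_product {τ : ℂ} (hτ : 0 < τ.im) (u : ℂ) :
    jacobiTheta₂ (u + 1 / 2 - τ / 2) τ =
      qPoch (ee u) (ee τ) * qPoch (ee (τ - u)) (ee τ) * qPoch (ee τ) (ee τ) := by
  have hp := norm_ee_lt_one hτ
  have hne := qPoch_self_ne_zero hp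
  have hseries := hasSum_jacobiTheta₂_term (u + 1 / 2 - τ / 2) hτ
  have hsum := tendsto_sum_div_finPoch hp hseries.summable
  have hprod := ((tendsto_qPoch (ee u) hp).mul (tendsto_qPoch (ee (τ - u)) hp)).div
    ((tendsto_finPoch hp).comp (tendsto_id.const_mul_atTop' two_pos)) hne
  have h := tendsto_nhds_unique hsum
    (hprod.congr fun N => (finite_triple_product hτ u N).symm)
  rw [hseries.tsum_eq, div_eq_div_iff (mul_ne_zero hne hne) hne] at h
  apply mul_right_cancel₀ hne
  linear_combination h

lemma theta1_eq_jacobiTheta₂ (z τ : ℂ) : theta1 z τ =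
    -(ee (τ / 8 + z / 2 + 1 / 4) * jacobiTheta₂ (z + 1 / 2 + τ / 2) τ) := by
  rw [theta1, jacobiTheta₂, ← tsum_mul_left]
  congr 2
  ext n
  rw [jacobiTheta₂_term, ee, ← Complex.exp_add, ← Complex.exp_add]
  ring_nf

lemma jacobiTheta₂_add_period (z τ : ℂ) :
    jacobiTheta₂ (z + τ) τ = ee (-τ / 2 - z) * jacobiTheta₂ z τ := by
  rw [jacobiTheta₂_add_left', ee]
  ring_nf

lemma theta3_eq_jacobiTheta₂ (z τ : ℂ) : theta3 z τ = jacobiTheta₂ z τ := by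
  rw [theta3, theta2, theta1_eq_jacobiTheta₂]
  have e : z + τ / 2 + 1 / 2 + 1 / 2 + τ / 2 = z + τ + 1 := by ring
  rw [e, jacobiTheta₂_add_left, jacobiTheta₂_add_period]
  have : Complex.exp (π * Complex.I * τ / 4 + π * Complex.I * z) = ee (τ / 8 + z / 2) := by
    rw [ee]; ring_nf
  rw [this, neg_eq_neg_one_mul (ee _ * _), ← ee_half]
  have h : ee (τ / 8 + z / 2) * ee (1 / 2) * ee (τ / 8 + (z + τ / 2 + 1 / 2) / 2 + 1 / 4) *
      ee (-τ / 2 - z) = 1 := by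
    rw [← ee_add, ← ee_add, ← ee_add]; ring_nf; exact ee_one
  linear_combination (jacobiTheta₂ z τ) * h

lemma theta4_eq_jacobiTheta₂ (z τ : ℂ) : theta4 z τ = jacobiTheta₂ (z + 1 / 2) τ := by
  rw [theta4, theta3_eq_jacobiTheta₂]

/-- The multiplicative theta function `θ(e^{2πiu};p) = (e^{2πiu};p)(p e^{-2πiu};p)`. -/
def shortTheta (τ u : ℂ) : ℂ := qPoch (ee u) (ee τ) * qPoch (ee (τ - u)) (ee τ)

lemma constR_mul_theta1 {τ : ℂ} (hτ : 0 < τ.im) (z : ℂ) :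
    constR τ * theta1 z τ = ee (-z / 2) * shortTheta τ z := by
  have hQ := qPoch_self_ne_zero (norm_ee_lt_one hτ)
  have e : z + 1 / 2 + τ / 2 = (z + 1 / 2 - τ / 2) + τ := by ring
  rw [theta1_eq_jacobiTheta₂, e, jacobiTheta₂_add_period, jacobi_triple_product hτ, constR,
    base_eq_ee, shortTheta]
  have h1 : Complex.exp (-(π * Complex.I * τ / 4)) = ee (-τ / 8) := by rw [ee]; ring_nf
  have h2 : Complex.I = ee (1 / 4) := by
    rw [ee]; refine Complex.exp_pi_div_two_mul_I.symm.trans ?_; congr 1; ring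
  have h4 : -(ee (τ / 8 + z / 2 + 1 / 4)) * ee (-τ / 2 - (z + 1 / 2 - τ / 2)) * ee (-τ / 8) =
      ee (1 / 4) * ee (-z / 2) := by
    rw [neg_eq_neg_one_mul, ← ee_half]
    simp only [← ee_add]
    ring_nf
  rw [h1, h2]
  have h3 := ee_ne_zero (1 / 4)
  rw [div_mul_eq_mul_div, div_eq_iff (mul_ne_zero h3 hQ)]
  linear_combination (qPoch (ee z) (ee τ) * qPoch (ee (τ - z)) (ee τ) * qPoch (ee τ) (ee τ)) * h4

/-! ### The addition formula -/

lemma ee_int_half (n : ℤ) : ee (n / 2) = (-1) ^ n := by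
  rw [← ee_half, ee, ee, ← Complex.exp_int_mul]; ring_nf

lemma tsum_eq_tsum_of_opposite_parity (F : ℤ × ℤ → ℂ) :
    ∑' mn : ℤ × ℤ, ((-1 : ℂ) ^ mn.1 - (-1) ^ mn.2) * F mn =
      ∑' kl : ℤ × ℤ, 2 * (ee (((kl.1 + kl.2 + 1 : ℤ) : ℂ) / 2) *
        F (kl.1 + kl.2 + 1, kl.1 - kl.2)) := by
  have hφ : Function.Injective fun kl : ℤ × ℤ => (kl.1 + kl.2 + 1, kl.1 - kl.2) := by
    rintro ⟨k, l⟩ ⟨k', l'⟩ h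
    simp only [Prod.mk.injEq] at h ⊢
    omega
  have hsupp : (Function.support fun mn : ℤ × ℤ => ((-1 : ℂ) ^ mn.1 - (-1) ^ mn.2) * F mn) ⊆
      Set.range fun kl : ℤ × ℤ => (kl.1 + kl.2 + 1, kl.1 - kl.2) := by
    rintro ⟨m, n⟩ hmn
    have hne : ((-1 : ℂ) ^ m - (-1) ^ n) ≠ 0 := left_ne_zero_of_mul hmn
    obtain ⟨k, hk⟩ : ∃ k, m + n = 2 * k + 1 := by
      rcases Int.even_or_odd m with hm | hm <;> rcases Int.even_or_odd n with hn | hn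
      · simp [hm.neg_one_zpow, hn.neg_one_zpow] at hne
      · exact hm.add_odd hn
      · exact hm.add_even hn
      · simp [hm.neg_one_zpow, hn.neg_one_zpow] at hne
    exact ⟨(k, m - k - 1), by simp only [Prod.mk.injEq]; omega⟩
  refine Eq.trans (hφ.tsum_eq hsupp).symm (tsum_congr fun ⟨k, l⟩ => ?_)
  have hpar : ((-1 : ℂ) ^ (k + l + 1) - (-1) ^ (k - l)) = 2 * ee (((k + l + 1 : ℤ) : ℂ) / 2) := by
    rw [ee_int_half]
    have : (k - l) = (k + l + 1) - (2 * l + 1) := by ring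
    rw [this, zpow_sub₀ (by norm_num), Odd.neg_one_zpow ⟨l, rfl⟩]; ring
  simp only [hpar, mul_assoc]

lemma im_half_pos {τ : ℂ} (hτ : 0 < τ.im) : 0 < (τ / 2).im := by
  have : (τ / 2).im = τ.im / 2 := by simp
  rw [this]; linarith

lemma hasSum_jacobiTheta₂_mul {τ τ' : ℂ} (hτ : 0 < τ.im) (hτ' : 0 < τ'.im) (x y : ℂ) :
    HasSum (fun mn : ℤ × ℤ => jacobiTheta₂_term mn.1 x τ * jacobiTheta₂_term mn.2 y τ')
      (jacobiTheta₂ x τ * jacobiTheta₂ y τ') := by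
  have h1 := ((summable_jacobiTheta₂_term_iff x τ).2 hτ).norm
  have h2 := ((summable_jacobiTheta₂_term_iff y τ').2 hτ').norm
  have := (summable_mul_of_summable_norm h1 h2).hasSum
  rwa [← tsum_mul_tsum_of_summable_norm h1 h2] at this

lemma jacobiTheta₂_term_add_half (n : ℤ) (z τ : ℂ) :
    jacobiTheta₂_term n (z + 1 / 2) τ = (-1) ^ n * jacobiTheta₂_term n z τ := by
  rw [← ee_int_half]
  simp only [jacobiTheta₂_term, ee]
  rw [← Complex.exp_add]; ring_nf

lemma two_mul_theta1_mul_theta1 {τ : ℂ} (hτ : 0 < τ.im) (x y : ℂ) :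
    2 * (theta1 (x + y) τ * theta1 (x - y) τ) =
      theta4 x (τ / 2) * theta3 y (τ / 2) - theta4 y (τ / 2) * theta3 x (τ / 2) := by
  have hτ2 := im_half_pos hτ
  have h1 := (hasSum_jacobiTheta₂_mul hτ2 hτ2 (x + 1 / 2) y).sub
    (hasSum_jacobiTheta₂_mul hτ2 hτ2 x (y + 1 / 2))
  have h2 := (hasSum_jacobiTheta₂_mul hτ hτ (x + y + 1 / 2 + τ / 2)
    (x - y + 1 / 2 + τ / 2)).mul_left
      (2 * (ee (τ / 8 + (x + y) / 2 + 1 / 4) * ee (τ / 8 + (x - y) / 2 + 1 / 4)))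
  have h3 := tsum_eq_tsum_of_opposite_parity
    fun mn => jacobiTheta₂_term mn.1 x (τ / 2) * jacobiTheta₂_term mn.2 y (τ / 2)
  have e1 : ∀ mn : ℤ × ℤ, ((-1 : ℂ) ^ mn.1 - (-1) ^ mn.2) *
      (jacobiTheta₂_term mn.1 x (τ / 2) * jacobiTheta₂_term mn.2 y (τ / 2)) =
      jacobiTheta₂_term mn.1 (x + 1 / 2) (τ / 2) * jacobiTheta₂_term mn.2 y (τ / 2) -
      jacobiTheta₂_term mn.1 x (τ / 2) * jacobiTheta₂_term mn.2 (y + 1 / 2) (τ / 2) := fun mn => by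
    rw [jacobiTheta₂_term_add_half, jacobiTheta₂_term_add_half]; ring
  have e2 : ∀ kl : ℤ × ℤ, 2 * (ee (((kl.1 + kl.2 + 1 : ℤ) : ℂ) / 2) *
      (jacobiTheta₂_term (kl.1 + kl.2 + 1) x (τ / 2) *
        jacobiTheta₂_term (kl.1 - kl.2) y (τ / 2))) =
      2 * (ee (τ / 8 + (x + y) / 2 + 1 / 4) * ee (τ / 8 + (x - y) / 2 + 1 / 4)) *
      (jacobiTheta₂_term kl.1 (x + y + 1 / 2 + τ / 2) τ *
        jacobiTheta₂_term kl.2 (x - y + 1 / 2 + τ / 2) τ) := fun kl => by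
    rw [mul_assoc]
    congr 1
    simp only [jacobiTheta₂_term, ee, ← Complex.exp_add]
    congr 1
    push_cast
    ring
  simp only [e1, e2] at h3
  rw [h1.tsum_eq, h2.tsum_eq] at h3
  simp only [theta1_eq_jacobiTheta₂, theta3_eq_jacobiTheta₂, theta4_eq_jacobiTheta₂]
  linear_combination -h3

lemma theta4_add_half (z τ : ℂ) : theta4 (z + 1 / 2) τ = theta3 z τ := by
  rw [theta4_eq_jacobiTheta₂, theta3_eq_jacobiTheta₂, ← jacobiTheta₂_add_left z, add_assoc,
    add_halves]

lemma theta_add_half (k : ThetaIndex) (z τ : ℂ) :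
    theta k (z + 1 / 2) τ = theta k.swap z τ := by
  cases k
  · rfl
  · exact theta4_add_half z τ

lemma theta_sub_half (k : ThetaIndex) (z τ : ℂ) :
    theta k (z - 1 / 2) τ = theta k.swap z τ := by
  have := theta_add_half k.swap (z - 1 / 2) τ
  rw [sub_add_cancel] at this
  cases k <;> exact this.symm

lemma theta_add_one (k : ThetaIndex) (z τ : ℂ) : theta k (z + 1) τ = theta k z τ := by
  have e : z + 1 = z + 1 / 2 + 1 / 2 := by ring
  rw [e, theta_add_half, theta_add_half]
  cases k <;> rfl

lemma theta_neg (k : ThetaIndex) (z τ : ℂ) : theta k (-z) τ = theta k z τ := by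
  cases k
  · simp only [theta, theta3_eq_jacobiTheta₂, jacobiTheta₂_neg_left]
  · simp only [theta]
    rw [theta4_eq_jacobiTheta₂, theta4_eq_jacobiTheta₂, ← jacobiTheta₂_neg_left,
      ← jacobiTheta₂_add_left]
    ring_nf

lemma differentiable_theta (k : ThetaIndex) {τ : ℂ} (hτ : 0 < τ.im) :
    Differentiable ℂ fun z => theta k z τ := by
  cases k
  · simp only [theta, theta3_eq_jacobiTheta₂]
    exact fun z => differentiableAt_jacobiTheta₂_fst z hτ
  · simp only [theta, theta4_eq_jacobiTheta₂]
    exact fun z => (differentiableAt_jacobiTheta₂_fst (z + 1 / 2) hτ).comp z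
      (differentiableAt_id.add_const _)

lemma differentiable_theta1 {τ : ℂ} (hτ : 0 < τ.im) :
    Differentiable ℂ fun z => theta1 z τ := by
  simp only [theta1_eq_jacobiTheta₂, ee]
  exact fun z => (DifferentiableAt.mul (by fun_prop)
    ((differentiableAt_jacobiTheta₂_fst (z + 1 / 2 + τ / 2) hτ).comp z
      ((differentiableAt_id.add_const _).add_const _))).neg

lemma theta_three_term (k : ThetaIndex) {τ : ℂ} (hτ : 0 < τ.im) (z G x : ℂ) :
    theta k (z + G) (τ / 2) * (theta1 (z - G + x) τ * theta1 (z - G - x) τ) -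
      theta k (z - G) (τ / 2) * (theta1 (z + G + x) τ * theta1 (z + G - x) τ) =
    theta k x (τ / 2) * (theta1 (2 * z) τ * theta1 (-2 * G) τ) := by
  have h1 := two_mul_theta1_mul_theta1 hτ (z - G) x
  have h2 := two_mul_theta1_mul_theta1 hτ (z + G) x
  have h3 := two_mul_theta1_mul_theta1 hτ (z - G) (z + G)
  have e1 : z - G + (z + G) = 2 * z := by ring
  have e2 : z - G - (z + G) = -2 * G := by ring
  rw [e1, e2] at h3
  apply mul_left_cancel₀ (two_ne_zero (α := ℂ))
  cases k <;> simp only [theta]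
  · linear_combination theta3 (z + G) (τ / 2) * h1 - theta3 (z - G) (τ / 2) * h2 -
      theta3 x (τ / 2) * h3
  · linear_combination theta4 (z + G) (τ / 2) * h1 - theta4 (z - G) (τ / 2) * h2 -
      theta4 x (τ / 2) * h3

/-! ### The double product -/

/-- The lattice vector `jτ + 2kη`. -/
def latVec (τ η : ℂ) (nm : ℕ × ℕ) : ℂ := nm.1 * τ + nm.2 * (2 * η)

lemma base_pow_mul_base_pow (τ η : ℂ) (j k : ℕ) :
    base τ ^ j * base (2 * η) ^ k = ee (latVec τ η (j, k)) := by
  rw [base_eq_ee, base_eq_ee, ← ee_nat_mul, ← ee_nat_mul, ← ee_add, latVec]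

lemma latVec_im (τ η : ℂ) (nm : ℕ × ℕ) : (latVec τ η nm).im = nm.1 * τ.im + nm.2 * (2 * η.im) := by
  simp [latVec]

lemma latVec_im_nonneg {τ η : ℂ} (hτ : 0 < τ.im) (hη : 0 < η.im) (nm : ℕ × ℕ) :
    0 ≤ (latVec τ η nm).im := by
  rw [latVec_im]; positivity

lemma im_two_mul_pos {η : ℂ} (hη : 0 < η.im) : 0 < (2 * η).im := by
  have : (2 * η).im = 2 * η.im := by simp
  rw [this]; linarith

lemma summable_norm_ee_latVec {τ η : ℂ} (hτ : 0 < τ.im) (hη : 0 < η.im) :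
    Summable fun nm => ‖ee (latVec τ η nm)‖ := by
  have h1 := summable_geometric_of_lt_one (norm_nonneg _) (norm_ee_lt_one hτ)
  have h2 := summable_geometric_of_lt_one (norm_nonneg _) (norm_ee_lt_one (im_two_mul_pos hη))
  refine (h1.mul_of_nonneg h2 (fun _ => by positivity) (fun _ => by positivity)).congr
    fun nm => ?_
  rw [← norm_pow, ← norm_pow, ← norm_mul, ← ee_nat_mul, ← ee_nat_mul, ← ee_add]; rfl

/-- `∏_{(j,k) ∉ s} (1 - e^{2πiz} p^j q^k)`. -/
def dblPochOff (τ η : ℂ) (s : Finset (ℕ × ℕ)) (z : ℂ) : ℂ :=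
  ∏' nm : ℕ × ℕ, (1 + if nm ∈ s then 0 else -ee (z + latVec τ η nm))

/-- `(e^{2πiz}; p, q)_∞`. -/
def dblPoch (τ η z : ℂ) : ℂ := dblPochOff τ η ∅ z

/-- `∏_{(j,k) ∈ s} (1 - e^{2πiz} p^j q^k)`. -/
def dblPochOn (τ η : ℂ) (s : Finset (ℕ × ℕ)) (z : ℂ) : ℂ := ∏ nm ∈ s, (1 - ee (z + latVec τ η nm))

section
variable {τ η : ℂ}

lemma norm_dblPochOff_term_le (s : Finset (ℕ × ℕ)) (z : ℂ) (nm : ℕ × ℕ) :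
    ‖if nm ∈ s then 0 else -ee (z + latVec τ η nm)‖ ≤ ‖ee z‖ * ‖ee (latVec τ η nm)‖ := by
  split_ifs
  · rw [norm_zero]; positivity
  · rw [norm_neg, ee_add, norm_mul]

lemma summable_dblPochOff (hτ : 0 < τ.im) (hη : 0 < η.im) (s : Finset (ℕ × ℕ)) (z : ℂ) :
    Summable fun nm : ℕ × ℕ => ‖if nm ∈ s then 0 else -ee (z + latVec τ η nm)‖ :=
  Summable.of_nonneg_of_le (fun _ => norm_nonneg _) (norm_dblPochOff_term_le s z)
    ((summable_norm_ee_latVec hτ hη).mul_left _)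

lemma hasProd_dblPochOff (hτ : 0 < τ.im) (hη : 0 < η.im) (s : Finset (ℕ × ℕ)) (z : ℂ) :
    HasProd (fun nm : ℕ × ℕ => 1 + if nm ∈ s then 0 else -ee (z + latVec τ η nm))
      (dblPochOff τ η s z) :=
  (multipliable_one_add_of_summable (summable_dblPochOff hτ hη s z)).hasProd

lemma hasProd_dblPoch (hτ : 0 < τ.im) (hη : 0 < η.im) (z : ℂ) :
    HasProd (fun nm : ℕ × ℕ => 1 - ee (z + latVec τ η nm)) (dblPoch τ η z) := by
  refine (hasProd_dblPochOff hτ hη ∅ z).congr_fun fun nm => ?_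
  rw [if_neg (Finset.notMem_empty _), sub_eq_add_neg]

lemma dblPochOff_ne_zero (hτ : 0 < τ.im) (hη : 0 < η.im) {s : Finset (ℕ × ℕ)} {z : ℂ}
    (h : ∀ nm ∉ s, ee (z + latVec τ η nm) ≠ 1) : dblPochOff τ η s z ≠ 0 := by
  refine tprod_one_add_ne_zero_of_summable (fun nm => ?_) (summable_dblPochOff hτ hη s z)
  split_ifs with hs
  · simp
  · intro h0; exact h nm hs (by linear_combination -h0)

lemma dblPoch_ne_zero (hτ : 0 < τ.im) (hη : 0 < η.im) {z : ℂ}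
    (h : ∀ nm, ee (z + latVec τ η nm) ≠ 1) : dblPoch τ η z ≠ 0 :=
  dblPochOff_ne_zero hτ hη fun nm _ => h nm

lemma dblPoch_ne_zero_of_im_pos (hτ : 0 < τ.im) (hη : 0 < η.im) {z : ℂ} (hz : 0 < z.im) :
    dblPoch τ η z ≠ 0 := by
  refine dblPoch_ne_zero hτ hη fun nm h => ?_
  refine one_sub_ee_ne_zero (u := z + latVec τ η nm) ?_ (by rw [h, sub_self])
  rw [Complex.add_im]
  have := latVec_im_nonneg hτ hη nm
  linarith

lemma dblPoch_eq_dblPochOn_mul_dblPochOff (hτ : 0 < τ.im) (hη : 0 < η.im)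
    (s : Finset (ℕ × ℕ)) (z : ℂ) :
    dblPoch τ η z = dblPochOn τ η s z * dblPochOff τ η s z := by
  have h1 : HasProd (fun nm : ℕ × ℕ => if nm ∈ s then 1 - ee (z + latVec τ η nm) else 1)
      (dblPochOn τ η s z) := by
    rw [dblPochOn, Finset.prod_congr rfl fun nm (hnm : nm ∈ s) =>
      (if_pos hnm : (if nm ∈ s then 1 - ee (z + latVec τ η nm) else 1) = _).symm]
    exact hasProd_prod_of_ne_finset_one fun nm hnm => if_neg hnm
  refine (hasProd_dblPoch hτ hη z).unique ((h1.mul (hasProd_dblPochOff hτ hη s z)).congr_fun ?_)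
  intro nm
  split_ifs <;> ring

lemma differentiable_dblPochOff (hτ : 0 < τ.im) (hη : 0 < η.im) (s : Finset (ℕ × ℕ)) :
    Differentiable ℂ (dblPochOff τ η s) := by
  refine differentiable_tprod_one_add (summable_norm_ee_latVec hτ hη)
    differentiable_ee.continuous.norm (fun nm => ?_) fun nm z => norm_dblPochOff_term_le s z nm
  split_ifs
  · exact differentiable_const 0
  · exact (differentiable_ee.comp (differentiable_id.add_const _)).neg

lemma differentiable_dblPoch (hτ : 0 < τ.im) (hη : 0 < η.im) : Differentiable ℂ (dblPoch τ η) :=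
  differentiable_dblPochOff hτ hη ∅

lemma dblPochOff_add_one (s : Finset (ℕ × ℕ)) (z : ℂ) :
    dblPochOff τ η s (z + 1) = dblPochOff τ η s z := by
  simp only [dblPochOff, add_right_comm z 1, ee_add_one]

lemma dblPoch_add_one (z : ℂ) : dblPoch τ η (z + 1) = dblPoch τ η z := dblPochOff_add_one ∅ z

lemma dblPoch_swap (z : ℂ) : dblPoch (2 * η) (τ / 2) z = dblPoch τ η z := by
  rw [dblPoch, dblPoch, dblPochOff, dblPochOff, ← (Equiv.prodComm ℕ ℕ).tprod_eq]
  refine tprod_congr fun nm => ?_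
  simp only [latVec, Equiv.prodComm_apply, Prod.fst_swap, Prod.snd_swap, Finset.notMem_empty,
    if_false]
  ring_nf

lemma dblPoch_eq_qPoch_mul_add_two_mul (hτ : 0 < τ.im) (hη : 0 < η.im) (z : ℂ) :
    dblPoch τ η z = qPoch (ee z) (ee τ) * dblPoch τ η (z + 2 * η) := by
  set f := fun nm : ℕ × ℕ => 1 - ee (z + latVec τ η nm) with hf
  have h1 : HasProd (fun nm : ℕ × ℕ => if nm.2 = 0 then f nm else 1)
      (qPoch (ee z) (ee τ)) := by
    have hi : Function.Injective fun j : ℕ => (j, 0) := fun j j' h => (Prod.mk.inj h).1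
    refine (hi.hasProd_iff ?_).1 ((multipliable_qPoch (ee z) (norm_ee_lt_one hτ)).hasProd.congr_fun
      fun j => ?_)
    · rintro ⟨j, k⟩ hjk
      refine if_neg fun hk => hjk ⟨j, ?_⟩
      rw [show k = 0 from hk]
    · simp only [Function.comp, if_true, hf, latVec]
      rw [← ee_nat_mul, ← ee_add]
      simp
  have h2 : HasProd (fun nm : ℕ × ℕ => if nm.2 = 0 then 1 else f nm)
      (dblPoch τ η (z + 2 * η)) := by
    have hi : Function.Injective fun jk : ℕ × ℕ => (jk.1, jk.2 + 1) := by
      rintro ⟨j, k⟩ ⟨j', k'⟩ h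
      simpa using h
    refine (hi.hasProd_iff ?_).1 ((hasProd_dblPoch hτ hη (z + 2 * η)).congr_fun fun jk => ?_)
    · rintro ⟨j, k⟩ hjk
      refine if_pos ?_
      by_contra hk
      exact hjk ⟨(j, k - 1), by simp only [Prod.mk.injEq, true_and]; simp only at hk; omega⟩
    · simp only [Function.comp, Nat.succ_ne_zero, if_false, hf, latVec]
      congr 2
      push_cast
      ring
  refine (hasProd_dblPoch hτ hη z).unique ((h1.mul h2).congr_fun fun nm => ?_)
  split_ifs <;> simp [hf]

lemma dblPoch_eq_qPoch_mul_add_tau (hτ : 0 < τ.im) (hη : 0 < η.im) (z : ℂ) :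
    dblPoch τ η z = qPoch (ee z) (ee (2 * η)) * dblPoch τ η (z + τ) := by
  have := dblPoch_eq_qPoch_mul_add_two_mul (im_two_mul_pos hη) (im_half_pos hτ) z
  rwa [dblPoch_swap, dblPoch_swap, mul_div_cancel₀ _ (two_ne_zero)] at this

/-! ### The elliptic gamma function -/

lemma ellGamma_eq_dblPoch_div (hτ : 0 < τ.im) (hη : 0 < η.im) (z : ℂ) :
    ellGamma τ η z = dblPoch τ η (τ + 2 * η - z) / dblPoch τ η z := by
  have e : ∀ nm : ℕ × ℕ, (1 - Complex.exp (-(2 * π * Complex.I * z)) *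
        base τ ^ (nm.1 + 1) * base (2 * η) ^ (nm.2 + 1)) /
      (1 - Complex.exp (2 * π * Complex.I * z) * base τ ^ nm.1 * base (2 * η) ^ nm.2) =
      (1 - ee (τ + 2 * η - z + latVec τ η nm)) / (1 - ee (z + latVec τ η nm)) := fun nm => by
    rw [mul_assoc (Complex.exp _), mul_assoc (Complex.exp (2 * π * Complex.I * z)),
      base_pow_mul_base_pow, base_pow_mul_base_pow]
    have h1 : Complex.exp (-(2 * π * Complex.I * z)) = ee (-z) := by rw [ee]; ring_nf
    have h2 : Complex.exp (2 * π * Complex.I * z) = ee z := rfl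
    rw [h1, h2, ← ee_add, ← ee_add]
    congr 3
    simp only [latVec]; push_cast; ring
  rw [ellGamma, tprod_congr e]
  by_cases h : ∀ nm, ee (z + latVec τ η nm) ≠ 1
  · exact ((hasProd_dblPoch hτ hη (τ + 2 * η - z)).div₀ (hasProd_dblPoch hτ hη z)
      (dblPoch_ne_zero hτ hη h)).tprod_eq
  · push Not at h
    obtain ⟨nm, hnm⟩ := h
    have h0 : dblPoch τ η z = 0 := by
      rw [← (hasProd_dblPoch hτ hη z).tprod_eq]
      exact tprod_of_exists_eq_zero ⟨nm, by rw [hnm, sub_self]⟩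
    rw [h0, div_zero]
    exact tprod_of_exists_eq_zero ⟨nm, by rw [hnm, sub_self, div_zero]⟩

lemma ellGamma_swap (hτ : 0 < τ.im) (hη : 0 < η.im) (z : ℂ) :
    ellGamma (2 * η) (τ / 2) z = ellGamma τ η z := by
  rw [ellGamma_eq_dblPoch_div hτ hη, ellGamma_eq_dblPoch_div (im_two_mul_pos hη) (im_half_pos hτ),
    dblPoch_swap, dblPoch_swap]
  congr 2; ring

lemma ellGamma_add_one (hτ : 0 < τ.im) (hη : 0 < η.im) (z : ℂ) :
    ellGamma τ η (z + 1) = ellGamma τ η z := by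
  rw [ellGamma_eq_dblPoch_div hτ hη, ellGamma_eq_dblPoch_div hτ hη, dblPoch_add_one,
    ← dblPoch_add_one (_ - (z + 1))]
  congr 2; ring

lemma ellGamma_add_two_mul (hτ : 0 < τ.im) (hη : 0 < η.im) {z : ℂ} (hz : dblPoch τ η z ≠ 0) :
    ellGamma τ η (z + 2 * η) = shortTheta τ z * ellGamma τ η z := by
  rw [ellGamma_eq_dblPoch_div hτ hη, ellGamma_eq_dblPoch_div hτ hη, shortTheta]
  have h1 := dblPoch_eq_qPoch_mul_add_two_mul hτ hη z
  have h2 := dblPoch_eq_qPoch_mul_add_two_mul hτ hη (τ - z)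
  have e1 : τ + 2 * η - (z + 2 * η) = τ - z := by ring
  have e2 : τ + 2 * η - z = τ - z + 2 * η := by ring
  rw [e1, e2, h1, h2]
  rw [h1] at hz
  have h3 := left_ne_zero_of_mul hz
  have h4 := right_ne_zero_of_mul hz
  field_simp

/-- The entire function `(t;p)_∞ (tq;q)_∞`, `t = e^{2πiz}`, so that
`1 / (Γ(z)Γ(-z)) = reflFactor z * reflFactor (-z)`. -/
def reflFactor (τ η z : ℂ) : ℂ := qPoch (ee z) (ee τ) * qPoch (ee (z + 2 * η)) (ee (2 * η))

lemma dblPoch_eq_reflFactor_mul (hτ : 0 < τ.im) (hη : 0 < η.im) (z : ℂ) :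
    dblPoch τ η z = reflFactor τ η z * dblPoch τ η (τ + 2 * η + z) := by
  rw [dblPoch_eq_qPoch_mul_add_two_mul hτ hη z, dblPoch_eq_qPoch_mul_add_tau hτ hη (z + 2 * η),
    reflFactor, mul_assoc]
  congr 3; ring

lemma differentiable_reflFactor (hτ : 0 < τ.im) (hη : 0 < η.im) :
    Differentiable ℂ (reflFactor τ η) :=
  ((differentiable_qPoch_left (norm_ee_lt_one hτ)).comp differentiable_ee).mul
    ((differentiable_qPoch_left (norm_ee_lt_one (im_two_mul_pos hη))).comp
      (differentiable_ee.comp (differentiable_id.add_const _)))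

lemma reflFactor_add_one (z : ℂ) : reflFactor τ η (z + 1) = reflFactor τ η z := by
  rw [reflFactor, reflFactor, add_right_comm, ee_add_one, ee_add_one]

lemma inv_ellGamma_mul (hτ : 0 < τ.im) (hη : 0 < η.im) {z : ℂ}
    (h1 : dblPoch τ η (τ + 2 * η + z) ≠ 0) (h2 : dblPoch τ η (τ + 2 * η - z) ≠ 0) :
    (ellGamma τ η z * ellGamma τ η (-z))⁻¹ = reflFactor τ η z * reflFactor τ η (-z) := by
  rw [ellGamma_eq_dblPoch_div hτ hη, ellGamma_eq_dblPoch_div hτ hη,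
    dblPoch_eq_reflFactor_mul hτ hη z,
    dblPoch_eq_reflFactor_mul hτ hη (-z), sub_neg_eq_add, ← sub_eq_add_neg]
  by_cases h3 : reflFactor τ η z = 0
  · simp [h3]
  by_cases h4 : reflFactor τ η (-z) = 0
  · simp [h4]
  field_simp

end

/-! ### Holomorphic parametric integrals and contour shifts -/

lemma aestronglyMeasurable_deriv_param {α : Type*} [MeasurableSpace α]
    {μ : MeasureTheory.Measure α} {F : ℂ → α → ℂ} {S : Set ℂ} {g₀ : ℂ} (hS : S ∈ 𝓝 g₀)
    (hF : ∀ g ∈ S, MeasureTheory.AEStronglyMeasurable (F g) μ)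
    (hd : ∀ x, DifferentiableAt ℂ (fun g => F g x) g₀) :
    MeasureTheory.AEStronglyMeasurable (fun x => deriv (fun g => F g x) g₀) μ := by
  have hne : (comap ((↑) : S → ℂ) (𝓝[≠] g₀)).NeBot :=
    NeBot.comap_of_range_mem inferInstance
      (by rw [Subtype.range_coe]; exact mem_nhdsWithin_of_mem_nhds hS)
  refine aestronglyMeasurable_of_tendsto_ae (comap ((↑) : S → ℂ) (𝓝[≠] g₀))
    (f := fun g x => slope (fun g => F g x) g₀ g) (fun g => ?_) (Eventually.of_forall fun x => ?_)
  · exact ((hF g g.2).sub (hF g₀ (mem_of_mem_nhds hS))).const_smul ((g : ℂ) - g₀)⁻¹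
  · exact (hasDerivAt_iff_tendsto_slope.1 (hd x).hasDerivAt).comp tendsto_comap

lemma differentiableOn_intervalIntegral {S : Set ℂ} (hS : IsOpen S) {F : ℂ → ℝ → ℂ} {a b : ℝ}
    (hc : ContinuousOn (Function.uncurry F) (S ×ˢ Set.univ))
    (hd : ∀ x, DifferentiableOn ℂ (fun g => F g x) S) :
    DifferentiableOn ℂ (fun g => ∫ x in a..b, F g x) S := by
  intro g₀ hg₀
  obtain ⟨r, hr, hrS⟩ := Metric.nhds_basis_closedBall.mem_iff.1 (hS.mem_nhds hg₀)
  obtain ⟨M, hM⟩ := (((isCompact_closedBall g₀ r).prod isCompact_uIcc).image_of_continuousOn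
    (hc.mono (Set.prod_mono hrS (Set.subset_univ (Set.uIcc a b))))).isBounded.exists_norm_le
  have hcx : ∀ g ∈ S, Continuous (F g) := fun g hg => by
    rw [← continuousOn_univ]
    exact hc.comp (f := fun x : ℝ => (g, x)) (by fun_prop) fun x _ => ⟨hg, trivial⟩
  have hdiff : ∀ g ∈ S, ∀ x, DifferentiableAt ℂ (fun g => F g x) g :=
    fun g hg x => (hd x g hg).differentiableAt (hS.mem_nhds hg)
  have hball : ∀ g ∈ Metric.ball g₀ (r / 2), Metric.closedBall g (r / 2) ⊆
      Metric.closedBall g₀ r := fun g hg => by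
    refine Metric.closedBall_subset_closedBall' ?_
    have := Metric.mem_ball.1 hg
    linarith
  have hderiv_le : ∀ x ∈ Set.uIoc a b, ∀ g ∈ Metric.ball g₀ (r / 2),
      ‖deriv (fun g => F g x) g‖ ≤ M / (r / 2) := fun x hx g hg => by
    refine Complex.norm_deriv_le_of_forall_mem_sphere_norm_le (by positivity)
      (DifferentiableOn.diffContOnCl ?_) fun w hw => ?_
    · exact (hd x).mono (Metric.closure_ball_subset_closedBall.trans ((hball g hg).trans hrS))
    · exact hM _ ⟨(w, x), ⟨hball g hg (Metric.sphere_subset_closedBall hw),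
        Set.uIoc_subset_uIcc hx⟩, rfl⟩
  have := intervalIntegral.hasDerivAt_integral_of_dominated_loc_of_deriv_le
    (μ := MeasureTheory.volume) (Metric.ball_mem_nhds g₀ (by positivity : 0 < r / 2))
    (by filter_upwards [hS.mem_nhds hg₀] with g hg using (hcx g hg).aestronglyMeasurable)
    ((hcx g₀ hg₀).intervalIntegrable _ _)
    (aestronglyMeasurable_deriv_param (hS.mem_nhds hg₀)
      (fun g hg => (hcx g hg).aestronglyMeasurable) (hdiff g₀ hg₀))
    (Eventually.of_forall hderiv_le) (by simp)
    (Eventually.of_forall fun x _ g hg => (hdiff g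
      (hrS (hball g hg (Metric.mem_closedBall_self (by positivity)))) x).hasDerivAt)
  exact this.2.differentiableAt.differentiableWithinAt

lemma intervalIntegral_horizontal_add_one {f : ℂ → ℂ} (hf : Function.Periodic f 1) (c y : ℝ) :
    ∫ x : ℝ in c..c + 1, f (x + y * Complex.I) = ∫ x : ℝ in (0 : ℝ)..1, f (x + y * Complex.I) := by
  have hp : Function.Periodic (fun x : ℝ => f (x + y * Complex.I)) 1 := fun x => by
    simp only
    rw [← hf (x + y * Complex.I)]; push_cast; ring_nf
  simpa only [zero_add] using hp.intervalIntegral_add_eq c 0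

lemma intervalIntegral_eq_of_differentiableOn_rectangle {f : ℂ → ℂ} (c y₁ y₂ : ℝ)
    (hd : DifferentiableOn ℂ f (Set.Icc c (c + 1) ×ℂ Set.uIcc y₁ y₂))
    (hv : ∀ y : ℝ, f (((c + 1 : ℝ) : ℂ) + y * Complex.I) = f (c + y * Complex.I)) :
    ∫ x : ℝ in c..c + 1, f (x + y₁ * Complex.I) = ∫ x : ℝ in c..c + 1, f (x + y₂ * Complex.I) := by
  have := Complex.integral_boundary_rect_eq_zero_of_differentiableOn f (c + y₁ * Complex.I)
    (((c + 1 : ℝ) : ℂ) + y₂ * Complex.I)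
  simp only [Complex.add_re, Complex.add_im, Complex.ofReal_re, Complex.ofReal_im, Complex.mul_re,
    Complex.mul_im, Complex.I_re, Complex.I_im, mul_zero, mul_one, sub_zero, add_zero, zero_add,
    hv] at this
  rw [Set.uIcc_of_le (by linarith : c ≤ c + 1)] at this
  have h := this hd
  rw [add_sub_assoc, sub_self, add_zero] at h
  exact sub_eq_zero.1 h

lemma intervalIntegral_eq_of_differentiableOn_strip {f : ℂ → ℂ} (hf : Function.Periodic f 1)
    {y₁ y₂ : ℝ} (hd : DifferentiableOn ℂ f {x | x.im ∈ Set.uIcc y₁ y₂}) :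
    ∫ x : ℝ in (0 : ℝ)..1, f (x + y₁ * Complex.I) =
      ∫ x : ℝ in (0 : ℝ)..1, f (x + y₂ * Complex.I) := by
  have := intervalIntegral_eq_of_differentiableOn_rectangle (f := f) 0 y₁ y₂
    (hd.mono fun x hx => hx.2) fun y => by
      rw [← hf (((0 : ℝ) : ℂ) + _)]; push_cast; ring_nf
  simpa using this

lemma dslope_one_sub_ee_ne_zero {u x : ℂ} (hx : |(x - u).re| < 1) :
    dslope (fun x => 1 - ee (x - u)) u x ≠ 0 := by
  by_cases hxu : x = u
  · have : HasDerivAt (fun x => 1 - ee (x - u)) (-(2 * π * Complex.I * ee (u - u))) u :=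
      ((hasDerivAt_ee (u - u)).comp_sub_const u u).const_sub 1
    rw [hxu, dslope_same, this.deriv, sub_self, ee_zero, mul_one, neg_ne_zero]
    exact Complex.two_pi_I_ne_zero
  · rw [dslope_of_ne _ hxu, slope_def_field, sub_self u, ee_zero, sub_self, sub_zero]
    refine div_ne_zero (fun h1 => ?_) (sub_ne_zero.2 hxu)
    obtain ⟨n, hn⟩ := (ee_eq_one_iff (x - u)).1 (sub_eq_zero.1 h1).symm
    rw [hn, Complex.intCast_re] at hx
    have hn0 : n = 0 := Int.abs_lt_one_iff.1 (by exact_mod_cast hx)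
    rw [hn0, Int.cast_zero] at hn
    exact hxu (sub_eq_zero.1 hn)

lemma dslope_div_dslope_of_zero {f D : ℂ → ℂ} {u x : ℂ} (hx : x ≠ u) (hf : f u = 0)
    (hD : D u = 0) : dslope f u x / dslope D u x = f x / D x := by
  rw [dslope_of_ne _ hx, dslope_of_ne _ hx, slope_def_field, slope_def_field, hf, hD, sub_zero,
    sub_zero, div_div_div_cancel_right₀ (sub_ne_zero.2 hx)]

lemma differentiableOn_dslope_div_dslope_one_sub_ee {L : ℝ} {h : ℂ → ℂ} {u : ℂ}
    (hh : DifferentiableOn ℂ h {x | |x.im| < L}) (hu : |u.im| < L) :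
    DifferentiableOn ℂ (fun x => dslope h u x / dslope (fun x => 1 - ee (x - u)) u x)
      {x | |x.im| < L ∧ |(x - u).re| < 1} := by
  have hL : {x : ℂ | |x.im| < L} ∈ 𝓝 u :=
    (isOpen_lt (f := fun w : ℂ => |w.im|) (by fun_prop) continuous_const).mem_nhds hu
  have hD : Differentiable ℂ fun x => 1 - ee (x - u) :=
    (differentiable_ee.comp (differentiable_id.sub_const u)).const_sub 1
  exact (((Complex.differentiableOn_dslope hL).2 hh).mono fun x hx => hx.1).div
    (((Complex.differentiableOn_dslope univ_mem).2 hD.differentiableOn).mono (Set.subset_univ _))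
    fun x hx => dslope_one_sub_ee_ne_zero hx.2

lemma intervalIntegral_div_one_sub_ee_eq {L y : ℝ} (hy : y < L) {h : ℂ → ℂ} {u : ℂ}
    (hh : DifferentiableOn ℂ h {x | |x.im| < L}) (hper : Function.Periodic h 1)
    (hu : |u.im| < y) (h0 : h u = 0) :
    ∫ x : ℝ in (0 : ℝ)..1, h (x + y * Complex.I) / (1 - ee (x + y * Complex.I - u)) =
      ∫ x : ℝ in (0 : ℝ)..1,
        h (x + (-y : ℝ) * Complex.I) / (1 - ee (x + (-y : ℝ) * Complex.I - u)) := by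
  set D := fun x => 1 - ee (x - u) with hD
  have hfper : Function.Periodic (fun x => h x / D x) 1 := fun x => by
    simp only [hD, hper x]
    rw [← ee_add_one (x - u)]; ring_nf
  have hq : ∀ x, x ≠ u → dslope h u x / dslope D u x = h x / D x := fun x hx =>
    dslope_div_dslope_of_zero hx h0 (by simp only [hD, sub_self, ee_zero])
  have ne_of_im : ∀ x s : ℝ, |s| = |y| → (x + s * Complex.I : ℂ) ≠ u := fun x s hs he => by
    have him : (x + s * Complex.I : ℂ).im = s := by simp
    rw [← he, him, hs] at hu
    exact (hu.trans_le (le_abs_self y)).false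
  have ne_of_re : ∀ s t : ℝ, s ≠ u.re → (s + t * Complex.I : ℂ) ≠ u := fun s t hs he => by
    have hre : (s + t * Complex.I : ℂ).re = s := by simp
    exact hs (hre.symm.trans (congrArg Complex.re he))
  set c := u.re - 1 / 2 with hc
  have hint : ∀ s : ℝ, |s| = |y| → ∫ x : ℝ in (0 : ℝ)..1, h (x + s * Complex.I) /
      D (x + s * Complex.I) = ∫ x : ℝ in c..c + 1, dslope h u (x + s * Complex.I) /
        dslope D u (x + s * Complex.I) := fun s hs => by
    rw [← intervalIntegral_horizontal_add_one hfper c s]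
    exact intervalIntegral.integral_congr fun x _ => (hq _ (ne_of_im x s hs)).symm
  refine (hint y rfl).trans (Eq.trans ?_ (hint (-y) (abs_neg y)).symm)
  refine intervalIntegral_eq_of_differentiableOn_rectangle
    (f := fun x => dslope h u x / dslope D u x) c y (-y)
    ((differentiableOn_dslope_div_dslope_one_sub_ee hh (hu.trans hy)).mono fun x hx =>
      ⟨(?_ : |x.im| ≤ y).trans_lt hy, ?_⟩) fun t => ?_
  · have him := hx.2
    rw [Set.mem_preimage, Set.uIcc_of_ge (by linarith [(abs_nonneg _).trans_lt hu])] at him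
    exact abs_le.2 him
  · have hre := hx.1
    rw [Set.mem_preimage, Set.mem_Icc] at hre
    rw [Complex.sub_re, abs_lt]
    constructor <;> linarith
  · rw [hq _ (ne_of_re _ _ (by linarith)), hq _ (ne_of_re _ _ (by linarith))]
    have := hfper (c + t * Complex.I)
    rwa [add_right_comm, ← Complex.ofReal_one, ← Complex.ofReal_add] at this

/-! ### Integrals with two families of poles -/

/-- The numerators of the pole integrals: holomorphic in the spin `g`, `Im g < C`, and in `x`,
`|Im x| < L`, with period `1` in `x`. -/
structure IsAdmissible (C L : ℝ) (H : ℂ × ℂ → ℂ) : Prop where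
  diff : DifferentiableOn ℂ H {w | w.1.im < C ∧ |w.2.im| < L}
  periodic : ∀ g x, H (g, x + 1) = H (g, x)

section
variable {ι : Type*}

/-- `∏_{i ∈ A} (1 - e^{2πi(x + a_i - g)})` at `w = (g, x)`, with zeros at `x = g - a_i`. -/
def poleUp (a : ι → ℂ) (A : Finset ι) (w : ℂ × ℂ) : ℂ := ∏ i ∈ A, (1 - ee (w.2 + a i - w.1))

/-- `∏_{i ∈ B} (1 - e^{2πi(-x + a_i - g)})` at `w = (g, x)`, with zeros at `x = a_i - g`. -/
def poleDown (a : ι → ℂ) (B : Finset ι) (w : ℂ × ℂ) : ℂ := poleUp a B (w.1, -w.2)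

/-- The integral of `H` divided by the two families of factors. -/
def poleIntegral (a : ι → ℂ) (A B : Finset ι) (H : ℂ × ℂ → ℂ) (g : ℂ) : ℂ :=
  ∫ x : ℝ in (0 : ℝ)..1, H (g, x) / (poleUp a A (g, x) * poleDown a B (g, x))

/-- The integral of `H / D` over the shifted contour `Im x = y`. -/
def shiftIntegral (D : ℂ × ℂ → ℂ) (y : ℝ) (H : ℂ × ℂ → ℂ) (g : ℂ) : ℂ :=
  ∫ x : ℝ in (0 : ℝ)..1, H (g, x + y * Complex.I) / D (g, x + y * Complex.I)

lemma differentiable_poleUp (a : ι → ℂ) (A : Finset ι) : Differentiable ℂ (poleUp a A) := by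
  classical
  intro w
  exact (HasFDerivAt.finsetProd (g := fun i (w : ℂ × ℂ) => 1 - ee (w.2 + a i - w.1)) fun i _ =>
    (((differentiable_ee.comp (by fun_prop : Differentiable ℂ
      fun w : ℂ × ℂ => w.2 + a i - w.1)).const_sub 1) w).hasFDerivAt).differentiableAt

lemma differentiable_poleDown (a : ι → ℂ) (B : Finset ι) : Differentiable ℂ (poleDown a B) :=
  (differentiable_poleUp a B).comp (by fun_prop)

lemma poleUp_periodic (a : ι → ℂ) (A : Finset ι) (g : ℂ) :
    Function.Periodic (fun x => poleUp a A (g, x)) 1 := fun x => by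
  refine Finset.prod_congr rfl fun i _ => ?_
  rw [← ee_add_one (x + a i - g)]; ring_nf

lemma poleDown_periodic (a : ι → ℂ) (B : Finset ι) (g : ℂ) :
    Function.Periodic (fun x => poleDown a B (g, x)) 1 := fun x => by
  have := poleUp_periodic a B g (-x - 1)
  rw [sub_add_cancel] at this
  simpa only [poleDown, neg_add'] using this.symm

lemma poleUp_ne_zero {a : ι → ℂ} {A : Finset ι} {g x : ℂ}
    (h : ∀ i ∈ A, g.im < (a i).im + x.im) : poleUp a A (g, x) ≠ 0 :=
  Finset.prod_ne_zero_iff.2 fun i hi => one_sub_ee_ne_zero (by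
    simp only [Complex.sub_im, Complex.add_im]
    linarith [h i hi])

lemma poleDown_ne_zero {a : ι → ℂ} {B : Finset ι} {g x : ℂ}
    (h : ∀ i ∈ B, g.im < (a i).im - x.im) : poleDown a B (g, x) ≠ 0 :=
  poleUp_ne_zero (x := -x) (by simpa only [Complex.neg_im, sub_eq_add_neg] using h)

lemma isOpen_im_lt (C : ℝ) : IsOpen {g : ℂ | g.im < C} :=
  isOpen_lt Complex.continuous_im continuous_const

lemma abs_le_max_of_mem_uIcc {s t r : ℝ} (h : r ∈ Set.uIcc s t) : |r| ≤ max |s| |t| := by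
  rcases Set.mem_uIcc.1 h with ⟨h₁, h₂⟩ | ⟨h₁, h₂⟩
  · exact abs_le_max_abs_abs h₁ h₂
  · exact max_comm |s| |t| ▸ abs_le_max_abs_abs h₁ h₂

variable {C L y : ℝ} {H D : ℂ × ℂ → ℂ} {a : ι → ℂ} {A B : Finset ι} {g : ℂ}

lemma IsAdmissible.mul {H' : ℂ × ℂ → ℂ} (hH : IsAdmissible C L H) (hH' : IsAdmissible C L H') :
    IsAdmissible C L fun w => H w * H' w :=
  ⟨hH.diff.mul hH'.diff, fun g x => by rw [hH.periodic, hH'.periodic]⟩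

lemma isAdmissible_ee (c : ℂ) : IsAdmissible C L fun w => ee (-w.2 + c - w.1) :=
  ⟨(differentiable_ee.comp (by fun_prop : Differentiable ℂ
    fun w : ℂ × ℂ => -w.2 + c - w.1)).differentiableOn, fun g x => by
      rw [← ee_add_one (-(x + 1) + c - g)]; ring_nf⟩

lemma IsAdmissible.diff_snd (hH : IsAdmissible C L H) (hg : g.im < C) :
    DifferentiableOn ℂ (fun x => H (g, x)) {x | |x.im| < L} :=
  hH.diff.comp (f := fun x => (g, x)) (by fun_prop) fun _ hx => ⟨hg, hx⟩

lemma IsAdmissible.diff_fst (hH : IsAdmissible C L H) {x : ℂ} (hx : |x.im| < L) :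
    DifferentiableOn ℂ (fun g => H (g, x)) {g | g.im < C} :=
  hH.diff.comp (f := fun g => (g, x)) (by fun_prop) fun _ hg => ⟨hg, hx⟩

lemma IsAdmissible.differentiableOn_shiftIntegral (hH : IsAdmissible C L H) (hy : |y| < L)
    (hD : Differentiable ℂ D) (hD0 : ∀ g x : ℂ, g.im < C → x.im = y → D (g, x) ≠ 0) :
    DifferentiableOn ℂ (shiftIntegral D y H) {g | g.im < C} := by
  have him : ∀ x : ℝ, ((x : ℂ) + y * Complex.I).im = y := fun x => by simp
  refine differentiableOn_intervalIntegral (F := fun g x =>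
    H (g, x + y * Complex.I) / D (g, x + y * Complex.I)) (isOpen_im_lt C) ?_ fun x => ?_
  · have hm : Continuous fun w : ℂ × ℝ => (w.1, (w.2 : ℂ) + y * Complex.I) := by fun_prop
    refine ContinuousOn.div (hH.diff.continuousOn.comp hm.continuousOn ?_)
      (hD.continuous.comp hm).continuousOn ?_
    · rintro ⟨g, x⟩ ⟨hg, -⟩
      exact ⟨hg, by simpa using hy⟩
    · rintro ⟨g, x⟩ ⟨hg, -⟩
      exact hD0 _ _ hg (him x)
  · refine DifferentiableOn.div (hH.diff_fst (by rwa [him])) ?_ fun g hg => hD0 _ _ hg (him x)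
    exact (hD.comp (by fun_prop : Differentiable ℂ
      fun g : ℂ => (g, (x : ℂ) + y * Complex.I))).differentiableOn

lemma IsAdmissible.shiftIntegral_eq (hH : IsAdmissible C L H) (hg : g.im < C)
    (hD : Differentiable ℂ D) (hper : Function.Periodic (fun x => D (g, x)) 1) {y₁ y₂ : ℝ}
    (hy₁ : |y₁| < L) (hy₂ : |y₂| < L) (hD0 : ∀ x : ℂ, x.im ∈ Set.uIcc y₁ y₂ → D (g, x) ≠ 0) :
    shiftIntegral D y₁ H g = shiftIntegral D y₂ H g := by
  refine intervalIntegral_eq_of_differentiableOn_strip (f := fun x => H (g, x) / D (g, x))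
    (fun x => congrArg₂ (· / ·) (hH.periodic g x) (hper x)) (DifferentiableOn.div ?_ ?_ hD0)
  · exact (hH.diff_snd hg).mono fun x hx =>
      (abs_le_max_of_mem_uIcc hx).trans_lt (max_lt hy₁ hy₂)
  · exact (hD.comp (by fun_prop : Differentiable ℂ fun x : ℂ => (g, x))).differentiableOn

lemma poleIntegral_eq_shiftIntegral_poleUp (hH : IsAdmissible C L H) (hy0 : 0 ≤ y) (hy : y < L)
    (hg : g.im < C) (hgA : ∀ i ∈ A, g.im < (a i).im) :
    poleIntegral a A ∅ H g = shiftIntegral (poleUp a A) y H g := by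
  have := hH.shiftIntegral_eq (y₁ := 0) (y₂ := y) hg (differentiable_poleUp a A)
    (poleUp_periodic a A g) (by simpa using hy0.trans_lt hy) (by rwa [abs_of_nonneg hy0])
    fun x hx => poleUp_ne_zero fun i hi => by
      rw [Set.uIcc_of_le hy0] at hx
      linarith [hgA i hi, hx.1]
  simpa [poleIntegral, shiftIntegral, poleDown, poleUp] using this

lemma poleIntegral_eq_shiftIntegral_poleDown (hH : IsAdmissible C L H) (hy0 : 0 ≤ y) (hy : y < L)
    (hg : g.im < C) (hgB : ∀ i ∈ B, g.im < (a i).im) :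
    poleIntegral a ∅ B H g = shiftIntegral (poleDown a B) (-y) H g := by
  have := hH.shiftIntegral_eq (y₁ := 0) (y₂ := -y) hg (differentiable_poleDown a B)
    (poleDown_periodic a B g) (by simpa using hy0.trans_lt hy)
    (by rwa [abs_neg, abs_of_nonneg hy0]) fun x hx => poleDown_ne_zero fun i hi => by
      rw [Set.uIcc_of_ge (by linarith)] at hx
      linarith [hgB i hi, hx.2]
  simpa [poleIntegral, shiftIntegral, poleDown, poleUp] using this

lemma differentiableOn_shiftIntegral_poleUp (hH : IsAdmissible C L H) (hy0 : 0 ≤ y) (hy : y < L)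
    (hA : ∀ i ∈ A, C ≤ (a i).im + y) :
    DifferentiableOn ℂ (shiftIntegral (poleUp a A) y H) {g | g.im < C} :=
  hH.differentiableOn_shiftIntegral (by rwa [abs_of_nonneg hy0]) (differentiable_poleUp a A)
    fun g x hg hx => poleUp_ne_zero fun i hi => by rw [hx]; linarith [hA i hi]

lemma differentiableOn_shiftIntegral_poleDown (hH : IsAdmissible C L H) (hy0 : 0 ≤ y) (hy : y < L)
    (hB : ∀ i ∈ B, C ≤ (a i).im + y) :
    DifferentiableOn ℂ (shiftIntegral (poleDown a B) (-y) H) {g | g.im < C} :=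
  hH.differentiableOn_shiftIntegral (by rwa [abs_neg, abs_of_nonneg hy0])
    (differentiable_poleDown a B)
    fun g x hg hx => poleDown_ne_zero fun i hi => by rw [hx]; linarith [hB i hi]

lemma continuous_poleIntegrand (hH : IsAdmissible C L H) (hL : 0 < L)
    (hg : g.im < C) (hgA : ∀ i ∈ A, g.im < (a i).im) (hgB : ∀ i ∈ B, g.im < (a i).im) :
    Continuous fun x : ℝ => H (g, x) / (poleUp a A (g, x) * poleDown a B (g, x)) := by
  have hm : Continuous fun x : ℝ => (g, (x : ℂ)) := by fun_prop
  refine Continuous.div ?_ (((differentiable_poleUp a A).continuous.comp hm).mul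
    ((differentiable_poleDown a B).continuous.comp hm)) fun x => ?_
  · rw [← continuousOn_univ]
    exact hH.diff.continuousOn.comp hm.continuousOn fun x _ => ⟨hg, by simpa using hL⟩
  · exact mul_ne_zero (poleUp_ne_zero fun i hi => by simpa using hgA i hi)
      (poleDown_ne_zero fun i hi => by simpa using hgB i hi)

lemma poleIntegral_add {H' : ℂ × ℂ → ℂ} (hH : IsAdmissible C L H) (hH' : IsAdmissible C L H')
    (hL : 0 < L) (hg : g.im < C) (hgA : ∀ i ∈ A, g.im < (a i).im)
    (hgB : ∀ i ∈ B, g.im < (a i).im) :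
    poleIntegral a A B (H + H') g = poleIntegral a A B H g + poleIntegral a A B H' g := by
  unfold poleIntegral
  rw [← intervalIntegral.integral_add
    ((continuous_poleIntegrand hH hL hg hgA hgB).intervalIntegrable _ _)
    ((continuous_poleIntegrand hH' hL hg hgA hgB).intervalIntegrable _ _)]
  simp only [Pi.add_apply, add_div]

lemma div_poleUp_mul_poleDown [DecidableEq ι] {x : ℂ} (hA0 : poleUp a A (g, x) ≠ 0)
    (hB0 : poleDown a B (g, x) ≠ 0) {i j : ι} (hi : i ∈ A) (hj : j ∈ B)
    (hij : ee (a i + a j - 2 * g) ≠ 1) (h : ℂ) :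
    h / (poleUp a A (g, x) * poleDown a B (g, x)) = (1 - ee (a i + a j - 2 * g))⁻¹ *
      (h / (poleUp a A (g, x) * poleDown a (B.erase j) (g, x)) +
        h * ee (-x + a j - g) / (poleUp a (A.erase i) (g, x) * poleDown a B (g, x))) := by
  have eA : poleUp a A (g, x) = (1 - ee (x + a i - g)) * poleUp a (A.erase i) (g, x) :=
    (Finset.mul_prod_erase A _ hi).symm
  have eB : poleDown a B (g, x) = (1 - ee (-x + a j - g)) * poleDown a (B.erase j) (g, x) :=
    (Finset.mul_prod_erase B _ hj).symm
  have e : ee (a i + a j - 2 * g) = ee (x + a i - g) * ee (-x + a j - g) := by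
    rw [← ee_add]; ring_nf
  have h1 := sub_ne_zero.2 hij.symm
  rw [e] at h1 ⊢
  rw [eA] at hA0 ⊢
  rw [eB] at hB0 ⊢
  have := left_ne_zero_of_mul hA0
  have := right_ne_zero_of_mul hA0
  have := left_ne_zero_of_mul hB0
  have := right_ne_zero_of_mul hB0
  generalize ee (x + a i - g) = u at *
  generalize ee (-x + a j - g) = v at *
  field_simp
  ring

/-- The partial fraction `1/((1-u)(1-v)) = (1-uv)⁻¹ (1/(1-u) + v/(1-v))` removes one pole from
each family in turn; the only singularity in `g` it creates is that of `(1-uv)⁻¹`, where `u = 1` and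
`v = 1` pinch the contour. -/
lemma poleIntegral_eq_inv_mul_add [DecidableEq ι] (hH : IsAdmissible C L H) (hL : 0 < L)
    (hg : g.im < C) (hgA : ∀ i ∈ A, g.im < (a i).im) (hgB : ∀ i ∈ B, g.im < (a i).im)
    {i j : ι} (hi : i ∈ A) (hj : j ∈ B) :
    poleIntegral a A B H g = (1 - ee (a i + a j - 2 * g))⁻¹ *
      (poleIntegral a A (B.erase j) H g +
        poleIntegral a (A.erase i) B (fun w => H w * ee (-w.2 + a j - w.1)) g) := by
  have h1 : ee (a i + a j - 2 * g) ≠ 1 := (sub_ne_zero.1 (one_sub_ee_ne_zero (by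
    simp only [Complex.sub_im, Complex.add_im, Complex.mul_im, Complex.re_ofNat, Complex.im_ofNat]
    linarith [hgA i hi, hgB j hj]))).symm
  unfold poleIntegral
  rw [← intervalIntegral.integral_add, ← intervalIntegral.integral_const_mul]
  · exact intervalIntegral.integral_congr fun x _ => div_poleUp_mul_poleDown
      (poleUp_ne_zero fun i hi => by simpa using hgA i hi)
      (poleDown_ne_zero fun i hi => by simpa using hgB i hi) hi hj h1 _
  · exact (continuous_poleIntegrand hH hL hg hgA
      (fun i hi => hgB i (Finset.mem_of_mem_erase hi))).intervalIntegrable _ _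
  · exact (continuous_poleIntegrand (hH.mul (isAdmissible_ee (a j))) hL hg
      (fun i hi => hgA i (Finset.mem_of_mem_erase hi)) hgB).intervalIntegrable _ _

lemma analyticAt_one_sub_ee (c g : ℂ) : AnalyticAt ℂ (fun g => 1 - ee (c - 2 * g)) g :=
  ((differentiable_ee.comp (by fun_prop : Differentiable ℂ
    fun g : ℂ => c - 2 * g)).const_sub 1).analyticAt g

/-- `G` is a meromorphic continuation to `Im g < C` of the integral `poleIntegral a A B H g`, whose
contour separates the two families of poles as long as `Im g < Im (a i)` for all `i`. -/
structure IsPoleContinuation (C : ℝ) (a : ι → ℂ) (A B : Finset ι) (H : ℂ × ℂ → ℂ) (G : ℂ → ℂ) :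
    Prop where
  meromorphicOn : MeromorphicOn G {g | g.im < C}
  eq_poleIntegral : ∀ g : ℂ, g.im < C → (∀ i ∈ A, g.im < (a i).im) →
    (∀ i ∈ B, g.im < (a i).im) → G g = poleIntegral a A B H g

lemma isPoleContinuation_shiftIntegral_poleUp (hH : IsAdmissible C L H) (hy0 : 0 ≤ y) (hy : y < L)
    (hA : ∀ i ∈ A, C ≤ (a i).im + y) :
    IsPoleContinuation C a A ∅ H (shiftIntegral (poleUp a A) y H) :=
  ⟨((differentiableOn_shiftIntegral_poleUp hH hy0 hy hA).analyticOnNhd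
    (isOpen_im_lt C)).meromorphicOn, fun _ hg hgA _ =>
      (poleIntegral_eq_shiftIntegral_poleUp hH hy0 hy hg hgA).symm⟩

lemma isPoleContinuation_shiftIntegral_poleDown (hH : IsAdmissible C L H) (hy0 : 0 ≤ y)
    (hy : y < L) (hB : ∀ i ∈ B, C ≤ (a i).im + y) :
    IsPoleContinuation C a ∅ B H (shiftIntegral (poleDown a B) (-y) H) :=
  ⟨((differentiableOn_shiftIntegral_poleDown hH hy0 hy hB).analyticOnNhd
    (isOpen_im_lt C)).meromorphicOn, fun _ hg _ hgB =>
      (poleIntegral_eq_shiftIntegral_poleDown hH hy0 hy hg hgB).symm⟩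

lemma IsPoleContinuation.inv_mul_add [DecidableEq ι] (hH : IsAdmissible C L H) (hL : 0 < L)
    {i j : ι} (hi : i ∈ A) (hj : j ∈ B) {G₁ G₂ : ℂ → ℂ}
    (h₁ : IsPoleContinuation C a A (B.erase j) H G₁)
    (h₂ : IsPoleContinuation C a (A.erase i) B (fun w => H w * ee (-w.2 + a j - w.1)) G₂) :
    IsPoleContinuation C a A B H fun g => (1 - ee (a i + a j - 2 * g))⁻¹ * (G₁ g + G₂ g) where
  meromorphicOn g hg := (analyticAt_one_sub_ee _ g).meromorphicAt.inv.mul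
    ((h₁.meromorphicOn g hg).add (h₂.meromorphicOn g hg))
  eq_poleIntegral g hg hgA hgB := by
    rw [poleIntegral_eq_inv_mul_add hH hL hg hgA hgB hi hj,
      ← h₁.eq_poleIntegral g hg hgA fun i hi => hgB i (Finset.mem_of_mem_erase hi),
      ← h₂.eq_poleIntegral g hg (fun i hi => hgA i (Finset.mem_of_mem_erase hi)) hgB]

theorem exists_isPoleContinuation (hH : IsAdmissible C L H)
    (hy0 : 0 ≤ y) (hy : y < L) (A B : Finset ι) (hA : ∀ i ∈ A, C ≤ (a i).im + y)
    (hB : ∀ i ∈ B, C ≤ (a i).im + y) : ∃ G, IsPoleContinuation C a A B H G := by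
  classical
  obtain ⟨n, hn⟩ : ∃ n, A.card + B.card ≤ n := ⟨_, le_rfl⟩
  induction n generalizing A B H with
  | zero =>
    have hB0 : B = ∅ := Finset.card_eq_zero.1 (by omega)
    exact ⟨_, hB0 ▸ isPoleContinuation_shiftIntegral_poleUp hH hy0 hy hA⟩
  | succ n ih =>
    rcases A.eq_empty_or_nonempty with rfl | ⟨i, hi⟩
    · exact ⟨_, isPoleContinuation_shiftIntegral_poleDown hH hy0 hy hB⟩
    rcases B.eq_empty_or_nonempty with rfl | ⟨j, hj⟩
    · exact ⟨_, isPoleContinuation_shiftIntegral_poleUp hH hy0 hy hA⟩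
    have hcA := Finset.card_erase_add_one hi
    have hcB := Finset.card_erase_add_one hj
    obtain ⟨G₁, hG₁⟩ := ih hH A (B.erase j) hA
      (fun i hi => hB i (Finset.mem_of_mem_erase hi)) (by omega)
    obtain ⟨G₂, hG₂⟩ := ih (hH.mul (isAdmissible_ee (a j))) (A.erase i) B
      (fun i hi => hA i (Finset.mem_of_mem_erase hi)) hB (by omega)
    exact ⟨_, hG₁.inv_mul_add hH (hy0.trans_lt hy) hi hj hG₂⟩

/-! ### Pinching -/

lemma eventually_one_sub_ee_ne_zero (g₀ : ℂ) :
    ∀ᶠ g in 𝓝[≠] g₀, 1 - ee (2 * (g₀ - g)) ≠ 0 := by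
  have h : HasDerivAt (fun g => 2 * (g₀ - g)) (2 * -1) g₀ :=
    ((hasDerivAt_id g₀).const_sub g₀).const_mul 2
  refine (((hasDerivAt_ee (2 * (g₀ - g₀))).comp g₀ h).const_sub 1).eventually_ne ?_
  rw [sub_self, mul_zero, ee_zero]
  simp

/-- At `g₀` the function `G` has at most a simple pole, and a removable singularity when the
numerator `H` of the integral `poleIntegral a A B H` vanishes at all the points `x = g₀ - a_i`
where a pole `g₀ - a_i` of the first family meets a pole `a_j - g₀` of the second one. -/
def HasPinchResidue (a : ι → ℂ) (A B : Finset ι) (H : ℂ × ℂ → ℂ) (g₀ : ℂ) (G : ℂ → ℂ) : Prop :=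
  ∃ K : ℂ → ℂ, AnalyticAt ℂ K g₀ ∧
    (∀ᶠ g in 𝓝[≠] g₀, G g * (1 - ee (2 * (g₀ - g))) = K g) ∧
    ((∀ i ∈ A, ∀ j ∈ B, ee (a i + a j - 2 * g₀) = 1 → H (g₀, g₀ - a i) = 0) → K g₀ = 0)

lemma hasPinchResidue_of_analyticAt {g₀ : ℂ} {G : ℂ → ℂ} (hG : AnalyticAt ℂ G g₀) :
    HasPinchResidue a A B H g₀ G := by
  refine ⟨_, hG.mul (analyticAt_one_sub_ee (2 * g₀) g₀),
    Eventually.of_forall fun g => by simp only [Pi.mul_apply, mul_sub], fun _ => ?_⟩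
  simp only [Pi.mul_apply, sub_self, ee_zero, mul_zero]

lemma HasPinchResidue.inv_mul_add [DecidableEq ι] {g₀ : ℂ} {i j : ι}
    (hij : ee (a i + a j - 2 * g₀) ≠ 1) {G₁ G₂ : ℂ → ℂ}
    (h₁ : HasPinchResidue a A (B.erase j) H g₀ G₁)
    (h₂ : HasPinchResidue a (A.erase i) B (fun w => H w * ee (-w.2 + a j - w.1)) g₀ G₂) :
    HasPinchResidue a A B H g₀ fun g => (1 - ee (a i + a j - 2 * g))⁻¹ * (G₁ g + G₂ g) := by
  obtain ⟨K₁, hK₁, hGK₁, hv₁⟩ := h₁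
  obtain ⟨K₂, hK₂, hGK₂, hv₂⟩ := h₂
  refine ⟨fun g => (1 - ee (a i + a j - 2 * g))⁻¹ * (K₁ g + K₂ g),
    ((analyticAt_one_sub_ee _ g₀).inv (sub_ne_zero.2 hij.symm)).mul (hK₁.add hK₂), ?_,
    fun hvan => ?_⟩
  · filter_upwards [hGK₁, hGK₂] with g h1 h2
    rw [← h1, ← h2]; ring
  · simp only
    rw [hv₁ fun i hi j hj h => hvan i hi j (Finset.mem_of_mem_erase hj) h,
      hv₂ fun i hi j hj h => mul_eq_zero_of_left (hvan i (Finset.mem_of_mem_erase hi) j hj h) _,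
      add_zero, mul_zero]

lemma mul_inv_div_one_sub_inv {E : ℂ} (h0 : E ≠ 0) (h1 : E ≠ 1) (c : ℂ) :
    c * E⁻¹ / (1 - E⁻¹) = -(c / (1 - E)) := by
  have h2 : E - 1 ≠ 0 := sub_ne_zero.2 h1
  have h3 : 1 - E ≠ 0 := sub_ne_zero.2 h1.symm
  field_simp
  ring

/-- When `a_i + a_j - 2g ∈ ℤ`, the two factors `1 - e^{2πi(x + a_i - g)}` and
`1 - e^{2πi(-x + a_j - g)}` vanish at the same `x`, and the two contour integrals are the opposite
sides of that single pole. -/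
lemma shiftIntegral_poleUp_add_shiftIntegral_poleDown (hH : IsAdmissible C L H) (hy : y < L)
    (hg : g.im < C) {i j : ι} (hi : C ≤ (a i).im + y) (hj : C ≤ (a j).im + y)
    (hij : ee (a i + a j - 2 * g) = 1) (h0 : H (g, g - a i) = 0) :
    shiftIntegral (poleUp a {i}) y H g +
      shiftIntegral (poleDown a {j}) (-y) (fun w => H w * ee (-w.2 + a j - w.1)) g = 0 := by
  have hu : |(g - a i).im| < y := by
    obtain ⟨m, hm⟩ := (ee_eq_one_iff _).1 hij
    have h3 := congrArg Complex.im hm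
    simp only [Complex.sub_im, Complex.add_im, Complex.mul_im, Complex.re_ofNat,
      Complex.im_ofNat, Complex.intCast_im] at h3
    rw [Complex.sub_im, abs_lt]
    constructor <;> linarith
  have eU : shiftIntegral (poleUp a {i}) y H g = ∫ x : ℝ in (0 : ℝ)..1,
      H (g, x + (-y : ℝ) * Complex.I) / (1 - ee (x + (-y : ℝ) * Complex.I - (g - a i))) := by
    rw [← intervalIntegral_div_one_sub_ee_eq hy (hH.diff_snd hg) (hH.periodic g) hu h0]
    refine intervalIntegral.integral_congr fun x _ => ?_
    simp only [poleUp, Finset.prod_singleton, sub_sub_eq_add_sub]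
  have eV : shiftIntegral (poleDown a {j}) (-y) (fun w => H w * ee (-w.2 + a j - w.1)) g =
      -∫ x : ℝ in (0 : ℝ)..1, H (g, x + (-y : ℝ) * Complex.I) /
        (1 - ee (x + (-y : ℝ) * Complex.I - (g - a i))) := by
    rw [← intervalIntegral.integral_neg]
    refine intervalIntegral.integral_congr fun x _ => ?_
    simp only [poleDown, poleUp, Finset.prod_singleton]
    set w : ℂ := x + (-y : ℝ) * Complex.I with hw
    have e : ee (-w + a j - g) = (ee (w - (g - a i)))⁻¹ := by
      rw [← ee_neg, ← mul_one (ee (-(w - (g - a i)))), ← hij, ← ee_add]; ring_nf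
    have h1 : ee (w - (g - a i)) ≠ 1 := fun h => by
      obtain ⟨n, hn⟩ := (ee_eq_one_iff _).1 h
      have hw' : w.im = -y := by simp [hw]
      have := congrArg Complex.im hn
      rw [Complex.sub_im, hw', Complex.intCast_im] at this
      linarith [(abs_lt.1 hu).1]
    rw [e]
    exact mul_inv_div_one_sub_inv (ee_ne_zero _) h1 _
  rw [eU, eV, add_neg_cancel]

lemma hasPinchResidue_singleton (hH : IsAdmissible C L H) (hy0 : 0 ≤ y) (hy : y < L) {g₀ : ℂ}
    (hg₀ : g₀.im < C) {i j : ι} (hi : C ≤ (a i).im + y) (hj : C ≤ (a j).im + y)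
    (hij : ee (a i + a j - 2 * g₀) = 1) :
    HasPinchResidue a {i} {j} H g₀ fun g => (1 - ee (a i + a j - 2 * g))⁻¹ *
      (shiftIntegral (poleUp a {i}) y H g +
        shiftIntegral (poleDown a {j}) (-y) (fun w => H w * ee (-w.2 + a j - w.1)) g) := by
  have hU := (differentiableOn_shiftIntegral_poleUp hH hy0 hy
    (A := {i}) (by simpa using hi)).analyticOnNhd (isOpen_im_lt C) g₀ hg₀
  have hV := (differentiableOn_shiftIntegral_poleDown (hH.mul (isAdmissible_ee (a j))) hy0 hy
    (B := {j}) (by simpa using hj)).analyticOnNhd (isOpen_im_lt C) g₀ hg₀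
  refine ⟨_, hU.add hV, ?_, fun hvan => shiftIntegral_poleUp_add_shiftIntegral_poleDown hH hy hg₀
    hi hj hij (hvan i (Finset.mem_singleton_self i) j (Finset.mem_singleton_self j) hij)⟩
  filter_upwards [eventually_one_sub_ee_ne_zero g₀] with g hg
  have e : ee (a i + a j - 2 * g) = ee (2 * (g₀ - g)) := by
    rw [← one_mul (ee (2 * (g₀ - g))), ← hij, ← ee_add]; ring_nf
  rw [e, mul_comm, mul_inv_cancel_left₀ hg, Pi.add_apply]

lemma isPoleContinuation_singleton (hH : IsAdmissible C L H) (hy0 : 0 ≤ y) (hy : y < L) {i j : ι}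
    (hi : C ≤ (a i).im + y) (hj : C ≤ (a j).im + y) :
    IsPoleContinuation C a {i} {j} H fun g => (1 - ee (a i + a j - 2 * g))⁻¹ *
      (shiftIntegral (poleUp a {i}) y H g +
        shiftIntegral (poleDown a {j}) (-y) (fun w => H w * ee (-w.2 + a j - w.1)) g) := by
  classical
  refine IsPoleContinuation.inv_mul_add hH (hy0.trans_lt hy) (Finset.mem_singleton_self i)
    (Finset.mem_singleton_self j) ?_ ?_
  · exact Finset.erase_singleton j ▸
      isPoleContinuation_shiftIntegral_poleUp hH hy0 hy (by simpa using hi)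
  · exact Finset.erase_singleton i ▸ isPoleContinuation_shiftIntegral_poleDown
      (hH.mul (isAdmissible_ee (a j))) hy0 hy (by simpa using hj)

theorem exists_isPoleContinuation_hasPinchResidue (hH : IsAdmissible C L H)
    (hy0 : 0 ≤ y) (hy : y < L) {g₀ : ℂ} (hg₀ : g₀.im < C) (A B : Finset ι)
    (hA : ∀ i ∈ A, C ≤ (a i).im + y) (hB : ∀ i ∈ B, C ≤ (a i).im + y)
    (hmA : ∀ i ∈ A, ∀ i' ∈ A, ∀ j ∈ B, ee (a i + a j - 2 * g₀) = 1 →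
      ee (a i' + a j - 2 * g₀) = 1 → i = i')
    (hmB : ∀ i ∈ A, ∀ j ∈ B, ∀ j' ∈ B, ee (a i + a j - 2 * g₀) = 1 →
      ee (a i + a j' - 2 * g₀) = 1 → j = j') :
    ∃ G, IsPoleContinuation C a A B H G ∧ HasPinchResidue a A B H g₀ G := by
  classical
  have hC := isOpen_im_lt C
  obtain ⟨n, hn⟩ : ∃ n, A.card + B.card ≤ n := ⟨_, le_rfl⟩
  induction n generalizing A B H with
  | zero =>
    have hB0 : B = ∅ := Finset.card_eq_zero.1 (by omega)
    subst hB0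
    exact ⟨_, isPoleContinuation_shiftIntegral_poleUp hH hy0 hy hA, hasPinchResidue_of_analyticAt
      ((differentiableOn_shiftIntegral_poleUp hH hy0 hy hA).analyticOnNhd hC g₀ hg₀)⟩
  | succ n ih =>
    rcases A.eq_empty_or_nonempty with rfl | ⟨i, hi⟩
    · exact ⟨_, isPoleContinuation_shiftIntegral_poleDown hH hy0 hy hB,
        hasPinchResidue_of_analyticAt
          ((differentiableOn_shiftIntegral_poleDown hH hy0 hy hB).analyticOnNhd hC g₀ hg₀)⟩
    rcases B.eq_empty_or_nonempty with rfl | ⟨j, hj⟩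
    · exact ⟨_, isPoleContinuation_shiftIntegral_poleUp hH hy0 hy hA, hasPinchResidue_of_analyticAt
        ((differentiableOn_shiftIntegral_poleUp hH hy0 hy hA).analyticOnNhd hC g₀ hg₀)⟩
    by_cases hall : ∀ i ∈ A, ∀ j ∈ B, ee (a i + a j - 2 * g₀) = 1
    · obtain rfl : A = {i} := Finset.eq_singleton_iff_unique_mem.2
        ⟨hi, fun i' hi' => hmA _ hi' _ hi j hj (hall _ hi' _ hj) (hall _ hi _ hj)⟩
      obtain rfl : B = {j} := Finset.eq_singleton_iff_unique_mem.2
        ⟨hj, fun j' hj' => hmB i hi _ hj' _ hj (hall _ hi _ hj') (hall _ hi _ hj)⟩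
      exact ⟨_, isPoleContinuation_singleton hH hy0 hy (hA i hi) (hB j hj),
        hasPinchResidue_singleton hH hy0 hy hg₀ (hA i hi) (hB j hj) (hall i hi j hj)⟩
    · push Not at hall
      obtain ⟨i, hi, j, hj, hij⟩ := hall
      have hcA := Finset.card_erase_add_one hi
      have hcB := Finset.card_erase_add_one hj
      have sA : ∀ i' ∈ A.erase i, i' ∈ A := fun _ => Finset.mem_of_mem_erase
      have sB : ∀ j' ∈ B.erase j, j' ∈ B := fun _ => Finset.mem_of_mem_erase
      obtain ⟨G₁, hG₁, hK₁⟩ := ih hH A (B.erase j) hA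
        (fun i hi => hB i (sB i hi)) (fun i hi i' hi' j hj => hmA i hi i' hi' j (sB j hj))
        (fun i hi j hj j' hj' => hmB i hi j (sB j hj) j' (sB j' hj')) (by omega)
      obtain ⟨G₂, hG₂, hK₂⟩ := ih (hH.mul (isAdmissible_ee (a j)))
        (A.erase i) B (fun i hi => hA i (sA i hi)) hB
        (fun i hi i' hi' => hmA i (sA i hi) i' (sA i' hi')) (fun i hi => hmB i (sA i hi)) (by omega)
      exact ⟨_, hG₁.inv_mul_add hH (hy0.trans_lt hy) hi hj hG₂, hK₁.inv_mul_add hij hK₂⟩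

end

/-! ### Identity theorem for meromorphic functions -/

lemma meromorphicOn_eventuallyEq_of_eventuallyEq {f h : ℂ → ℂ} {U : Set ℂ}
    (hf : MeromorphicOn f U) (hh : MeromorphicOn h U) (hU : IsPreconnected U) {x y : ℂ}
    (hx : x ∈ U) (hy : y ∈ U) (he : f =ᶠ[𝓝[≠] x] h) : f =ᶠ[𝓝[≠] y] h := by
  have hsub : MeromorphicOn (f - h) U := hf.sub hh
  have h1 : meromorphicOrderAt (f - h) x = ⊤ := by
    rw [meromorphicOrderAt_eq_top_iff]
    filter_upwards [he] with w hw
    rw [Pi.sub_apply, hw, sub_self]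
  have h2 : meromorphicOrderAt (f - h) y = ⊤ := by
    by_contra hne
    exact hsub.meromorphicOrderAt_ne_top_of_isPreconnected hU hy hx hne h1
  rw [meromorphicOrderAt_eq_top_iff] at h2
  filter_upwards [h2] with w hw
  exact sub_eq_zero.1 hw

lemma isPreconnected_im_lt (C : ℝ) : IsPreconnected {g : ℂ | g.im < C} :=
  (convex_halfSpace_im_lt C).isPreconnected

lemma analyticAt_eq_of_eventuallyEq_nhdsNE {f h : ℂ → ℂ} {x : ℂ} (hf : AnalyticAt ℂ f x)
    (hh : AnalyticAt ℂ h x) (he : f =ᶠ[𝓝[≠] x] h) : f x = h x :=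
  ((hf.continuousAt.eventuallyEq_nhds_iff_eventuallyEq_nhdsNE hh.continuousAt).1 he).eq_of_nhds

lemma eventually_codiscrete_ne_zero {f : ℂ → ℂ} (hf : Differentiable ℂ f) {x : ℂ} (hx : f x ≠ 0) :
    ∀ᶠ z in codiscrete ℂ, f z ≠ 0 :=
  AnalyticOnNhd.preimage_zero_mem_codiscrete (fun z _ => hf.analyticAt z) hx

lemma eventually_codiscrete_iff {P : ℂ → Prop} :
    (∀ᶠ z in codiscrete ℂ, P z) ↔ ∀ x, ∀ᶠ z in 𝓝[≠] x, P z := by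
  simp [Filter.Eventually, mem_codiscrete, disjoint_principal_right]

lemma exists_meromorphicNFOn_univ_of_cover {ι : Type*} {U : ι → Set ℂ} (hU : ∀ i, IsOpen (U i))
    (hcover : ∀ x, ∃ i, x ∈ U i) {f : ι → ℂ → ℂ} (hf : ∀ i, MeromorphicOn (f i) (U i))
    (hcompat : ∀ i j, ∀ x, x ∈ U i → x ∈ U j → f i =ᶠ[𝓝[≠] x] f j) :
    ∃ F : ℂ → ℂ, MeromorphicNFOn F Set.univ ∧ ∀ i, ∀ x ∈ U i, F =ᶠ[𝓝[≠] x] f i := by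
  choose N hN using hcover
  set F : ℂ → ℂ := fun x => toMeromorphicNFAt (f (N x)) x x
  have hF : ∀ i, ∀ x ∈ U i, F =ᶠ[𝓝 x] toMeromorphicNFOn (f i) (U i) := fun i x hx => by
    filter_upwards [(hU i).mem_nhds hx] with w hw
    rw [toMeromorphicNFOn_eq_toMeromorphicNFAt (hf i) hw]
    exact (toMeromorphicNFAt_eventuallyEq_nhds_congr (hcompat _ i w (hN w) hw)).eq_of_nhds
  refine ⟨F, fun x _ => (meromorphicNFAt_congr (hF (N x) x (hN x))).2
    (meromorphicNFOn_toMeromorphicNFOn _ _ (hN x)), fun i x hx => ?_⟩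
  exact ((hF i x hx).filter_mono nhdsWithin_le_nhds).trans
    ((hf i).toMeromorphicNFOn_eq_self_on_nhdsNE hx)

/-! ### The integrand -/

section
variable {τ η : ℂ}

/-- The integrand of the operator without its poles near the real line: the zeros at the lattice
points `latVec τ η nm` with `nm ∈ s` are removed from the four denominators. It depends on
`w = (g, x)`, and the prefactor `1 / Γ(-2g)` is left out. -/
def integrandNum (τ η z : ℂ) (s : Finset (ℕ × ℕ)) (Φ : ℂ → ℂ) (w : ℂ × ℂ) : ℂ :=
  dblPoch τ η (τ + 2 * η - (z + w.2 - w.1)) * dblPoch τ η (τ + 2 * η - (z - w.2 - w.1)) *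
    dblPoch τ η (τ + 2 * η - (-z + w.2 - w.1)) * dblPoch τ η (τ + 2 * η - (-z - w.2 - w.1)) /
    (dblPochOff τ η s (z + w.2 - w.1) * dblPochOff τ η s (z - w.2 - w.1) *
      dblPochOff τ η s (-z + w.2 - w.1) * dblPochOff τ η s (-z - w.2 - w.1)) *
    (reflFactor τ η (2 * w.2) * reflFactor τ η (-2 * w.2)) * Φ w.2

/-- The shifts `±z + jτ + 2kη` which locate the poles of the integrand, at `x = ±(g - shift)`
modulo `1`. -/
def polePos (τ η z : ℂ) : (ℕ × ℕ) ⊕ (ℕ × ℕ) → ℂ :=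
  Sum.elim (fun nm => z + latVec τ η nm) fun nm => -z + latVec τ η nm

lemma poleUp_polePos (z : ℂ) (s t : Finset (ℕ × ℕ)) (g x : ℂ) :
    poleUp (polePos τ η z) (s.disjSum t) (g, x) =
      dblPochOn τ η s (z + x - g) * dblPochOn τ η t (-z + x - g) := by
  rw [poleUp, Finset.prod_disjSum]
  congr 1 <;> refine Finset.prod_congr rfl fun nm _ => ?_ <;> simp only [polePos, Sum.elim_inl,
    Sum.elim_inr] <;> ring_nf

lemma poleDown_polePos (z : ℂ) (s t : Finset (ℕ × ℕ)) (g x : ℂ) :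
    poleDown (polePos τ η z) (s.disjSum t) (g, x) =
      dblPochOn τ η s (z - x - g) * dblPochOn τ η t (-z - x - g) := by
  rw [poleDown, poleUp, Finset.prod_disjSum]
  congr 1 <;> refine Finset.prod_congr rfl fun nm _ => ?_ <;> simp only [polePos, Sum.elim_inl,
    Sum.elim_inr] <;> ring_nf

/-- The prefactor `(q;q)_∞ (p;p)_∞ / (2 Γ(-2g))` of the operator, with `1 / Γ` written as a quotient
of entire functions so that it makes sense at the zeros of `Γ(-2g)`. -/
def spinFactor (τ η g : ℂ) : ℂ :=
  qPoch (base (2 * η)) (base (2 * η)) * qPoch (base τ) (base τ) / 2 *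
    (dblPoch τ η (-2 * g) / dblPoch τ η (τ + 2 * η + 2 * g))

lemma neg_abs_le_polePos_im (hτ : 0 < τ.im) (hη : 0 < η.im) (z : ℂ) (i : (ℕ × ℕ) ⊕ (ℕ × ℕ)) :
    -|z.im| ≤ (polePos τ η z i).im := by
  rcases i with nm | nm <;> simp only [polePos, Sum.elim_inl, Sum.elim_inr, Complex.add_im,
    Complex.neg_im] <;> have := latVec_im_nonneg hτ hη nm
  · linarith [neg_abs_le z.im]
  · linarith [le_abs_self z.im]

lemma lt_neg_abs_iff (g z : ℂ) : g.im < -|z.im| ↔ 0 < (-g + z).im ∧ 0 < (-g - z).im := by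
  rw [lt_neg, abs_lt]
  simp only [Complex.add_im, Complex.sub_im, Complex.neg_im]
  constructor
  · rintro ⟨h1, h2⟩; constructor <;> linarith
  · rintro ⟨h1, h2⟩; constructor <;> linarith

/-- The kernel `Γ(±z ± x - g) / Γ(-2g, ±2x)` of the operator. -/
def spinKernel (τ η g z x : ℂ) : ℂ :=
  ellGamma τ η (z + x - g) * ellGamma τ η (z - x - g) *
      ellGamma τ η (-z + x - g) * ellGamma τ η (-z - x - g) /
    (ellGamma τ η (-2 * g) * ellGamma τ η (2 * x) * ellGamma τ η (-2 * x))

lemma spinKernel_mul_eq (hτ : 0 < τ.im) (hη : 0 < η.im) (s : Finset (ℕ × ℕ)) (Φ : ℂ → ℂ)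
    (g z : ℂ) (x : ℝ) :
    spinKernel τ η g z x * Φ x = dblPoch τ η (-2 * g) / dblPoch τ η (τ + 2 * η + 2 * g) *
      (integrandNum τ η z s Φ (g, x) / (poleUp (polePos τ η z) (s.disjSum s) (g, x) *
        poleDown (polePos τ η z) (s.disjSum s) (g, x))) := by
  have hre : ∀ w : ℂ, w.im = 0 → dblPoch τ η (τ + 2 * η + w) ≠ 0 := fun w hw =>
    dblPoch_ne_zero_of_im_pos hτ hη (by
      rw [Complex.add_im, Complex.add_im, hw]
      have := im_two_mul_pos hη
      linarith)
  have h1 := inv_ellGamma_mul (z := 2 * (x : ℂ)) hτ hη (hre _ (by simp))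
    (by rw [sub_eq_add_neg]; exact hre _ (by simp))
  have e1 : ellGamma τ η (-2 * g) * ellGamma τ η (2 * x) * ellGamma τ η (-2 * x) =
      ellGamma τ η (-2 * g) * (ellGamma τ η (2 * x) * ellGamma τ η (-(2 * x))) := by ring_nf
  rw [spinKernel, poleUp_polePos, poleDown_polePos, e1, div_eq_mul_inv, mul_inv, h1, integrandNum]
  simp only [ellGamma_eq_dblPoch_div hτ hη]
  rw [dblPoch_eq_dblPochOn_mul_dblPochOff hτ hη s (z + x - g),
    dblPoch_eq_dblPochOn_mul_dblPochOff hτ hη s (z - x - g),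
    dblPoch_eq_dblPochOn_mul_dblPochOff hτ hη s (-z + x - g),
    dblPoch_eq_dblPochOn_mul_dblPochOff hτ hη s (-z - x - g)]
  have e2 : τ + 2 * η - -2 * g = τ + 2 * η + 2 * g := by ring
  have e3 : -(2 * (x : ℂ)) = -2 * x := by ring
  rw [e2, e3]
  simp only [div_eq_mul_inv, mul_inv, inv_inv]
  ring

lemma intertwinerIntegral_eq (hτ : 0 < τ.im) (hη : 0 < η.im) (s : Finset (ℕ × ℕ)) (Φ : ℂ → ℂ)
    (g z : ℂ) :
    intertwinerIntegral τ η g Φ z = spinFactor τ η g *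
      poleIntegral (polePos τ η z) (s.disjSum s) (s.disjSum s) (integrandNum τ η z s Φ) g := by
  rw [intertwinerIntegral, spinFactor, mul_assoc (_ / 2) (_ / _), poleIntegral,
    ← intervalIntegral.integral_const_mul (dblPoch τ η (-2 * g) / dblPoch τ η (τ + 2 * η + 2 * g))]
  congr 1
  exact intervalIntegral.integral_congr fun x _ => spinKernel_mul_eq hτ hη s Φ g z x

lemma exists_finset_latVec (hτ : 0 < τ.im) (hη : 0 < η.im) (Y : ℝ) :
    ∃ s : Finset (ℕ × ℕ), (0, 0) ∈ s ∧ ∀ nm ∉ s, Y < (latVec τ η nm).im := by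
  obtain ⟨N₁, hN₁⟩ := exists_nat_gt (Y / τ.im)
  obtain ⟨N₂, hN₂⟩ := exists_nat_gt (Y / (2 * η.im))
  rw [div_lt_iff₀ (by positivity)] at hN₁ hN₂
  refine ⟨Finset.range (N₁ + 1) ×ˢ Finset.range (N₂ + 1), by simp, ?_⟩
  rintro ⟨j, k⟩ h
  rw [latVec_im]
  simp only [Finset.mem_product, Finset.mem_range, not_and_or, not_lt] at h
  rcases h with h | h
  · have h1 : (N₁ : ℝ) + 1 ≤ j := by exact_mod_cast h
    have h2 : 0 ≤ (k : ℝ) * (2 * η.im) := by positivity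
    nlinarith
  · have h1 : (N₂ : ℝ) + 1 ≤ k := by exact_mod_cast h
    have h2 : 0 ≤ (j : ℝ) * τ.im := by positivity
    nlinarith

lemma integrandNum_add_one {Φ : ℂ → ℂ} (hΦ : Function.Periodic Φ 1) (z : ℂ)
    (s : Finset (ℕ × ℕ)) (g x : ℂ) :
    integrandNum τ η z s Φ (g, x + 1) = integrandNum τ η z s Φ (g, x) := by
  have e1 : z + (x + 1) - g = z + x - g + 1 := by ring
  have e2 : -z + (x + 1) - g = -z + x - g + 1 := by ring
  have e3 : z - x - g = z - (x + 1) - g + 1 := by ring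
  have e4 : -z - x - g = -z - (x + 1) - g + 1 := by ring
  have e5 : τ + 2 * η - (z + x - g) = τ + 2 * η - (z + x - g + 1) + 1 := by ring
  have e6 : τ + 2 * η - (-z + x - g) = τ + 2 * η - (-z + x - g + 1) + 1 := by ring
  have e7 : τ + 2 * η - (z - (x + 1) - g) = τ + 2 * η - (z - (x + 1) - g + 1) + 1 := by ring
  have e8 : τ + 2 * η - (-z - (x + 1) - g) = τ + 2 * η - (-z - (x + 1) - g + 1) + 1 := by ring
  have e9 : 2 * (x + 1) = 2 * x + 1 + 1 := by ring
  have e10 : -2 * x = -2 * (x + 1) + 1 + 1 := by ring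
  simp only [integrandNum]
  rw [hΦ, e1, e2, e3, e4, e7, e8, e5, e6, e9, reflFactor_add_one, reflFactor_add_one, e10,
    reflFactor_add_one, reflFactor_add_one]
  simp only [dblPoch_add_one, dblPochOff_add_one]

lemma dblPochOff_ne_zero_of_lt_im (hτ : 0 < τ.im) (hη : 0 < η.im) {s : Finset (ℕ × ℕ)} {u : ℂ}
    (hu : ∀ nm ∉ s, 0 < (u + latVec τ η nm).im) : dblPochOff τ η s u ≠ 0 :=
  dblPochOff_ne_zero hτ hη fun nm hnm h =>
    one_sub_ee_ne_zero (hu nm hnm).ne' (by rw [h, sub_self])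

lemma isAdmissible_integrandNum (hτ : 0 < τ.im) (hη : 0 < η.im) {C L : ℝ} {z : ℂ}
    {s : Finset (ℕ × ℕ)} (hs : ∀ nm ∉ s, C + L + |z.im| < (latVec τ η nm).im) {Φ : ℂ → ℂ}
    (hΦ : IsTestFunction Φ) : IsAdmissible C L (integrandNum τ η z s Φ) := by
  have hD := differentiable_dblPoch hτ hη
  have hR := differentiable_dblPochOff hτ hη s
  have hW := differentiable_reflFactor hτ hη
  have d1 : Differentiable ℂ fun w : ℂ × ℂ => z + w.2 - w.1 := by fun_prop
  have d2 : Differentiable ℂ fun w : ℂ × ℂ => z - w.2 - w.1 := by fun_prop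
  have d3 : Differentiable ℂ fun w : ℂ × ℂ => -z + w.2 - w.1 := by fun_prop
  have d4 : Differentiable ℂ fun w : ℂ × ℂ => -z - w.2 - w.1 := by fun_prop
  refine ⟨?_, integrandNum_add_one hΦ.2 z s⟩
  unfold integrandNum
  simp only [div_eq_mul_inv]
  refine ((DifferentiableOn.mul ?_ (DifferentiableOn.fun_inv ?_ ?_)).mul ?_).mul ?_
  · exact ((((hD.comp (d1.const_sub _)).mul (hD.comp (d2.const_sub _))).mul
      (hD.comp (d3.const_sub _))).mul (hD.comp (d4.const_sub _))).differentiableOn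
  · exact ((((hR.comp d1).mul (hR.comp d2)).mul (hR.comp d3)).mul (hR.comp d4)).differentiableOn
  · rintro ⟨g, x⟩ ⟨hg : g.im < C, hx : |x.im| < L⟩
    obtain ⟨hx₁, hx₂⟩ := abs_le.1 hx.le
    obtain ⟨hz₁, hz₂⟩ := abs_le.1 (le_refl |z.im|)
    refine mul_ne_zero (mul_ne_zero (mul_ne_zero ?_ ?_) ?_) ?_ <;>
      refine dblPochOff_ne_zero_of_lt_im hτ hη fun nm hnm => ?_ <;>
      have := hs nm hnm <;>
      simp only [Complex.sub_im, Complex.add_im, Complex.neg_im] <;> linarith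
  · exact ((hW.comp (by fun_prop : Differentiable ℂ fun w : ℂ × ℂ => 2 * w.2)).mul
      (hW.comp (by fun_prop : Differentiable ℂ fun w : ℂ × ℂ => -2 * w.2))).differentiableOn
  · exact (hΦ.1.comp differentiable_snd).differentiableOn

lemma eventually_dblPoch_ne_zero (hτ : 0 < τ.im) (hη : 0 < η.im) (g₀ : ℂ) :
    ∀ᶠ g in 𝓝[≠] g₀, dblPoch τ η (τ + 2 * η + 2 * g) ≠ 0 := by
  refine eventually_codiscrete_iff.1 (eventually_codiscrete_ne_zero (x := 0)
    ((differentiable_dblPoch hτ hη).comp (by fun_prop : Differentiable ℂ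
      fun g : ℂ => τ + 2 * η + 2 * g)) ?_) g₀
  refine dblPoch_ne_zero_of_im_pos hτ hη ?_
  have := im_two_mul_pos hη
  simp only [Complex.add_im, mul_zero, Complex.zero_im] at *
  linarith

lemma ellGamma_neg_two_mul_ne_zero_iff (hτ : 0 < τ.im) (hη : 0 < η.im) {g : ℂ} (hg : g.im < 0) :
    ellGamma τ η (-2 * g) ≠ 0 ↔ dblPoch τ η (τ + 2 * η + 2 * g) ≠ 0 := by
  have h : dblPoch τ η (-2 * g) ≠ 0 := dblPoch_ne_zero_of_im_pos hτ hη (by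
    simp [Complex.mul_im]; linarith)
  have e : τ + 2 * η - -2 * g = τ + 2 * η + 2 * g := by ring
  rw [ellGamma_eq_dblPoch_div hτ hη, e, Ne, div_eq_zero_iff, or_iff_left h]

lemma meromorphicAt_spinFactor (hτ : 0 < τ.im) (hη : 0 < η.im) (g : ℂ) :
    MeromorphicAt (spinFactor τ η) g := by
  have hD := differentiable_dblPoch hτ hη
  refine (MeromorphicAt.const _ _).mul (MeromorphicAt.div ?_ ?_)
  · exact ((hD.comp (by fun_prop : Differentiable ℂ fun g : ℂ => -2 * g)).analyticAt
      g).meromorphicAt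
  · exact ((hD.comp (by fun_prop : Differentiable ℂ fun g : ℂ => τ + 2 * η + 2 * g)).analyticAt
      g).meromorphicAt

lemma analyticAt_spinFactor (hτ : 0 < τ.im) (hη : 0 < η.im) {g : ℂ}
    (hg : dblPoch τ η (τ + 2 * η + 2 * g) ≠ 0) : AnalyticAt ℂ (spinFactor τ η) g := by
  have hD := differentiable_dblPoch hτ hη
  refine analyticAt_const.mul (AnalyticAt.div ?_ ?_ hg)
  · exact (hD.comp (by fun_prop : Differentiable ℂ fun g : ℂ => -2 * g)).analyticAt g
  · exact (hD.comp (by fun_prop : Differentiable ℂ fun g : ℂ => τ + 2 * η + 2 * g)).analyticAt g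

lemma analyticAt_intertwinerIntegral (hτ : 0 < τ.im) (hη : 0 < η.im) {Φ : ℂ → ℂ}
    (hΦ : IsTestFunction Φ) {g z : ℂ} (hg : g.im < -|z.im|)
    (hg' : dblPoch τ η (τ + 2 * η + 2 * g) ≠ 0) :
    AnalyticAt ℂ (fun g => intertwinerIntegral τ η g Φ z) g := by
  obtain ⟨s, -, hs⟩ := exists_finset_latVec hτ hη (-|z.im| + 1 + |z.im|)
  have hH := isAdmissible_integrandNum hτ hη hs hΦ
  have hd := hH.differentiableOn_shiftIntegral (y := 0) (by simp)
    (D := fun w => poleUp (polePos τ η z) (s.disjSum s) w *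
      poleDown (polePos τ η z) (s.disjSum s) w)
    ((differentiable_poleUp _ _).mul (differentiable_poleDown _ _)) fun g x hg hx =>
      mul_ne_zero
        (poleUp_ne_zero fun i _ => by rw [hx]; linarith [neg_abs_le_polePos_im hτ hη z i])
        (poleDown_ne_zero fun i _ => by rw [hx]; linarith [neg_abs_le_polePos_im hτ hη z i])
  have h1 := hd.analyticAt ((isOpen_im_lt _).mem_nhds hg)
  refine ((analyticAt_spinFactor hτ hη hg').mul h1).congr (Eventually.of_forall fun g => ?_)
  simp only [Pi.mul_apply]
  rw [intertwinerIntegral_eq hτ hη s]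
  simp [poleIntegral, shiftIntegral]

lemma IsSpinContinuation.eventuallyEq_integral (hτ : 0 < τ.im) (hη : 0 < η.im) {Φ F : ℂ → ℂ}
    {z : ℂ} (hF : IsSpinContinuation τ η Φ z F) {g₀ : ℂ} (hg₀ : g₀.im < -|z.im|) :
    F =ᶠ[𝓝[≠] g₀] fun g => intertwinerIntegral τ η g Φ z := by
  filter_upwards [eventually_dblPoch_ne_zero hτ hη g₀,
    mem_nhdsWithin_of_mem_nhds ((isOpen_im_lt _).mem_nhds hg₀)] with g h1 h2
  obtain ⟨h3, h4⟩ := (lt_neg_abs_iff g z).1 h2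
  refine hF.2 g h3 h4 ((ellGamma_neg_two_mul_ne_zero_iff hτ hη ?_).2 h1)
  have h2' : g.im < -|z.im| := h2
  exact h2'.trans_le (neg_nonpos.2 (abs_nonneg _))

lemma IsSpinContinuation.eventuallyEq (hτ : 0 < τ.im) (hη : 0 < η.im) {Φ F f : ℂ → ℂ}
    {z : ℂ} (hF : IsSpinContinuation τ η Φ z F) {U : Set ℂ} (hU : IsPreconnected U)
    (hf : MeromorphicOn f U) {g₁ : ℂ} (hg₁ : g₁.im < -|z.im|) (hg₁U : g₁ ∈ U)
    (he : f =ᶠ[𝓝[≠] g₁] fun g => intertwinerIntegral τ η g Φ z) {g : ℂ} (hg : g ∈ U) :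
    F =ᶠ[𝓝[≠] g] f :=
  meromorphicOn_eventuallyEq_of_eventuallyEq
    (fun x _ => (hF.1 (Set.mem_univ x)).meromorphicAt) hf hU hg₁U hg
    ((hF.eventuallyEq_integral hτ hη hg₁).trans he.symm)

lemma IsSpinContinuation.unique (hτ : 0 < τ.im) (hη : 0 < η.im) {Φ F F' : ℂ → ℂ}
    {z : ℂ} (hF : IsSpinContinuation τ η Φ z F) (hF' : IsSpinContinuation τ η Φ z F') : F = F' := by
  ext g
  have hg₁ : (((-|z.im| - 1 : ℝ) : ℂ) * Complex.I).im < -|z.im| := by simp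
  have := hF.eventuallyEq hτ hη isPreconnected_univ hF'.1.meromorphicOn hg₁ trivial
    (hF'.eventuallyEq_integral hτ hη hg₁) (g := g) trivial
  exact (((hF.1 (Set.mem_univ g)).eventuallyEq_nhdsNE_iff_eventuallyEq_nhds
    (hF'.1 (Set.mem_univ g))).1 this).eq_of_nhds

lemma exists_halfPlane_continuation (hτ : 0 < τ.im) (hη : 0 < η.im) {Φ : ℂ → ℂ}
    (hΦ : IsTestFunction Φ) (z : ℂ) (C : ℝ) :
    ∃ f : ℂ → ℂ, MeromorphicOn f {g | g.im < C} ∧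
      ∀ g : ℂ, g.im < C → g.im < -|z.im| → f g = intertwinerIntegral τ η g Φ z := by
  set y := |C| + |z.im|
  obtain ⟨s, -, hs⟩ := exists_finset_latVec hτ hη (C + (y + 1) + |z.im|)
  have hH := isAdmissible_integrandNum hτ hη hs hΦ
  have ha : ∀ i ∈ s.disjSum s, C ≤ (polePos τ η z i).im + y := fun i _ => by
    have := neg_abs_le_polePos_im hτ hη z i
    have := le_abs_self C
    linarith
  obtain ⟨G, hG⟩ := exists_isPoleContinuation hH (by positivity) (lt_add_one y) _ _ ha ha
  refine ⟨fun g => spinFactor τ η g * G g,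
    fun g hg => (meromorphicAt_spinFactor hτ hη g).mul (hG.meromorphicOn g hg),
    fun g hg hgz => ?_⟩
  have hlt : ∀ i ∈ s.disjSum s, g.im < (polePos τ η z i).im := fun i _ =>
    hgz.trans_le (neg_abs_le_polePos_im hτ hη z i)
  simp only
  rw [intertwinerIntegral_eq hτ hη s, hG.eq_poleIntegral g hg hlt hlt]

theorem exists_isSpinContinuation (hτ : 0 < τ.im) (hη : 0 < η.im) {Φ : ℂ → ℂ}
    (hΦ : IsTestFunction Φ) (z : ℂ) : ∃ F : ℂ → ℂ, IsSpinContinuation τ η Φ z F := by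
  choose f hf hf' using fun n : ℕ => exists_halfPlane_continuation hτ hη hΦ z (n : ℝ)
  have hreg : ∀ (n : ℕ) (g : ℂ), g.im < -|z.im| →
      f n =ᶠ[𝓝[≠] g] fun g => intertwinerIntegral τ η g Φ z := fun n g hg => by
    filter_upwards [mem_nhdsWithin_of_mem_nhds ((isOpen_im_lt (-|z.im|)).mem_nhds hg)]
      with w hw
    exact hf' n w (lt_of_lt_of_le (b := -|z.im|) hw
      ((neg_nonpos.2 (abs_nonneg _)).trans n.cast_nonneg)) hw
  have hcompat : ∀ (n m : ℕ) (g : ℂ), g.im < n → g.im < m → f n =ᶠ[𝓝[≠] g] f m := by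
    intro n m g hn hm
    have him : (((-|z.im| - 1 : ℝ) : ℂ) * Complex.I).im < -|z.im| := by simp
    have hlt : ∀ k : ℕ, (((-|z.im| - 1 : ℝ) : ℂ) * Complex.I).im < k := fun k =>
      him.trans_le ((neg_nonpos.2 (abs_nonneg _)).trans k.cast_nonneg)
    exact meromorphicOn_eventuallyEq_of_eventuallyEq (U := {g | g.im < min (n : ℝ) m})
      ((hf n).mono_set fun x hx => lt_of_lt_of_le (b := min (n : ℝ) m) hx (min_le_left _ _))
      ((hf m).mono_set fun x hx => lt_of_lt_of_le (b := min (n : ℝ) m) hx (min_le_right _ _))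
      (isPreconnected_im_lt _)
      (lt_min (hlt n) (hlt m)) (lt_min hn hm) ((hreg n _ him).trans (hreg m _ him).symm)
  obtain ⟨F, hNF, hF⟩ := exists_meromorphicNFOn_univ_of_cover (fun n : ℕ => isOpen_im_lt (n : ℝ))
    (fun g => exists_nat_gt g.im) hf hcompat
  refine ⟨F, hNF, fun g h1 h2 h3 => ?_⟩
  have hg := (lt_neg_abs_iff g z).2 ⟨h1, h2⟩
  have hg0 : g.im < 0 := hg.trans_le (neg_nonpos.2 (abs_nonneg _))
  have hA := analyticAt_intertwinerIntegral hτ hη hΦ hg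
    ((ellGamma_neg_two_mul_ne_zero_iff hτ hη hg0).1 h3)
  exact (((hNF (Set.mem_univ g)).eventuallyEq_nhdsNE_iff_eventuallyEq_nhds
    hA.meromorphicNFAt).1 ((hF 0 g (by simpa using hg0)).trans (hreg 0 g hg))).eq_of_nhds

lemma isSpinContinuation_intertwiner (hτ : 0 < τ.im) (hη : 0 < η.im) {Φ : ℂ → ℂ}
    (hΦ : IsTestFunction Φ) (z : ℂ) :
    IsSpinContinuation τ η Φ z fun g => intertwiner τ η g Φ z := by
  have h := exists_isSpinContinuation hτ hη hΦ z
  have e : (fun g => intertwiner τ η g Φ z) = h.choose := by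
    ext g; exact dif_pos h
  rw [e]
  exact h.choose_spec

lemma IsSpinContinuation.eq_intertwiner (hτ : 0 < τ.im) (hη : 0 < η.im) {Φ F : ℂ → ℂ}
    (hΦ : IsTestFunction Φ) {z : ℂ} (hF : IsSpinContinuation τ η Φ z F) (g : ℂ) :
    intertwiner τ η g Φ z = F g :=
  congrFun ((isSpinContinuation_intertwiner hτ hη hΦ z).unique hτ hη hF) g

/-! ### The half-period shift and the exchange of bases -/

lemma IsTestFunction.halfShift {Φ : ℂ → ℂ} (hΦ : IsTestFunction Φ) :
    IsTestFunction (halfShift Φ) :=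
  ⟨hΦ.1.comp (differentiable_id.add_const _), fun z => by
    simp only [EllipticDouble.halfShift]; rw [add_right_comm, hΦ.2]⟩

lemma halfShift_even {Φ : ℂ → ℂ} (hΦ : Function.Periodic Φ 1) (he : ∀ x, Φ (-x) = Φ x) (x : ℂ) :
    halfShift Φ (-x) = halfShift Φ x := by
  simp only [halfShift]
  rw [← he, ← hΦ]; ring_nf

lemma ellGamma_sub_one (hτ : 0 < τ.im) (hη : 0 < η.im) (z : ℂ) :
    ellGamma τ η (z - 1) = ellGamma τ η z := by
  rw [← ellGamma_add_one hτ hη, sub_add_cancel]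

lemma spinKernel_add_one (hτ : 0 < τ.im) (hη : 0 < η.im) (g z x : ℂ) :
    spinKernel τ η g z (x + 1) = spinKernel τ η g z x := by
  have e1 : z + (x + 1) - g = z + x - g + 1 := by ring
  have e2 : z - (x + 1) - g = z - x - g - 1 := by ring
  have e3 : -z + (x + 1) - g = -z + x - g + 1 := by ring
  have e4 : -z - (x + 1) - g = -z - x - g - 1 := by ring
  have e5 : 2 * (x + 1) = 2 * x + 1 + 1 := by ring
  have e6 : -2 * (x + 1) = -2 * x - 1 - 1 := by ring
  simp only [spinKernel, e1, e2, e3, e4, e5, e6, ellGamma_add_one hτ hη, ellGamma_sub_one hτ hη]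

lemma spinKernel_add_half_add_half (hτ : 0 < τ.im) (hη : 0 < η.im) (g z x : ℂ) :
    spinKernel τ η (g + 1 / 2) z (x + 1 / 2) = spinKernel τ η g z x := by
  have e1 : z + (x + 1 / 2) - (g + 1 / 2) = z + x - g := by ring
  have e2 : z - (x + 1 / 2) - (g + 1 / 2) = z - x - g - 1 := by ring
  have e3 : -z + (x + 1 / 2) - (g + 1 / 2) = -z + x - g := by ring
  have e4 : -z - (x + 1 / 2) - (g + 1 / 2) = -z - x - g - 1 := by ring
  have e5 : 2 * (x + 1 / 2) = 2 * x + 1 := by ring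
  have e6 : -2 * (x + 1 / 2) = -2 * x - 1 := by ring
  have e7 : -2 * (g + 1 / 2) = -2 * g - 1 := by ring
  simp only [spinKernel, e1, e2, e3, e4, e5, e6, e7, ellGamma_add_one hτ hη,
    ellGamma_sub_one hτ hη]

lemma intertwinerIntegral_add_half (hτ : 0 < τ.im) (hη : 0 < η.im) {Φ : ℂ → ℂ}
    (hΦ : Function.Periodic Φ 1) (g z : ℂ) :
    intertwinerIntegral τ η (g + 1 / 2) Φ z = intertwinerIntegral τ η g (halfShift Φ) z := by
  set f : ℂ → ℂ := fun x => spinKernel τ η (g + 1 / 2) z x * Φ x with hf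
  have hper : Function.Periodic f 1 := fun x => by
    simp only [hf, spinKernel_add_one hτ hη, hΦ x]
  have hshift : ∫ x : ℝ in (0 : ℝ)..1, f x = ∫ x : ℝ in (1 / 2 : ℝ)..1 / 2 + 1, f x := by
    simpa using (intervalIntegral_horizontal_add_one hper (1 / 2) 0).symm
  have hsubst : ∫ x : ℝ in (1 / 2 : ℝ)..1 / 2 + 1, f x =
      ∫ x : ℝ in (0 : ℝ)..1, f (x + 1 / 2) := by
    have h := intervalIntegral.integral_comp_add_right (a := 0) (b := 1)
      (fun x : ℝ => f x) (1 / 2)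
    rw [zero_add, add_comm 1] at h
    rw [← h]
    push_cast
    rfl
  change _ * ∫ x : ℝ in (0 : ℝ)..1, f x =
    _ * ∫ x : ℝ in (0 : ℝ)..1, spinKernel τ η g z x * halfShift Φ x
  rw [hshift, hsubst]
  simp only [hf, spinKernel_add_half_add_half hτ hη, halfShift]

theorem intertwiner_add_half (hτ : 0 < τ.im) (hη : 0 < η.im) {Φ : ℂ → ℂ}
    (hΦ : IsTestFunction Φ) (g z : ℂ) :
    intertwiner τ η (g + 1 / 2) Φ z = intertwiner τ η g (halfShift Φ) z := by
  have hF := isSpinContinuation_intertwiner hτ hη hΦ z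
  refine (IsSpinContinuation.eq_intertwiner (F := fun g => intertwiner τ η (g + 1 / 2) Φ z)
    hτ hη hΦ.halfShift ⟨?_, fun g h1 h2 h3 => ?_⟩ g).symm
  · intro g _
    exact (meromorphicNFAt_comp_add_const_iff_meromorphicNFAt
      (f := fun g => intertwiner τ η g Φ z)).2 (hF.1 (Set.mem_univ _))
  · rw [← intertwinerIntegral_add_half hτ hη hΦ.2]
    have him : ∀ w : ℂ, (-(g + 1 / 2) + w).im = (-g + w).im := fun w => by simp
    have him' : ∀ w : ℂ, (-(g + 1 / 2) - w).im = (-g - w).im := fun w => by simp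
    refine hF.2 _ (by rwa [him]) (by rwa [him']) ?_
    have e : -2 * (g + 1 / 2) = -2 * g - 1 := by ring
    rwa [e, ellGamma_sub_one hτ hη]

lemma intertwinerIntegral_swap (hτ : 0 < τ.im) (hη : 0 < η.im) (g : ℂ) (Φ : ℂ → ℂ) (z : ℂ) :
    intertwinerIntegral (2 * η) (τ / 2) g Φ z = intertwinerIntegral τ η g Φ z := by
  simp only [intertwinerIntegral, ellGamma_swap hτ hη, mul_div_cancel₀ τ (two_ne_zero' ℂ)]
  ring

lemma intertwiner_swap (hτ : 0 < τ.im) (hη : 0 < η.im) {Φ : ℂ → ℂ} (hΦ : IsTestFunction Φ)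
    (g z : ℂ) : intertwiner (2 * η) (τ / 2) g Φ z = intertwiner τ η g Φ z := by
  have h := isSpinContinuation_intertwiner hτ hη hΦ z
  refine IsSpinContinuation.eq_intertwiner (im_two_mul_pos hη) (im_half_pos hτ) hΦ
    (F := fun g => intertwiner τ η g Φ z) ⟨h.1, ?_⟩ g
  simpa only [ellGamma_swap hτ hη, intertwinerIntegral_swap hτ hη] using h.2

/-! ### Regularity and locality at the lattice points -/

lemma latVec_zero : latVec τ η (0, 0) = 0 := by simp [latVec]

lemma latVec_add (nm nm' : ℕ × ℕ) : latVec τ η (nm + nm') = latVec τ η nm + latVec τ η nm' := by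
  simp only [latVec, Prod.fst_add, Prod.snd_add]; push_cast; ring

/-- No other lattice vector `jτ + 2kη`, `j, k ≥ 0`, is congruent to `mτ + 2nη` modulo `1`. -/
def SpinGeneric (τ η : ℂ) (m n : ℕ) : Prop :=
  ∀ nm : ℕ × ℕ, ee (latVec τ η nm) = ee (latVec τ η (m, n)) → nm = (m, n)

/-- At spin `g = mτ/2 + nη` no pole of the integrand with shift `z + jτ + 2kη` pinches the contour
against another one with shift `z + j'τ + 2k'η`, and likewise for `-z`; the pairs `(j, k)` range
over `s`. -/
def PinchGeneric (τ η : ℂ) (m n : ℕ) (s : Finset (ℕ × ℕ)) (z : ℂ) : Prop :=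
  ∀ nm ∈ s, ∀ nm' ∈ s, ee (2 * z + latVec τ η nm + latVec τ η nm' - latVec τ η (m, n)) ≠ 1 ∧
    ee (-2 * z + latVec τ η nm + latVec τ η nm' - latVec τ η (m, n)) ≠ 1

section
variable {m n : ℕ} {s : Finset (ℕ × ℕ)} {g₀ z : ℂ}

lemma exists_add_eq_of_ee_polePos_eq_one (hsg : SpinGeneric τ η m n)
    (hz : PinchGeneric τ η m n s z) (h2 : 2 * g₀ = latVec τ η (m, n)) {i j : (ℕ × ℕ) ⊕ (ℕ × ℕ)}
    (hi : i ∈ s.disjSum s) (hj : j ∈ s.disjSum s)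
    (h : ee (polePos τ η z i + polePos τ η z j - 2 * g₀) = 1) :
    ∃ nm nm', nm + nm' = (m, n) ∧
      (i = Sum.inl nm ∧ j = Sum.inr nm' ∨ i = Sum.inr nm ∧ j = Sum.inl nm') := by
  rw [h2] at h
  rcases i with nm | nm <;> rcases j with nm' | nm' <;>
    simp only [Finset.inl_mem_disjSum, Finset.inr_mem_disjSum] at hi hj <;>
    simp only [polePos, Sum.elim_inl, Sum.elim_inr] at h
  · refine absurd ?_ (hz nm hi nm' hj).1
    rw [← h]; ring_nf
  · refine ⟨nm, nm', hsg _ ?_, Or.inl ⟨rfl, rfl⟩⟩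
    rw [← mul_one (ee (latVec τ η (m, n))), ← h, ← ee_add, latVec_add]; ring_nf
  · refine ⟨nm, nm', hsg _ ?_, Or.inr ⟨rfl, rfl⟩⟩
    rw [← mul_one (ee (latVec τ η (m, n))), ← h, ← ee_add, latVec_add]; ring_nf
  · refine absurd ?_ (hz nm hi nm' hj).2
    rw [← h]; ring_nf

lemma eq_of_ee_polePos_eq_one (hsg : SpinGeneric τ η m n) (hz : PinchGeneric τ η m n s z)
    (h2 : 2 * g₀ = latVec τ η (m, n)) {i i' j : (ℕ × ℕ) ⊕ (ℕ × ℕ)} (hi : i ∈ s.disjSum s)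
    (hi' : i' ∈ s.disjSum s) (hj : j ∈ s.disjSum s)
    (h : ee (polePos τ η z i + polePos τ η z j - 2 * g₀) = 1)
    (h' : ee (polePos τ η z i' + polePos τ η z j - 2 * g₀) = 1) : i = i' := by
  obtain ⟨a, b, hab, ⟨rfl, rfl⟩ | ⟨rfl, rfl⟩⟩ :=
    exists_add_eq_of_ee_polePos_eq_one hsg hz h2 hi hj h <;>
  obtain ⟨a', b', hab', ⟨rfl, hb⟩ | ⟨rfl, hb⟩⟩ :=
    exists_add_eq_of_ee_polePos_eq_one hsg hz h2 hi' hj h' <;>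
  simp only [Sum.inl.injEq, Sum.inr.injEq, reduceCtorEq] at hb ⊢ <;> subst hb <;>
  exact add_right_cancel (hab.trans hab'.symm)

end

lemma eventually_ee_ne_one (c d z₀ : ℂ) (hc : c ≠ 0) :
    ∀ᶠ z in 𝓝[≠] z₀, ee (c * z + d) ≠ 1 := by
  have hd : Differentiable ℂ fun z => ee (c * z + d) - 1 :=
    (differentiable_ee.comp (by fun_prop : Differentiable ℂ fun z : ℂ => c * z + d)).sub_const 1
  have h := eventually_codiscrete_ne_zero (x := (Complex.I - d) / c) hd (by
    rw [mul_div_cancel₀ _ hc, sub_add_cancel]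
    have : (1 : ℂ) - ee Complex.I ≠ 0 := one_sub_ee_ne_zero (by simp)
    exact fun h => this (by linear_combination -h))
  filter_upwards [eventually_codiscrete_iff.1 h z₀] with z hz h1
  exact hz (by rw [h1, sub_self])

lemma eventually_pinchGeneric (m n : ℕ) (s : Finset (ℕ × ℕ)) (z₀ : ℂ) :
    ∀ᶠ z in 𝓝[≠] z₀, PinchGeneric τ η m n s z := by
  unfold PinchGeneric
  simp only [Filter.eventually_all_finset]
  intro nm _ nm' _
  filter_upwards [eventually_ee_ne_one 2 (latVec τ η nm + latVec τ η nm' - latVec τ η (m, n)) z₀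
    two_ne_zero, eventually_ee_ne_one (-2) (latVec τ η nm + latVec τ η nm' - latVec τ η (m, n)) z₀
    (by norm_num)] with z h1 h2
  constructor
  · rwa [add_sub_assoc, add_assoc, ← add_sub_assoc]
  · rwa [add_sub_assoc, add_assoc, ← add_sub_assoc]

lemma eventually_codiscrete_of_pinchGeneric (m n : ℕ) {P : ℂ → Prop}
    (h : ∀ Y : ℝ, ∃ s, ∀ z : ℂ, |z.im| ≤ Y → PinchGeneric τ η m n s z → P z) :
    ∀ᶠ z in codiscrete ℂ, P z := by
  rw [eventually_codiscrete_iff]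
  intro z₀
  obtain ⟨s, hs⟩ := h (|z₀.im| + 1)
  have hY : ∀ᶠ z : ℂ in 𝓝[≠] z₀, |z.im| < |z₀.im| + 1 := by
    refine mem_nhdsWithin_of_mem_nhds ((isOpen_lt (f := fun z : ℂ => |z.im|) (by fun_prop)
      continuous_const).mem_nhds ?_)
    exact lt_add_one |z₀.im|
  filter_upwards [hY, eventually_pinchGeneric m n s z₀] with z h1 h2 using hs z h1.le h2

/-- The prefactor `spinFactor` without its zero at `g = mτ/2 + nη`, which cancels the pole of the
integral there. -/
def regSpinFactor (τ η : ℂ) (m n : ℕ) (g : ℂ) : ℂ :=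
  qPoch (base (2 * η)) (base (2 * η)) * qPoch (base τ) (base τ) / 2 *
    (dblPochOff τ η {(m, n)} (-2 * g) / dblPoch τ η (τ + 2 * η + 2 * g))

section
variable {m n : ℕ} {g₀ : ℂ}

lemma spinFactor_eq_regSpinFactor_mul (hτ : 0 < τ.im) (hη : 0 < η.im)
    (h2 : 2 * g₀ = latVec τ η (m, n)) (g : ℂ) :
    spinFactor τ η g = regSpinFactor τ η m n g * (1 - ee (2 * (g₀ - g))) := by
  have e : -2 * g + 2 * g₀ = 2 * (g₀ - g) := by ring
  rw [spinFactor, regSpinFactor, dblPoch_eq_dblPochOn_mul_dblPochOff hτ hη {(m, n)} (-2 * g),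
    dblPochOn, Finset.prod_singleton, ← h2, e]
  ring

lemma analyticAt_regSpinFactor (hτ : 0 < τ.im) (hη : 0 < η.im)
    (h2 : 2 * g₀ = latVec τ η (m, n)) : AnalyticAt ℂ (regSpinFactor τ η m n) g₀ := by
  have hne : dblPoch τ η (τ + 2 * η + 2 * g₀) ≠ 0 := dblPoch_ne_zero_of_im_pos hτ hη (by
    rw [h2, Complex.add_im, Complex.add_im]
    linarith [latVec_im_nonneg hτ hη (m, n), im_two_mul_pos hη])
  refine analyticAt_const.mul (AnalyticAt.div ?_ ?_ hne)
  · exact ((differentiable_dblPochOff hτ hη _).comp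
      (by fun_prop : Differentiable ℂ fun g : ℂ => -2 * g)).analyticAt g₀
  · exact ((differentiable_dblPoch hτ hη).comp
      (by fun_prop : Differentiable ℂ fun g : ℂ => τ + 2 * η + 2 * g)).analyticAt g₀

lemma intertwiner_eventuallyEq_regSpinFactor_mul (hτ : 0 < τ.im) (hη : 0 < η.im) {Φ : ℂ → ℂ}
    (hΦ : IsTestFunction Φ) {z : ℂ} (h2 : 2 * g₀ = latVec τ η (m, n)) {C : ℝ} (hg₀ : g₀.im < C)
    {s : Finset (ℕ × ℕ)} {G K : ℂ → ℂ} (hG : IsPoleContinuation C (polePos τ η z) (s.disjSum s)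
      (s.disjSum s) (integrandNum τ η z s Φ) G)
    (hK : AnalyticAt ℂ K g₀) (hGK : ∀ᶠ g in 𝓝[≠] g₀, G g * (1 - ee (2 * (g₀ - g))) = K g) :
    (fun g => intertwiner τ η g Φ z) =ᶠ[𝓝 g₀] fun g => regSpinFactor τ η m n g * K g := by
  have hF := isSpinContinuation_intertwiner hτ hη hΦ z
  have hA : AnalyticAt ℂ (fun g => regSpinFactor τ η m n g * K g) g₀ :=
    (analyticAt_regSpinFactor hτ hη h2).mul hK
  refine ((hF.1 (Set.mem_univ g₀)).eventuallyEq_nhdsNE_iff_eventuallyEq_nhds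
    hA.meromorphicNFAt).1 ?_
  set g₁ : ℂ := ((-|z.im| - |C| - 1 : ℝ) : ℂ) * Complex.I
  have hg₁ : g₁.im = -|z.im| - |C| - 1 := by simp [g₁]
  have hlt1 : g₁.im < -|z.im| := by rw [hg₁]; linarith [abs_nonneg C]
  have hlt2 : g₁.im < C := by rw [hg₁]; linarith [neg_abs_le C, abs_nonneg z.im]
  have hreg : (fun g => spinFactor τ η g * G g) =ᶠ[𝓝[≠] g₁]
      fun g => intertwinerIntegral τ η g Φ z := by
    filter_upwards [mem_nhdsWithin_of_mem_nhds ((isOpen_im_lt _).mem_nhds hlt1),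
      mem_nhdsWithin_of_mem_nhds ((isOpen_im_lt _).mem_nhds hlt2)] with g hgz hgC
    have hlt : ∀ i ∈ s.disjSum s, g.im < (polePos τ η z i).im := fun i _ =>
      lt_of_lt_of_le (b := -|z.im|) hgz (neg_abs_le_polePos_im hτ hη z i)
    rw [intertwinerIntegral_eq hτ hη s, hG.eq_poleIntegral g hgC hlt hlt]
  refine (hF.eventuallyEq (f := fun g => spinFactor τ η g * G g) hτ hη (isPreconnected_im_lt C)
    (fun g hg => (meromorphicAt_spinFactor hτ hη g).mul (hG.meromorphicOn g hg)) hlt1 hlt2 hreg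
    hg₀).trans ?_
  filter_upwards [hGK] with g hg
  rw [spinFactor_eq_regSpinFactor_mul hτ hη h2, ← hg]; ring

lemma exists_finset_isPoleContinuation_hasPinchResidue (hτ : 0 < τ.im) (hη : 0 < η.im)
    (hsg : SpinGeneric τ η m n) (h2 : 2 * g₀ = latVec τ η (m, n)) (Y : ℝ) :
    ∃ (s : Finset (ℕ × ℕ)) (L : ℝ), (0, 0) ∈ s ∧ 0 < L ∧ ∀ z : ℂ, |z.im| ≤ Y →
      PinchGeneric τ η m n s z →
      (∀ Φ, IsTestFunction Φ → IsAdmissible (g₀.im + 1) L (integrandNum τ η z s Φ)) ∧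
      ∀ H, IsAdmissible (g₀.im + 1) L H → ∃ G,
        IsPoleContinuation (g₀.im + 1) (polePos τ η z) (s.disjSum s) (s.disjSum s) H G ∧
        HasPinchResidue (polePos τ η z) (s.disjSum s) (s.disjSum s) H g₀ G := by
  set C := g₀.im + 1
  set y := |C| + |Y|
  obtain ⟨s, hs0, hs⟩ := exists_finset_latVec hτ hη (C + (y + 1) + |Y|)
  refine ⟨s, y + 1, hs0, by positivity, fun z hz hgen => ⟨fun Φ hΦ => ?_, fun H hH => ?_⟩⟩
  · refine isAdmissible_integrandNum hτ hη (fun nm hnm => lt_of_le_of_lt ?_ (hs nm hnm)) hΦ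
    linarith [le_abs_self Y]
  · have ha : ∀ i ∈ s.disjSum s, C ≤ (polePos τ η z i).im + y := fun i _ => by
      linarith [neg_abs_le_polePos_im hτ hη z i, le_abs_self C, le_abs_self Y]
    refine exists_isPoleContinuation_hasPinchResidue hH (by positivity) (lt_add_one y)
      (lt_add_one g₀.im) _ _ ha ha
      (fun i hi i' hi' j hj => eq_of_ee_polePos_eq_one hsg hgen h2 hi hi' hj)
      fun i hi j hj j' hj' hij hij' => ?_
    rw [add_comm (polePos τ η z i)] at hij hij'
    exact eq_of_ee_polePos_eq_one hsg hgen h2 hj hj' hi hij hij'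

end

lemma IsTestFunction.add {Φ Ψ : ℂ → ℂ} (hΦ : IsTestFunction Φ) (hΨ : IsTestFunction Ψ) :
    IsTestFunction (Φ + Ψ) :=
  ⟨hΦ.1.add hΨ.1, fun z => by simp only [Pi.add_apply, hΦ.2, hΨ.2]⟩

lemma IsTestFunction.sub {Φ Ψ : ℂ → ℂ} (hΦ : IsTestFunction Φ) (hΨ : IsTestFunction Ψ) :
    IsTestFunction (Φ - Ψ) :=
  ⟨hΦ.1.sub hΨ.1, fun z => by simp only [Pi.sub_apply, hΦ.2, hΨ.2]⟩

lemma intertwinerIntegral_add (hτ : 0 < τ.im) (hη : 0 < η.im) {Φ Ψ : ℂ → ℂ}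
    (hΦ : IsTestFunction Φ) (hΨ : IsTestFunction Ψ) {g z : ℂ} (hg : g.im < -|z.im|) :
    intertwinerIntegral τ η g (Φ + Ψ) z =
      intertwinerIntegral τ η g Φ z + intertwinerIntegral τ η g Ψ z := by
  obtain ⟨s, -, hs⟩ := exists_finset_latVec hτ hη (-|z.im| + 1 + |z.im|)
  have hlt : ∀ i ∈ s.disjSum s, g.im < (polePos τ η z i).im := fun i _ =>
    hg.trans_le (neg_abs_le_polePos_im hτ hη z i)
  have e : integrandNum τ η z s (Φ + Ψ) = integrandNum τ η z s Φ + integrandNum τ η z s Ψ := by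
    ext w
    simp only [integrandNum, Pi.add_apply, mul_add]
  rw [intertwinerIntegral_eq hτ hη s, intertwinerIntegral_eq hτ hη s,
    intertwinerIntegral_eq hτ hη s, ← mul_add, e,
    poleIntegral_add (isAdmissible_integrandNum hτ hη hs hΦ)
      (isAdmissible_integrandNum hτ hη hs hΨ) one_pos hg hlt hlt]

lemma intertwiner_add_eventuallyEq (hτ : 0 < τ.im) (hη : 0 < η.im) {Φ Ψ : ℂ → ℂ}
    (hΦ : IsTestFunction Φ) (hΨ : IsTestFunction Ψ) (z g : ℂ) :
    (fun g => intertwiner τ η g (Φ + Ψ) z) =ᶠ[𝓝[≠] g]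
      (fun g => intertwiner τ η g Φ z) + fun g => intertwiner τ η g Ψ z := by
  have hF := isSpinContinuation_intertwiner hτ hη hΦ z
  have hF' := isSpinContinuation_intertwiner hτ hη hΨ z
  have hg₁ : (((-|z.im| - 1 : ℝ) : ℂ) * Complex.I).im < -|z.im| := by simp
  refine (isSpinContinuation_intertwiner hτ hη (hΦ.add hΨ) z).eventuallyEq hτ hη
    isPreconnected_univ (hF.1.meromorphicOn.add hF'.1.meromorphicOn) hg₁ trivial ?_ trivial
  filter_upwards [hF.eventuallyEq_integral hτ hη hg₁, hF'.eventuallyEq_integral hτ hη hg₁,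
    mem_nhdsWithin_of_mem_nhds ((isOpen_im_lt _).mem_nhds hg₁)] with g h1 h2 h3
  rw [Pi.add_apply, h1, h2, intertwinerIntegral_add hτ hη hΦ hΨ h3]

/-- The points `z + αη + βτ/2` with `|α| ≤ n` and `|β| ≤ m`. The operators at spin `nη + mτ/2` only
see the values of the test function at these points. -/
def shiftStencil (τ η : ℂ) (n m : ℕ) (z : ℂ) : Set ℂ :=
  {w | ∃ α β : ℤ, |α| ≤ n ∧ |β| ≤ m ∧ z + (α * η + β * (τ / 2)) = w}

lemma apply_sub_polePos_eq_zero {Φ : ℂ → ℂ} (he : ∀ x, Φ (-x) = Φ x) {m n : ℕ} {z : ℂ}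
    (hΦ : ∀ w ∈ shiftStencil τ η n m z, Φ w = 0) {nm nm' : ℕ × ℕ} (hnm : nm + nm' = (m, n))
    {i : (ℕ × ℕ) ⊕ (ℕ × ℕ)} (hi : i = Sum.inl nm ∨ i = Sum.inr nm) :
    Φ (n * η + m * (τ / 2) - polePos τ η z i) = 0 := by
  obtain ⟨hm, hn⟩ := Prod.mk.inj hnm
  rcases hi with rfl | rfl
  · rw [← he]
    refine hΦ _ ⟨2 * nm.2 - n, 2 * nm.1 - m, ?_, ?_, ?_⟩
    · rw [abs_le]; constructor <;> omega
    · rw [abs_le]; constructor <;> omega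
    · simp only [polePos, Sum.elim_inl, latVec]; push_cast; ring
  · refine hΦ _ ⟨n - 2 * nm.2, m - 2 * nm.1, ?_, ?_, ?_⟩
    · rw [abs_le]; constructor <;> omega
    · rw [abs_le]; constructor <;> omega
    · simp only [polePos, Sum.elim_inr, latVec]; push_cast; ring

lemma eventually_analyticAt_intertwiner_and_eq_zero (hτ : 0 < τ.im) (hη : 0 < η.im) {m n : ℕ}
    (hsg : SpinGeneric τ η m n) :
    ∀ᶠ z in codiscrete ℂ, ∀ Φ, IsTestFunction Φ →
      AnalyticAt ℂ (fun g => intertwiner τ η g Φ z) (n * η + m * (τ / 2)) ∧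
      ((∀ x, Φ (-x) = Φ x) → (∀ w ∈ shiftStencil τ η n m z, Φ w = 0) →
        intertwiner τ η (n * η + m * (τ / 2)) Φ z = 0) := by
  have h2 : 2 * (n * η + m * (τ / 2)) = latVec τ η (m, n) := by simp only [latVec]; ring
  refine eventually_codiscrete_of_pinchGeneric (τ := τ) (η := η) m n fun Y => ?_
  obtain ⟨s, L, -, -, hs⟩ := exists_finset_isPoleContinuation_hasPinchResidue hτ hη hsg h2 Y
  refine ⟨s, fun z hz hgen Φ hΦ => ?_⟩
  obtain ⟨hadm, hpin⟩ := hs z hz hgen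
  obtain ⟨G, hG, K, hK, hGK, hres⟩ := hpin _ (hadm Φ hΦ)
  have he := intertwiner_eventuallyEq_regSpinFactor_mul hτ hη hΦ h2 (lt_add_one _) hG hK hGK
  refine ⟨((analyticAt_regSpinFactor hτ hη h2).mul hK).congr he.symm, fun hev hvan => ?_⟩
  rw [he.eq_of_nhds, hres, mul_zero]
  intro i hi j hj hij
  obtain ⟨a, b, hab, hc⟩ := exists_add_eq_of_ee_polePos_eq_one hsg hgen h2 hi hj hij
  rw [integrandNum, apply_sub_polePos_eq_zero hev hvan hab (hc.imp And.left And.left), mul_zero]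

theorem eventually_analyticAt_intertwiner (hτ : 0 < τ.im) (hη : 0 < η.im) {m n : ℕ}
    (hsg : SpinGeneric τ η m n) :
    ∀ᶠ z in codiscrete ℂ, ∀ Φ, IsTestFunction Φ →
      AnalyticAt ℂ (fun g => intertwiner τ η g Φ z) (n * η + m * (τ / 2)) := by
  filter_upwards [eventually_analyticAt_intertwiner_and_eq_zero hτ hη hsg] with z hz Φ hΦ
    using (hz Φ hΦ).1

theorem eventually_intertwiner_eq_of_eqOn (hτ : 0 < τ.im) (hη : 0 < η.im) {m n : ℕ}
    (hsg : SpinGeneric τ η m n) :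
    ∀ᶠ z in codiscrete ℂ, ∀ Φ Ψ, IsTestFunction Φ → IsTestFunction Ψ → (∀ x, Φ (-x) = Φ x) →
      (∀ x, Ψ (-x) = Ψ x) → Set.EqOn Φ Ψ (shiftStencil τ η n m z) →
      intertwiner τ η (n * η + m * (τ / 2)) Φ z = intertwiner τ η (n * η + m * (τ / 2)) Ψ z := by
  filter_upwards [eventually_analyticAt_intertwiner_and_eq_zero hτ hη hsg]
    with z hz Φ Ψ hΦ hΨ he he' hval
  obtain ⟨hD, hD0⟩ := hz _ (hΦ.sub hΨ)
  have hzero := hD0 (fun x => by simp only [Pi.sub_apply, he, he']) fun w hw => by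
    rw [Pi.sub_apply, hval hw, sub_self]
  have hadd := analyticAt_eq_of_eventuallyEq_nhdsNE
    (by simpa only [sub_add_cancel] using (hz Φ hΦ).1) (hD.add (hz Ψ hΨ).1)
    (intertwiner_add_eventuallyEq hτ hη (hΦ.sub hΨ) hΨ z _)
  simpa only [sub_add_cancel, Pi.add_apply, hzero, zero_add] using hadd

/-! ### The operator at zero spin -/

lemma integral_inv_one_sub_ee {c : ℂ} (hc : 0 < c.im) :
    ∫ x : ℝ in (0 : ℝ)..1, (1 - ee (x + c))⁻¹ = 1 := by
  have hd : DiffContOnCl ℂ (fun w : ℂ => (1 - w * ee c)⁻¹) (Metric.ball 0 |(1 : ℝ)|) := by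
    refine DifferentiableOn.diffContOnCl ?_
    rw [closure_ball _ (by norm_num)]
    refine DifferentiableOn.inv (by fun_prop) fun w hw h => ?_
    have h1 : ‖w * ee c‖ = 1 := by
      have : w * ee c = 1 := by linear_combination -h
      rw [this, norm_one]
    have h2 : ‖w‖ ≤ 1 := by simpa using hw
    have h3 := norm_ee_lt_one hc
    rw [norm_mul] at h1
    nlinarith [norm_nonneg w, norm_nonneg (ee c)]
  have h := hd.circleAverage
  rw [zero_mul, sub_zero, inv_one, Real.circleAverage_def] at h
  have h2 := intervalIntegral.integral_comp_mul_left (a := 0) (b := 1)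
    (fun θ : ℝ => (1 - circleMap 0 1 θ * ee c)⁻¹) (c := 2 * π) (by positivity)
  rw [mul_zero, mul_one] at h2
  refine Eq.trans (intervalIntegral.integral_congr fun x _ => ?_) (h2.trans h)
  simp only [circleMap, zero_add, Complex.ofReal_one, one_mul]
  rw [ee_add, ee]
  push_cast
  ring_nf

lemma integral_inv_one_sub_ee_neg {c : ℂ} (hc : 0 < c.im) :
    ∫ x : ℝ in (0 : ℝ)..1, (1 - ee (-x + c))⁻¹ = 1 := by
  have h := intervalIntegral.integral_comp_sub_left (a := 0) (b := 1)
    (fun x : ℝ => (1 - ee (x + c))⁻¹) 1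
  rw [sub_self, sub_zero, integral_inv_one_sub_ee hc] at h
  refine Eq.trans (intervalIntegral.integral_congr fun x _ => ?_) h
  rw [← ee_add_one (-x + c)]
  push_cast
  ring_nf

lemma inv_one_sub_mul_inv_one_sub {K : Type*} [Field K] {u v : K} (hu : 1 - u ≠ 0)
    (hv : 1 - v ≠ 0) (huv : 1 - u * v ≠ 0) :
    (1 - u)⁻¹ * (1 - v)⁻¹ = (1 - u * v)⁻¹ * ((1 - u)⁻¹ + (1 - v)⁻¹ - 1) := by
  field_simp
  ring

lemma integral_inv_one_sub_ee_mul_inv_one_sub_ee_neg {c d : ℂ} (hc : 0 < c.im) (hd : 0 < d.im) :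
    ∫ x : ℝ in (0 : ℝ)..1, (1 - ee (x + c))⁻¹ * (1 - ee (-x + d))⁻¹ = (1 - ee (c + d))⁻¹ := by
  have hU : ∀ x : ℝ, 1 - ee (x + c) ≠ 0 := fun x => one_sub_ee_ne_zero (by
    simpa using hc.ne')
  have hV : ∀ x : ℝ, 1 - ee (-x + d) ≠ 0 := fun x => one_sub_ee_ne_zero (by
    simpa using hd.ne')
  have hUV : 1 - ee (c + d) ≠ 0 := one_sub_ee_ne_zero (by rw [Complex.add_im]; linarith)
  have cU : Continuous fun x : ℝ => (1 - ee (x + c))⁻¹ :=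
    (continuous_const.sub (differentiable_ee.continuous.comp
      (by fun_prop : Continuous fun x : ℝ => (x : ℂ) + c))).inv₀ hU
  have cV : Continuous fun x : ℝ => (1 - ee (-x + d))⁻¹ :=
    (continuous_const.sub (differentiable_ee.continuous.comp
      (by fun_prop : Continuous fun x : ℝ => -(x : ℂ) + d))).inv₀ hV
  have cUV : Continuous fun x : ℝ => (1 - ee (x + c))⁻¹ + (1 - ee (-x + d))⁻¹ := cU.add cV
  have hsplit : ∀ x : ℝ, (1 - ee (x + c))⁻¹ * (1 - ee (-x + d))⁻¹ =
      (1 - ee (c + d))⁻¹ * ((1 - ee (x + c))⁻¹ + (1 - ee (-x + d))⁻¹ - 1) := fun x => by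
    have hmul : ee (c + d) = ee (x + c) * ee (-x + d) := by rw [← ee_add]; ring_nf
    rw [hmul] at hUV ⊢
    exact inv_one_sub_mul_inv_one_sub (hU x) (hV x) hUV
  simp only [hsplit]
  rw [intervalIntegral.integral_const_mul, intervalIntegral.integral_sub
    (cUV.intervalIntegrable _ _) (continuous_const.intervalIntegrable _ _),
    intervalIntegral.integral_add (cU.intervalIntegrable _ _) (cV.intervalIntegrable _ _),
    integral_inv_one_sub_ee hc, integral_inv_one_sub_ee_neg hd]
  simp

section
variable {ι : Type*} {C L : ℝ} {a : ι → ℂ} {A B : Finset ι} {H H' : ℂ × ℂ → ℂ} {G G' : ℂ → ℂ}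

lemma IsPoleContinuation.add (hG : IsPoleContinuation C a A B H G)
    (hG' : IsPoleContinuation C a A B H' G') (hH : IsAdmissible C L H)
    (hH' : IsAdmissible C L H') (hL : 0 < L) :
    IsPoleContinuation C a A B (H + H') (G + G') where
  meromorphicOn := hG.meromorphicOn.add hG'.meromorphicOn
  eq_poleIntegral g hg hgA hgB := by
    rw [poleIntegral_add hH hH' hL hg hgA hgB, Pi.add_apply, hG.eq_poleIntegral g hg hgA hgB,
      hG'.eq_poleIntegral g hg hgA hgB]

lemma IsPoleContinuation.const_mul (hG : IsPoleContinuation C a A B H G) (c : ℂ) :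
    IsPoleContinuation C a A B (fun w => c * H w) fun g => c * G g where
  meromorphicOn g hg := (MeromorphicAt.const c g).mul (hG.meromorphicOn g hg)
  eq_poleIntegral g hg hgA hgB := by
    simp only [hG.eq_poleIntegral g hg hgA hgB, poleIntegral, mul_div_assoc,
      intervalIntegral.integral_const_mul]

lemma IsAdmissible.add (hH : IsAdmissible C L H) (hH' : IsAdmissible C L H') :
    IsAdmissible C L (H + H') :=
  ⟨hH.diff.add hH'.diff, fun g x => by simp only [Pi.add_apply, hH.periodic, hH'.periodic]⟩

lemma IsAdmissible.const_mul (hH : IsAdmissible C L H) (c : ℂ) :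
    IsAdmissible C L fun w => c * H w :=
  ⟨hH.diff.const_mul c, fun g x => by rw [hH.periodic]⟩

variable [DecidableEq ι]

/-- The part of the denominator complementary to the factors with index `i` in the first family of
poles and `j` in the second, so that dividing it by the denominator leaves only this pair. -/
def poleCompl (a : ι → ℂ) (A : Finset ι) (i j : ι) (w : ℂ × ℂ) : ℂ :=
  poleUp a (A.erase i) w * poleDown a (A.erase j) w

lemma isAdmissible_poleCompl (a : ι → ℂ) (A : Finset ι) (i j : ι) (C L : ℝ) :
    IsAdmissible C L (poleCompl a A i j) :=
  ⟨((differentiable_poleUp _ _).mul (differentiable_poleDown _ _)).differentiableOn,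
    fun g x => by simp only [poleCompl, poleUp_periodic a _ g x, poleDown_periodic a _ g x]⟩

lemma poleCompl_swap_neg (a : ι → ℂ) (A : Finset ι) (i j : ι) (g x : ℂ) :
    poleCompl a A j i (g, -x) = poleCompl a A i j (g, x) := by
  simp only [poleCompl, poleUp, poleDown, neg_neg]
  ring

lemma poleCompl_div {i j : ι} (hi : i ∈ A) (hj : j ∈ A) {g x : ℂ}
    (hup : poleUp a A (g, x) ≠ 0) (hdown : poleDown a A (g, x) ≠ 0) :
    poleCompl a A i j (g, x) / (poleUp a A (g, x) * poleDown a A (g, x)) =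
      (1 - ee (x + (a i - g)))⁻¹ * (1 - ee (-x + (a j - g)))⁻¹ := by
  have eA : poleUp a A (g, x) = (1 - ee (x + (a i - g))) * poleUp a (A.erase i) (g, x) := by
    rw [← add_sub_assoc]; exact (Finset.mul_prod_erase A _ hi).symm
  have eB : poleDown a A (g, x) = (1 - ee (-x + (a j - g))) * poleDown a (A.erase j) (g, x) := by
    rw [← add_sub_assoc]; exact (Finset.mul_prod_erase A _ hj).symm
  rw [eA] at hup ⊢
  rw [eB] at hdown ⊢
  have := right_ne_zero_of_mul hup
  have := right_ne_zero_of_mul hdown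
  rw [poleCompl]
  field_simp

lemma isPoleContinuation_poleCompl {i j : ι} (hi : i ∈ A) (hj : j ∈ A) :
    IsPoleContinuation C a A A (poleCompl a A i j) fun g => (1 - ee (a i + a j - 2 * g))⁻¹ where
  meromorphicOn g _ := (analyticAt_one_sub_ee _ g).meromorphicAt.inv
  eq_poleIntegral g _ hgA _ := by
    have hc : ∀ i ∈ A, 0 < (a i - g).im := fun i hi => by rw [Complex.sub_im]; linarith [hgA i hi]
    have hsum : a i + a j - 2 * g = (a i - g) + (a j - g) := by ring
    rw [hsum, ← integral_inv_one_sub_ee_mul_inv_one_sub_ee_neg (hc i hi) (hc j hj)]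
    exact intervalIntegral.integral_congr fun x _ => (poleCompl_div hi hj
      (poleUp_ne_zero fun i hi => by simpa using hgA i hi)
      (poleDown_ne_zero fun i hi => by simpa using hgA i hi)).symm

end

lemma eq_at_zero_of_one_sub_ee_mul {f h : ℂ → ℂ} (hf : Differentiable ℂ f)
    (hh : Differentiable ℂ h) (he : ∀ w, (1 - ee w) * f w = (1 - ee w) * h w) : f 0 = h 0 := by
  refine analyticAt_eq_of_eventuallyEq_nhdsNE (hf.analyticAt 0) (hh.analyticAt 0) ?_
  filter_upwards [eventually_ee_ne_one 1 0 0 one_ne_zero] with w hw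
  rw [one_mul, add_zero] at hw
  exact mul_left_cancel₀ (sub_ne_zero.2 hw.symm) (he w)

lemma dblPochOff_zero_zero (hτ : 0 < τ.im) (hη : 0 < η.im) : dblPochOff τ η {(0, 0)} 0 =
    qPoch (base τ) (base τ) * qPoch (base (2 * η)) (base (2 * η)) * dblPoch τ η (τ + 2 * η) := by
  have hp := norm_ee_lt_one hτ
  have hq := norm_ee_lt_one (im_two_mul_pos hη)
  have h := eq_at_zero_of_one_sub_ee_mul (f := dblPochOff τ η {(0, 0)}) (h := fun w =>
      qPoch (ee (w + τ)) (ee τ) * qPoch (ee (w + 2 * η)) (ee (2 * η)) *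
        dblPoch τ η (τ + 2 * η + w)) (differentiable_dblPochOff hτ hη _)
    ((((differentiable_qPoch_left hp).comp (differentiable_ee.comp
      (differentiable_id.add_const _))).mul ((differentiable_qPoch_left hq).comp
      (differentiable_ee.comp (differentiable_id.add_const _)))).mul
      ((differentiable_dblPoch hτ hη).comp (differentiable_id.const_add _))) fun w => by
    have h1 := dblPoch_eq_dblPochOn_mul_dblPochOff hτ hη {(0, 0)} w
    rw [dblPochOn, Finset.prod_singleton, dblPoch_eq_reflFactor_mul hτ hη, reflFactor,
      qPoch_eq_one_sub_mul _ hp] at h1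
    simp only [latVec, Nat.cast_zero, zero_mul, add_zero] at h1
    rw [← h1, ee_add w τ]
    ring
  simpa [base_eq_ee] using h

lemma dblPochOn_erase_mul_dblPochOff (hτ : 0 < τ.im) (hη : 0 < η.im) {s : Finset (ℕ × ℕ)}
    (hs : (0, 0) ∈ s) :
    dblPochOn τ η (s.erase (0, 0)) 0 * dblPochOff τ η s 0 = dblPochOff τ η {(0, 0)} 0 := by
  refine eq_at_zero_of_one_sub_ee_mul
    (f := fun w => dblPochOn τ η (s.erase (0, 0)) w * dblPochOff τ η s w) ?_
    (differentiable_dblPochOff hτ hη _) fun w => ?_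
  · refine Differentiable.mul ?_ (differentiable_dblPochOff hτ hη _)
    unfold dblPochOn
    exact Differentiable.fun_finsetProd fun nm _ => (differentiable_ee.comp
      (differentiable_id.add_const _)).const_sub 1
  · have h1 := dblPoch_eq_dblPochOn_mul_dblPochOff hτ hη {(0, 0)} w
    have h2 := dblPoch_eq_dblPochOn_mul_dblPochOff hτ hη s w
    rw [dblPochOn, Finset.prod_singleton] at h1
    rw [dblPochOn, ← Finset.mul_prod_erase s _ hs] at h2
    simp only [latVec, Nat.cast_zero, zero_mul, add_zero] at h1 h2
    rw [← h1, h2, mul_assoc]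
    rfl

lemma spinGeneric_zero (hτ : 0 < τ.im) (hη : 0 < η.im) : SpinGeneric τ η 0 0 := by
  rintro ⟨j, k⟩ h
  by_contra hne
  refine one_sub_ee_ne_zero (u := latVec τ η (j, k)) ?_ (by rw [h, latVec_zero, ee_zero, sub_self])
  rw [latVec_im]
  have h1 : 0 ≤ (j : ℝ) * τ.im := by positivity
  have h2 : 0 ≤ (k : ℝ) * (2 * η.im) := by positivity
  intro h3
  have hj : (j : ℝ) * τ.im = 0 := by linarith
  have hk : (k : ℝ) * (2 * η.im) = 0 := by linarith
  refine hne ?_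
  simp only [mul_eq_zero, Nat.cast_eq_zero, hτ.ne', hη.ne', or_false, two_ne_zero] at hj hk
  rw [hj, hk]

lemma integrandNum_even {z : ℂ} {s : Finset (ℕ × ℕ)} {Φ : ℂ → ℂ} (he : ∀ x, Φ (-x) = Φ x)
    (g x : ℂ) : integrandNum τ η z s Φ (g, -x) = integrandNum τ η z s Φ (g, x) := by
  simp only [integrandNum, he]
  have e1 : z + -x - g = z - x - g := by ring
  have e2 : z - -x - g = z + x - g := by ring
  have e3 : -z + -x - g = -z - x - g := by ring
  have e4 : -z - -x - g = -z + x - g := by ring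
  have e5 : 2 * -x = -2 * x := by ring
  have e6 : -2 * -x = 2 * x := by ring
  rw [e1, e2, e3, e4, e5, e6]
  ring

lemma dblPoch_tau_add_two_mul_ne_zero (hτ : 0 < τ.im) (hη : 0 < η.im) :
    dblPoch τ η (τ + 2 * η) ≠ 0 :=
  dblPoch_ne_zero_of_im_pos hτ hη (by rw [Complex.add_im]; linarith [im_two_mul_pos hη])

lemma qPoch_base_mul_ne_zero (hτ : 0 < τ.im) (hη : 0 < η.im) :
    qPoch (base τ) (base τ) * qPoch (base (2 * η)) (base (2 * η)) ≠ 0 :=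
  mul_ne_zero (qPoch_self_ne_zero (norm_ee_lt_one hτ))
    (qPoch_self_ne_zero (norm_ee_lt_one (im_two_mul_pos hη)))

lemma dblPoch_div_dblPochOff_zero (hτ : 0 < τ.im) (hη : 0 < η.im) {s : Finset (ℕ × ℕ)}
    (hs : (0, 0) ∈ s) :
    dblPoch τ η (τ + 2 * η) / dblPochOff τ η s 0 = dblPochOn τ η (s.erase (0, 0)) 0 /
      (qPoch (base τ) (base τ) * qPoch (base (2 * η)) (base (2 * η))) := by
  have h := dblPochOn_erase_mul_dblPochOff hτ hη hs
  rw [dblPochOff_zero_zero hτ hη] at h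
  have hPQ := qPoch_base_mul_ne_zero hτ hη
  have hoff : dblPochOff τ η s 0 ≠ 0 := right_ne_zero_of_mul
    (h ▸ mul_ne_zero hPQ (dblPoch_tau_add_two_mul_ne_zero hτ hη))
  rw [div_eq_div_iff hoff hPQ, h]
  ring

lemma reflFactor_mul_dblPoch_div_dblPochOff (hτ : 0 < τ.im) (hη : 0 < η.im) (s : Finset (ℕ × ℕ))
    {w : ℂ} (hw : dblPoch τ η w ≠ 0) :
    reflFactor τ η w * (dblPoch τ η (τ + 2 * η + w) / dblPochOff τ η s w) =
      dblPochOn τ η s w := by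
  have h := dblPoch_eq_dblPochOn_mul_dblPochOff hτ hη s w
  rw [← mul_div_assoc, ← dblPoch_eq_reflFactor_mul hτ hη, h]
  exact mul_div_cancel_right₀ _ (right_ne_zero_of_mul (h ▸ hw))

section
variable {z : ℂ} {s : Finset (ℕ × ℕ)}

/-- A numerator with explicitly known integral, made of the two pairs of poles which pinch the
contour at spin `0`. -/
def zeroSpinNum (τ η z : ℂ) (s : Finset (ℕ × ℕ)) : ℂ × ℂ → ℂ :=
  poleCompl (polePos τ η z) (s.disjSum s) (Sum.inl (0, 0)) (Sum.inr (0, 0)) +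
    poleCompl (polePos τ η z) (s.disjSum s) (Sum.inr (0, 0)) (Sum.inl (0, 0))

lemma isAdmissible_zeroSpinNum (C L : ℝ) : IsAdmissible C L (zeroSpinNum τ η z s) :=
  (isAdmissible_poleCompl _ _ _ _ C L).add (isAdmissible_poleCompl _ _ _ _ C L)

lemma isPoleContinuation_zeroSpinNum (hs : (0, 0) ∈ s) (C : ℝ) :
    IsPoleContinuation C (polePos τ η z) (s.disjSum s) (s.disjSum s) (zeroSpinNum τ η z s)
      fun g => 2 * (1 - ee (2 * (0 - g)))⁻¹ := by
  have hl : Sum.inl (0, 0) ∈ s.disjSum s := Finset.inl_mem_disjSum.2 hs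
  have hr : Sum.inr (0, 0) ∈ s.disjSum s := Finset.inr_mem_disjSum.2 hs
  convert (isPoleContinuation_poleCompl (C := C) (a := polePos τ η z) hl hr).add
    (isPoleContinuation_poleCompl hr hl) (isAdmissible_poleCompl _ _ _ _ C 1)
    (isAdmissible_poleCompl _ _ _ _ C 1) one_pos using 1
  · rfl
  ext g
  simp only [Pi.add_apply, polePos, Sum.elim_inl, Sum.elim_inr, latVec_zero, ← two_mul,
    add_zero, add_neg_cancel, neg_add_cancel, zero_sub, mul_neg]

lemma zeroSpinNum_even (x : ℂ) : zeroSpinNum τ η z s (0, -x) = zeroSpinNum τ η z s (0, x) := by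
  simp only [zeroSpinNum, Pi.add_apply, poleCompl_swap_neg]
  exact add_comm _ _

lemma zeroSpinNum_neg (hs : (0, 0) ∈ s) :
    zeroSpinNum τ η z s (0, -z) = dblPochOn τ η (s.erase (0, 0)) 0 ^ 2 *
      (dblPochOn τ η s (2 * z) * dblPochOn τ η s (-2 * z)) := by
  have hl : (s.disjSum s).erase (Sum.inl (0, 0)) = (s.erase (0, 0)).disjSum s := by
    ext i; rcases i with i | i <;> simp
  have hr : (s.disjSum s).erase (Sum.inr (0, 0)) = s.disjSum (s.erase (0, 0)) := by
    ext i; rcases i with i | i <;> simp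
  have hzero : dblPochOn τ η s 0 = 0 := Finset.prod_eq_zero hs (by simp [latVec_zero, ee_zero])
  have e₁ : z + -z - 0 = 0 := by ring
  have e₂ : z - -z - 0 = 2 * z := by ring
  have e₃ : -z + -z - 0 = -2 * z := by ring
  have e₄ : -z - -z - 0 = 0 := by ring
  simp only [zeroSpinNum, Pi.add_apply, poleCompl, hl, hr, poleUp_polePos, poleDown_polePos,
    e₁, e₂, e₃, e₄, hzero]
  ring

lemma integrandNum_eq_mul_zeroSpinNum (hτ : 0 < τ.im) (hη : 0 < η.im) (hs : (0, 0) ∈ s)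
    {Φ : ℂ → ℂ} (he : ∀ x, Φ (-x) = Φ x)
    (h1 : dblPoch τ η (2 * z) ≠ 0) (h2 : dblPoch τ η (-2 * z) ≠ 0) :
    integrandNum τ η z s Φ (0, -z) = Φ z / (qPoch (base τ) (base τ) *
      qPoch (base (2 * η)) (base (2 * η))) ^ 2 * zeroSpinNum τ η z s (0, -z) := by
  have e₁ : z + -z - 0 = 0 := by ring
  have e₂ : z - -z - 0 = 2 * z := by ring
  have e₃ : -z + -z - 0 = -2 * z := by ring
  have e₄ : -z - -z - 0 = 0 := by ring
  have e₅ : 2 * -z = -2 * z := by ring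
  have e₆ : -2 * -z = 2 * z := by ring
  have e₇ : τ + 2 * η - 2 * z = τ + 2 * η + -2 * z := by ring
  have e₈ : τ + 2 * η - -2 * z = τ + 2 * η + 2 * z := by ring
  rw [zeroSpinNum_neg hs, ← reflFactor_mul_dblPoch_div_dblPochOff hτ hη s h1,
    ← reflFactor_mul_dblPoch_div_dblPochOff hτ hη s h2, integrandNum, he]
  simp only [e₁, e₂, e₃, e₄, e₅, e₆, e₇, e₈, sub_zero]
  have h0 := dblPoch_div_dblPochOff_zero hτ hη hs
  calc _ = Φ z * (dblPoch τ η (τ + 2 * η) / dblPochOff τ η s 0) ^ 2 *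
        (reflFactor τ η (2 * z) * (dblPoch τ η (τ + 2 * η + 2 * z) / dblPochOff τ η s (2 * z)) *
        (reflFactor τ η (-2 * z) *
          (dblPoch τ η (τ + 2 * η + -2 * z) / dblPochOff τ η s (-2 * z)))) := by
        simp only [div_eq_mul_inv, mul_inv]; ring
    _ = _ := by rw [h0]; ring

lemma apply_zero_sub_polePos_eq_zero (hτ : 0 < τ.im) (hη : 0 < η.im)
    (hgen : PinchGeneric τ η 0 0 s z) {H : ℂ × ℂ → ℂ} (heven : ∀ x, H (0, -x) = H (0, x))
    (hz : H (0, -z) = 0) {i j : (ℕ × ℕ) ⊕ (ℕ × ℕ)} (hi : i ∈ s.disjSum s) (hj : j ∈ s.disjSum s)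
    (hij : ee (polePos τ η z i + polePos τ η z j - 2 * 0) = 1) :
    H (0, 0 - polePos τ η z i) = 0 := by
  obtain ⟨nm, nm', hsum, hcase⟩ := exists_add_eq_of_ee_polePos_eq_one (spinGeneric_zero hτ hη) hgen
    (by rw [latVec_zero, mul_zero]) hi hj hij
  obtain rfl : nm = (0, 0) := (add_eq_zero.1 hsum).1
  rcases hcase with ⟨rfl, -⟩ | ⟨rfl, -⟩
  · simpa only [polePos, Sum.elim_inl, latVec_zero, add_zero, zero_sub] using hz
  · simpa only [polePos, Sum.elim_inr, latVec_zero, add_zero, zero_sub, neg_neg, heven] using hz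

lemma regSpinFactor_zero (hτ : 0 < τ.im) (hη : 0 < η.im) : regSpinFactor τ η 0 0 0 =
    (qPoch (base τ) (base τ) * qPoch (base (2 * η)) (base (2 * η))) ^ 2 / 2 := by
  have hne := dblPoch_tau_add_two_mul_ne_zero hτ hη
  rw [regSpinFactor, mul_zero, mul_zero, add_zero, dblPochOff_zero_zero hτ hη]
  field_simp

end

lemma eventually_dblPoch_mul_ne_zero (hτ : 0 < τ.im) (hη : 0 < η.im) {c : ℂ} (hc : c ≠ 0) :
    ∀ᶠ z in codiscrete ℂ, dblPoch τ η (c * z) ≠ 0 :=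
  eventually_codiscrete_ne_zero (x := (τ + 2 * η) / c) ((differentiable_dblPoch hτ hη).comp
    (differentiable_id.const_mul c)) (by
      simpa only [Function.comp_def, id, mul_div_cancel₀ _ hc] using
        dblPoch_tau_add_two_mul_ne_zero hτ hη)

theorem intertwiner_zero (hτ : 0 < τ.im) (hη : 0 < η.im) :
    ∀ᶠ z in codiscrete ℂ, ∀ Φ, IsTestFunction Φ → (∀ x, Φ (-x) = Φ x) →
      intertwiner τ η 0 Φ z = Φ z := by
  have h2 : 2 * (0 : ℂ) = latVec τ η (0, 0) := by rw [latVec_zero, mul_zero]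
  suffices key : ∀ᶠ z in codiscrete ℂ, dblPoch τ η (2 * z) ≠ 0 → dblPoch τ η (-2 * z) ≠ 0 →
      ∀ Φ, IsTestFunction Φ → (∀ x, Φ (-x) = Φ x) → intertwiner τ η 0 Φ z = Φ z by
    filter_upwards [key, eventually_dblPoch_mul_ne_zero hτ hη two_ne_zero,
      eventually_dblPoch_mul_ne_zero hτ hη (c := -2) (by norm_num)]
      with z h h₂ h₂' using h h₂ h₂'
  refine eventually_codiscrete_of_pinchGeneric (τ := τ) (η := η) 0 0 fun Y => ?_
  obtain ⟨s, L, hs0, hL, hs⟩ := exists_finset_isPoleContinuation_hasPinchResidue hτ hη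
    (spinGeneric_zero hτ hη) h2 Y
  refine ⟨s, fun z hz hgen hz₂ hz₂' Φ hΦ he => ?_⟩
  obtain ⟨hadm, hpin⟩ := hs z hz hgen
  set c := Φ z / (qPoch (base τ) (base τ) * qPoch (base (2 * η)) (base (2 * η))) ^ 2 with hc
  have hE : IsAdmissible ((0 : ℂ).im + 1) L fun w => -c * zeroSpinNum τ η z s w :=
    (isAdmissible_zeroSpinNum _ L).const_mul _
  have hE' := (isAdmissible_zeroSpinNum (τ := τ) (η := η) (z := z) (s := s) ((0 : ℂ).im + 1)
    L).const_mul c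
  -- Subtracting a multiple of `zeroSpinNum` makes the numerator vanish at the pinching points.
  obtain ⟨G, hG, K, hK, hGK, hres⟩ := hpin _ ((hadm Φ hΦ).add hE)
  have hK0 : K 0 = 0 := hres fun i hi j hj hij => apply_zero_sub_polePos_eq_zero hτ hη hgen
    (fun x => by simp only [Pi.add_apply, integrandNum_even he, zeroSpinNum_even])
    (by rw [Pi.add_apply, integrandNum_eq_mul_zeroSpinNum hτ hη hs0 he hz₂ hz₂']; ring) hi hj hij
  have hGc := hG.add ((isPoleContinuation_zeroSpinNum hs0 _).const_mul c) ((hadm Φ hΦ).add hE)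
    hE' hL
  have hnum : integrandNum τ η z s Φ + (fun w => -c * zeroSpinNum τ η z s w) +
      (fun w => c * zeroSpinNum τ η z s w) = integrandNum τ η z s Φ := by
    ext w; simp only [Pi.add_apply]; ring
  have hval := intertwiner_eventuallyEq_regSpinFactor_mul (K := fun g => K g + 2 * c) hτ hη hΦ h2
    (lt_add_one _) (hnum ▸ hGc) (hK.add analyticAt_const) (by
      filter_upwards [hGK, eventually_one_sub_ee_ne_zero 0] with g h h'
      simp only [Pi.add_apply]
      rw [← h]
      field_simp)
  have hPQ := qPoch_base_mul_ne_zero hτ hη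
  rw [hval.eq_of_nhds, hK0, regSpinFactor_zero hτ hη, hc]
  generalize qPoch (base τ) (base τ) * qPoch (base (2 * η)) (base (2 * η)) = k at hPQ ⊢
  field_simp
  ring

/-! ### The recurrence in the spin -/

lemma tendsto_add_const_nhdsNE (c x : ℂ) :
    Tendsto (fun z : ℂ => z + c) (𝓝[≠] x) (𝓝[≠] (x + c)) :=
  tendsto_nhdsWithin_of_tendsto_nhds_of_eventually_within _
    ((continuous_add_const c).continuousAt.tendsto.mono_left nhdsWithin_le_nhds)
    (by filter_upwards [self_mem_nhdsWithin] with z hz h using hz (add_right_cancel h))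

lemma constR_ne_zero (hτ : 0 < τ.im) : constR τ ≠ 0 :=
  div_ne_zero (Complex.exp_ne_zero _)
    (mul_ne_zero Complex.I_ne_zero (qPoch_self_ne_zero (norm_ee_lt_one hτ)))

lemma theta1_neg (z τ : ℂ) : theta1 (-z) τ = -theta1 z τ := by
  have h (n : ℤ) : Complex.exp (2 * π * Complex.I * ((-1 - n : ℤ) + 1 / 2) * (-z + 1 / 2)) =
      -Complex.exp (2 * π * Complex.I * (n + 1 / 2) * (z + 1 / 2)) := by
    rw [← mul_neg_one (Complex.exp _), ← Complex.exp_pi_mul_I, ← Complex.exp_add,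
      Complex.exp_eq_exp_iff_exists_int]
    exact ⟨-(n + 1), by push_cast; ring⟩
  rw [theta1, theta1, ← tsum_neg, ← (Equiv.subLeft (-1 : ℤ)).tsum_eq, neg_neg]
  refine tsum_congr fun n => ?_
  rw [Equiv.subLeft_apply, h, mul_neg]
  push_cast
  ring_nf

lemma shortTheta_eq_constR_mul_theta1 (hτ : 0 < τ.im) (z : ℂ) :
    shortTheta τ z = constR τ * ee (z / 2) * theta1 z τ := by
  rw [mul_right_comm, constR_mul_theta1 hτ, mul_right_comm, ← ee_add, neg_div, neg_add_cancel,
    ee_zero, one_mul]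

lemma theta1_half_period_ne_zero (hτ : 0 < τ.im) : theta1 (τ / 2) τ ≠ 0 := by
  have hne : qPoch (ee (τ / 2)) (ee τ) ≠ 0 :=
    qPoch_ne_zero (norm_ee_lt_one hτ) fun k hk => by
      have hlt : ‖ee (τ / 2) * ee τ ^ k‖ < 1 := by
        rw [norm_mul, norm_pow]
        exact mul_lt_one_of_nonneg_of_lt_one_left (norm_nonneg _)
          (norm_ee_lt_one (im_half_pos hτ)) (pow_le_one₀ (norm_nonneg _) (norm_ee_lt_one hτ).le)
      rw [hk, norm_one] at hlt
      exact lt_irrefl _ hlt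
  have h := shortTheta_eq_constR_mul_theta1 hτ (τ / 2)
  rw [shortTheta, sub_half] at h
  exact right_ne_zero_of_mul (h ▸ mul_ne_zero hne hne)

/-- The coefficient of the shift `z ↦ z + η` in `A_k(g)`, with the Gaussian factors multiplied out.
The coefficient of `z ↦ z - η` is its value at `-z`. -/
def coeffA (τ η : ℂ) (k : ThetaIndex) (g z : ℂ) : ℂ :=
  theta k (z + (g + η)) (τ / 2) * ee (-z) / (constR τ * theta1 (2 * z) τ)

lemma opA_eq_coeffA (hη : η ≠ 0) (k : ThetaIndex) (g : ℂ) (Φ : ℂ → ℂ) (z : ℂ) :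
    opA τ η k g Φ z = coeffA τ η k g z * Φ (z + η) + coeffA τ η k g (-z) * Φ (z - η) := by
  have h1 : Complex.exp (π * Complex.I * z ^ 2 / η) * Complex.exp (π * Complex.I * η) *
      Complex.exp (-(π * Complex.I * (z + η) ^ 2 / η)) = ee (-z) := by
    rw [← Complex.exp_add, ← Complex.exp_add, ee]; congr 1; field_simp; ring
  have h2 : Complex.exp (π * Complex.I * z ^ 2 / η) * Complex.exp (π * Complex.I * η) *
      Complex.exp (-(π * Complex.I * (z - η) ^ 2 / η)) = ee z := by
    rw [← Complex.exp_add, ← Complex.exp_add, ee]; congr 1; field_simp; ring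
  have h3 : theta k (-z + (g + η)) (τ / 2) = theta k (z - g - η) (τ / 2) := by
    rw [← theta_neg]; ring_nf
  rw [opA, coeffA, coeffA, h3, neg_neg, mul_neg, theta1_neg, ← h1, ← h2, ← add_assoc]
  simp only [div_eq_mul_inv, mul_inv, mul_neg, inv_neg]
  ring

lemma spinKernel_neg (g z x : ℂ) : spinKernel τ η g (-z) x = spinKernel τ η g z x := by
  simp only [spinKernel, neg_neg]
  ring

lemma spinKernel_add_eta (hτ : 0 < τ.im) (hη : 0 < η.im) {g z : ℂ} (hg : (g + η).im < -|z.im|)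
    (x : ℝ) :
    spinKernel τ η g (z + η) x = constR τ * ee z * (theta1 (z + x - (g + η)) τ *
      theta1 (z - x - (g + η)) τ / theta1 (-2 * (g + η)) τ) * spinKernel τ η (g + η) z x := by
  set G := g + η with hG
  have hshift (w : ℂ) (hw : 0 < w.im) : ellGamma τ η (w + 2 * η) =
      constR τ * ee (w / 2) * theta1 w τ * ellGamma τ η w := by
    rw [ellGamma_add_two_mul hτ hη (dblPoch_ne_zero_of_im_pos hτ hη hw),
      shortTheta_eq_constR_mul_theta1 hτ]
  have hz := abs_le.1 (le_refl |z.im|)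
  have h1 : 0 < (z + x - G).im := by
    simp only [Complex.sub_im, Complex.add_im, Complex.ofReal_im]; linarith
  have h2 : 0 < (z - x - G).im := by
    simp only [Complex.sub_im, Complex.ofReal_im]; linarith
  have h3 : 0 < (-2 * G).im := by
    rw [neg_mul, Complex.neg_im, ← Complex.ofReal_ofNat, Complex.im_ofReal_mul]
    linarith [abs_nonneg z.im]
  have e1 : z + η + x - g = z + x - G + 2 * η := by rw [hG]; ring
  have e2 : z + η - x - g = z - x - G + 2 * η := by rw [hG]; ring
  have e3 : -(z + η) + x - g = -z + x - G := by rw [hG]; ring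
  have e4 : -(z + η) - x - g = -z - x - G := by rw [hG]; ring
  have e5 : -2 * g = -2 * G + 2 * η := by rw [hG]; ring
  have hee : ee ((z + x - G) / 2) * ee ((z - x - G) / 2) = ee z * ee (-2 * G / 2) := by
    rw [← ee_add, ← ee_add]; ring_nf
  have hR : constR τ * (constR τ)⁻¹ = 1 := mul_inv_cancel₀ (constR_ne_zero hτ)
  have hE : ee (-2 * G / 2) * (ee (-2 * G / 2))⁻¹ = 1 := mul_inv_cancel₀ (ee_ne_zero _)
  rw [spinKernel, e1, e2, e3, e4, e5, hshift _ h1, hshift _ h2, hshift _ h3, spinKernel]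
  generalize ee ((z + x - G) / 2) = a, ee ((z - x - G) / 2) = b, ee (-2 * G / 2) = c at *
  simp only [div_eq_mul_inv, mul_inv]
  linear_combination (theta1 (z + x - G) τ * theta1 (z - x - G) τ * (theta1 (-2 * G) τ)⁻¹ *
    (ellGamma τ η (z + x - G) * ellGamma τ η (z - x - G) * ellGamma τ η (-z + x - G) *
      ellGamma τ η (-z - x - G) * ((ellGamma τ η (-2 * G))⁻¹ * (ellGamma τ η (2 * x))⁻¹ *
      (ellGamma τ η (-2 * x))⁻¹))) * constR τ * (a * b * c⁻¹ * hR + c⁻¹ * hee + ee z * hE)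

lemma coeffA_mul_spinKernel (hτ : 0 < τ.im) (hη : 0 < η.im) (k : ThetaIndex) {g z : ℂ}
    (hg : (g + η).im < -|z.im|) (x : ℝ) :
    coeffA τ η k g z * spinKernel τ η g (z + η) x =
      theta k (z + (g + η)) (τ / 2) * (theta1 (z + x - (g + η)) τ * theta1 (z - x - (g + η)) τ) /
        (theta1 (2 * z) τ * theta1 (-2 * (g + η)) τ) * spinKernel τ η (g + η) z x := by
  have hR : constR τ * (constR τ)⁻¹ = 1 := mul_inv_cancel₀ (constR_ne_zero hτ)
  have hE : ee (-z) * ee z = 1 := by rw [← ee_add, neg_add_cancel, ee_zero]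
  rw [spinKernel_add_eta hτ hη hg, coeffA]
  generalize theta k (z + (g + η)) (τ / 2) = t
  simp only [div_eq_mul_inv, mul_inv]
  linear_combination (t * theta1 (z + x - (g + η)) τ *
    theta1 (z - x - (g + η)) τ * (theta1 (2 * z) τ)⁻¹ * (theta1 (-2 * (g + η)) τ)⁻¹ *
    spinKernel τ η (g + η) z x) * (ee (-z) * ee z * hR + hE)

lemma opA_spinKernel (hτ : 0 < τ.im) (hη : 0 < η.im) (k : ThetaIndex) {g z : ℂ}
    (hz : theta1 (2 * z) τ ≠ 0) (hg : (g + η).im < -|z.im|) (hg' : theta1 (-2 * (g + η)) τ ≠ 0)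
    (x : ℝ) :
    opA τ η k g (fun w => spinKernel τ η g w x) z =
      theta k x (τ / 2) * spinKernel τ η (g + η) z x := by
  have hη₀ : η ≠ 0 := fun h => by simp [h] at hη
  set G := g + η with hG
  have hm : spinKernel τ η g (z - η) x = spinKernel τ η g (-z + η) x := by
    rw [← spinKernel_neg, neg_sub, sub_eq_neg_add]
  have t1 : theta1 (-z + x - G) τ = -theta1 (z + G - x) τ := by rw [← theta1_neg]; ring_nf
  have t2 : theta1 (-z - x - G) τ = -theta1 (z + G + x) τ := by rw [← theta1_neg]; ring_nf
  have t3 : theta k (-z + G) (τ / 2) = theta k (z - G) (τ / 2) := by rw [← theta_neg]; ring_nf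
  have t4 : theta1 (2 * -z) τ = -theta1 (2 * z) τ := by rw [mul_neg, theta1_neg]
  have h3 := theta_three_term k hτ z G x
  rw [sub_add_eq_add_sub, sub_right_comm z G] at h3
  rw [opA_eq_coeffA hη₀, hm, coeffA_mul_spinKernel hτ hη k hg,
    coeffA_mul_spinKernel hτ hη k (by rwa [Complex.neg_im, abs_neg]), spinKernel_neg, ← hG,
    t1, t2, t3, t4, ← add_mul]
  congr 1
  rw [neg_mul (theta1 (2 * z) τ), div_neg, ← sub_eq_add_neg, ← sub_div,
    div_eq_iff (mul_ne_zero hz hg'), ← h3]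
  ring

lemma intervalIntegrable_spinKernel (hτ : 0 < τ.im) (hη : 0 < η.im) {Φ : ℂ → ℂ}
    (hΦ : IsTestFunction Φ) {g z : ℂ} (hg : g.im < -|z.im|) :
    IntervalIntegrable (fun x : ℝ => spinKernel τ η g z x * Φ x) MeasureTheory.volume 0 1 := by
  obtain ⟨s, -, hs⟩ := exists_finset_latVec hτ hη (-|z.im| + 1 + |z.im|)
  have hlt : ∀ i ∈ s.disjSum s, g.im < (polePos τ η z i).im := fun i _ =>
    hg.trans_le (neg_abs_le_polePos_im hτ hη z i)
  simp only [spinKernel_mul_eq hτ hη s]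
  exact ((continuous_poleIntegrand (isAdmissible_integrandNum hτ hη hs hΦ) one_pos hg hlt
    hlt).const_mul _).intervalIntegrable _ _

lemma IsTestFunction.theta_mul (hτ : 0 < τ.im) (k : ThetaIndex) {Φ : ℂ → ℂ}
    (hΦ : IsTestFunction Φ) : IsTestFunction fun x => theta k x (τ / 2) * Φ x :=
  ⟨(differentiable_theta k (im_half_pos hτ)).mul hΦ.1, fun z => by
    simp only [theta_add_one, hΦ.2]⟩

lemma opA_intertwinerIntegral (hτ : 0 < τ.im) (hη : 0 < η.im) (k : ThetaIndex) {Φ : ℂ → ℂ}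
    (hΦ : IsTestFunction Φ) {g z : ℂ} (hz : theta1 (2 * z) τ ≠ 0) (hg : (g + η).im < -|z.im|)
    (hgp : g.im < -|(z + η).im|) (hgm : g.im < -|(z - η).im|)
    (hg' : theta1 (-2 * (g + η)) τ ≠ 0) :
    opA τ η k g (intertwinerIntegral τ η g Φ) z =
      intertwinerIntegral τ η (g + η) (fun x => theta k x (τ / 2) * Φ x) z := by
  have hη₀ : η ≠ 0 := fun h => by simp [h] at hη
  have hdef (g : ℂ) (Φ : ℂ → ℂ) (z : ℂ) : intertwinerIntegral τ η g Φ z =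
      qPoch (base (2 * η)) (base (2 * η)) * qPoch (base τ) (base τ) / 2 *
        ∫ x : ℝ in (0 : ℝ)..1, spinKernel τ η g z x * Φ x := rfl
  have hker (x : ℝ) : spinKernel τ η (g + η) z x * (theta k x (τ / 2) * Φ x) =
      coeffA τ η k g z * (spinKernel τ η g (z + η) x * Φ x) +
        coeffA τ η k g (-z) * (spinKernel τ η g (z - η) x * Φ x) := by
    rw [← mul_assoc, mul_comm (spinKernel _ _ _ _ _), ← opA_spinKernel hτ hη k hz hg hg' x,
      opA_eq_coeffA hη₀]
    ring
  simp only [opA_eq_coeffA hη₀, hdef, hker]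
  rw [intervalIntegral.integral_add ((intervalIntegrable_spinKernel hτ hη hΦ hgp).const_mul _)
    ((intervalIntegrable_spinKernel hτ hη hΦ hgm).const_mul _),
    intervalIntegral.integral_const_mul, intervalIntegral.integral_const_mul]
  ring

lemma eventually_theta1_neg_two_mul_ne_zero (hτ : 0 < τ.im) (η : ℂ) :
    ∀ᶠ g in codiscrete ℂ, theta1 (-2 * (g + η)) τ ≠ 0 := by
  have e : -2 * (-(τ / 2) / 2 - η + η) = τ / 2 := by ring
  refine eventually_codiscrete_ne_zero (f := fun g => theta1 (-2 * (g + η)) τ)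
    (x := -(τ / 2) / 2 - η) ((differentiable_theta1 hτ).comp (by fun_prop)) ?_
  rw [e]
  exact theta1_half_period_ne_zero hτ

lemma intertwiner_add_eta_eventuallyEq_of_im_lt (hτ : 0 < τ.im) (hη : 0 < η.im) (k : ThetaIndex)
    {Φ : ℂ → ℂ} (hΦ : IsTestFunction Φ) {g₀ z : ℂ} (hz : theta1 (2 * z) τ ≠ 0)
    (hg : (g₀ + η).im < -|z.im|) (hgp : g₀.im < -|(z + η).im|) (hgm : g₀.im < -|(z - η).im|) :
    (fun g => intertwiner τ η (g + η) (fun x => theta k x (τ / 2) * Φ x) z) =ᶠ[𝓝[≠] g₀]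
      fun g => opA τ η k g (intertwiner τ η g Φ) z := by
  have hη₀ : η ≠ 0 := fun h => by simp [h] at hη
  have hlow {g : ℂ} {C : ℝ} (h : g.im < C) : ∀ᶠ g in 𝓝[≠] g, g.im < C :=
    mem_nhdsWithin_of_mem_nhds ((isOpen_im_lt C).mem_nhds h)
  have hshift := tendsto_add_const_nhdsNE η g₀
  have hspin {Ψ} (hΨ : IsTestFunction Ψ) (w : ℂ) := isSpinContinuation_intertwiner hτ hη hΨ w
  filter_upwards [eventually_codiscrete_iff.1 (eventually_theta1_neg_two_mul_ne_zero hτ η) g₀,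
    hshift.eventually ((hspin (hΦ.theta_mul hτ k) z).eventuallyEq_integral hτ hη hg),
    (hspin hΦ (z + η)).eventuallyEq_integral hτ hη hgp,
    (hspin hΦ (z - η)).eventuallyEq_integral hτ hη hgm,
    hshift.eventually (hlow hg), hlow hgp, hlow hgm] with g hθ h hp hm hg hgp hgm
  rw [h, ← opA_intertwinerIntegral hτ hη k hΦ hz hg hgp hgm hθ, opA_eq_coeffA hη₀,
    opA_eq_coeffA hη₀, hp, hm]

lemma differentiable_coeffA (hτ : 0 < τ.im) (η : ℂ) (k : ThetaIndex) (z : ℂ) :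
    Differentiable ℂ fun g => coeffA τ η k g z :=
  (((differentiable_theta k (im_half_pos hτ)).comp (f := fun g : ℂ => z + (g + η))
    (by fun_prop)).mul_const _).div_const _

theorem intertwiner_add_eta_eventuallyEq (hτ : 0 < τ.im) (hη : 0 < η.im) (k : ThetaIndex)
    {Φ : ℂ → ℂ} (hΦ : IsTestFunction Φ) {z : ℂ} (hz : theta1 (2 * z) τ ≠ 0) (g₀ : ℂ) :
    (fun g => intertwiner τ η (g + η) (fun x => theta k x (τ / 2) * Φ x) z) =ᶠ[𝓝[≠] g₀]
      fun g => opA τ η k g (intertwiner τ η g Φ) z := by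
  have hη₀ : η ≠ 0 := fun h => by simp [h] at hη
  have hmero {Ψ} (hΨ : IsTestFunction Ψ) (w g : ℂ) :
      MeromorphicAt (fun g => intertwiner τ η g Ψ w) g :=
    (isSpinContinuation_intertwiner hτ hη hΨ w).1.meromorphicOn g trivial
  have hcoeff (w g : ℂ) : MeromorphicAt (fun g => coeffA τ η k g w) g :=
    ((differentiable_coeffA hτ η k w).analyticAt g).meromorphicAt
  set y : ℝ := -|z.im| - |(z + η).im| - |(z - η).im| - η.im - 1 with hy
  have him : ((y : ℂ) * Complex.I).im = y := by simp
  have h1 := abs_nonneg z.im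
  have h2 := abs_nonneg (z + η).im
  have h3 := abs_nonneg (z - η).im
  refine meromorphicOn_eventuallyEq_of_eventuallyEq (U := Set.univ) (fun g _ => ?_) (fun g _ => ?_)
    isPreconnected_univ trivial trivial
    (intertwiner_add_eta_eventuallyEq_of_im_lt (g₀ := y * Complex.I) hτ hη k hΦ hz ?_ ?_ ?_)
  · exact (hmero (hΦ.theta_mul hτ k) z (g + η)).comp_analyticAt (g := fun g => g + η)
      (analyticAt_id.add analyticAt_const)
  · simp only [opA_eq_coeffA hη₀]
    exact ((hcoeff z g).mul (hmero hΦ (z + η) g)).add ((hcoeff (-z) g).mul (hmero hΦ (z - η) g))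
  · rw [Complex.add_im, him, hy]; linarith
  · rw [him, hy]; linarith
  · rw [him, hy]; linarith

lemma intertwiner_add_eta_of_analyticAt (hτ : 0 < τ.im) (hη : 0 < η.im) (k : ThetaIndex)
    {Φ : ℂ → ℂ} (hΦ : IsTestFunction Φ) {z g : ℂ} (hz : theta1 (2 * z) τ ≠ 0)
    (h : AnalyticAt ℂ (fun g => intertwiner τ η g (fun x => theta k x (τ / 2) * Φ x) z) (g + η))
    (hp : AnalyticAt ℂ (fun g => intertwiner τ η g Φ (z + η)) g)
    (hm : AnalyticAt ℂ (fun g => intertwiner τ η g Φ (z - η)) g) :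
    intertwiner τ η (g + η) (fun x => theta k x (τ / 2) * Φ x) z =
      opA τ η k g (intertwiner τ η g Φ) z := by
  have hη₀ : η ≠ 0 := fun h => by simp [h] at hη
  have hcoeff (w : ℂ) := (differentiable_coeffA hτ η k w).analyticAt g
  refine analyticAt_eq_of_eventuallyEq_nhdsNE
    (f := fun g => intertwiner τ η (g + η) (fun x => theta k x (τ / 2) * Φ x) z)
    (h := fun g => opA τ η k g (intertwiner τ η g Φ) z)
    (h.comp (f := fun g => g + η) (analyticAt_id.add analyticAt_const)) ?_
    (intertwiner_add_eta_eventuallyEq hτ hη k hΦ hz g)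
  simp only [opA_eq_coeffA hη₀]
  exact ((hcoeff z).mul hp).add ((hcoeff (-z)).mul hm)

/-! ### Incommensurate periods -/

lemma eventually_codiscrete_add {P : ℂ → Prop} (h : ∀ᶠ z in codiscrete ℂ, P z) (c : ℂ) :
    ∀ᶠ z in codiscrete ℂ, P (z + c) := by
  rw [eventually_codiscrete_iff] at h ⊢
  exact fun x => (tendsto_add_const_nhdsNE c x).eventually (h (x + c))

lemma exists_theta_ne_zero (k : ThetaIndex) (hτ : 0 < τ.im) : ∃ x, theta k x τ ≠ 0 := by
  have h := theta1_half_period_ne_zero hτ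
  rw [theta1_eq_jacobiTheta₂, neg_ne_zero] at h
  have h3 := right_ne_zero_of_mul h
  cases k
  · exact ⟨_, by simp only [theta, theta3_eq_jacobiTheta₂]; exact h3⟩
  · refine ⟨τ / 2 + τ / 2, ?_⟩
    simp only [theta, theta4_eq_jacobiTheta₂]
    rwa [add_right_comm]

lemma eventually_theta_ne_zero (k : ThetaIndex) (hτ : 0 < τ.im) :
    ∀ᶠ z in codiscrete ℂ, theta k z τ ≠ 0 := by
  obtain ⟨x, hx⟩ := exists_theta_ne_zero k hτ
  exact eventually_codiscrete_ne_zero (differentiable_theta k hτ) hx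

lemma eventually_theta1_two_mul_ne_zero (hτ : 0 < τ.im) :
    ∀ᶠ z in codiscrete ℂ, theta1 (2 * z) τ ≠ 0 := by
  refine eventually_codiscrete_ne_zero (x := τ / 2 / 2) ((differentiable_theta1 hτ).comp
    (differentiable_id.const_mul 2)) ?_
  rw [mul_div_cancel₀ _ two_ne_zero]
  exact theta1_half_period_ne_zero hτ

/-- `1, 2η, τ` have no integral relation involving `2η` or `τ`. This is the linear independence of
`1, 2η, τ` over `ℚ`, cleared of denominators, and it does not change when `2η` and `τ` are
exchanged. -/
def Incommensurate (τ η : ℂ) : Prop :=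
  ∀ a b c : ℤ, (a : ℂ) + b * (2 * η) + c * τ = 0 → b = 0 ∧ c = 0

lemma incommensurate_of_linearIndependent (h : LinearIndependent ℚ ![(1 : ℂ), 2 * η, τ]) :
    Incommensurate τ η := by
  intro a b c habc
  have h := Fintype.linearIndependent_iff.1 h ![(a : ℚ), b, c] (by
    simp only [Fin.sum_univ_three, Matrix.cons_val_zero, Matrix.cons_val_one, Matrix.cons_val]
    rw [← habc]
    simp [Rat.smul_def])
  exact ⟨by simpa using h 1, by simpa using h 2⟩

lemma Incommensurate.swap (h : Incommensurate τ η) : Incommensurate (2 * η) (τ / 2) :=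
  fun a b c habc => (h a c b (by rw [← habc]; ring)).symm

lemma Incommensurate.spinGeneric (h : Incommensurate τ η) (m n : ℕ) : SpinGeneric τ η m n := by
  rintro ⟨j, k⟩ hjk
  have h1 : ee (latVec τ η (j, k) - latVec τ η (m, n)) = 1 := by
    rw [ee_sub, hjk, div_self (ee_ne_zero _)]
  obtain ⟨a, ha⟩ := (ee_eq_one_iff _).1 h1
  obtain ⟨h2, h3⟩ := h (-a) (k - n) (j - m) (by
    simp only [latVec] at ha
    push_cast
    linear_combination ha)
  ext <;> simp only <;> omega

/-! ### Interpolation on a stencil -/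

lemma exists_even_testFunction_eqOn {s : Set ℂ} (hs : s.Finite)
    (hinj : s.InjOn fun x => Complex.cos (2 * π * x)) (v : ℂ → ℂ) :
    ∃ Φ, IsTestFunction Φ ∧ (∀ x, Φ (-x) = Φ x) ∧ s.EqOn Φ v := by
  obtain ⟨P, hP⟩ : ∃ P : Polynomial ℂ, ∀ x ∈ s, P.eval (Complex.cos (2 * π * x)) = v x :=
    ⟨_, fun x hx => Lagrange.eval_interpolate_at_node (v := fun x => Complex.cos (2 * π * x)) v
      (by rwa [hs.coe_toFinset]) (hs.mem_toFinset.2 hx)⟩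
  refine ⟨fun x => P.eval (Complex.cos (2 * π * x)), ⟨?_, fun x => ?_⟩, fun x => ?_, hP⟩
  · exact P.differentiable.comp (by fun_prop : Differentiable ℂ fun x => Complex.cos (2 * π * x))
  · simp only [mul_add, mul_one, Complex.cos_add_two_pi]
  · simp only [mul_neg, Complex.cos_neg]

lemma finite_shiftStencil (τ η : ℂ) (n m : ℕ) (z : ℂ) : (shiftStencil τ η n m z).Finite := by
  refine Set.Finite.subset (((Set.finite_Icc (-n : ℤ) n).prod (Set.finite_Icc (-m : ℤ) m)).image
    fun p => z + (p.1 * η + p.2 * (τ / 2))) ?_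
  rintro w ⟨α, β, hα, hβ, rfl⟩
  exact ⟨(α, β), ⟨abs_le.1 hα, abs_le.1 hβ⟩, rfl⟩

lemma eventually_forall_mem_shiftStencil {P : ℂ → Prop} (h : ∀ᶠ z in codiscrete ℂ, P z)
    (n m : ℕ) : ∀ᶠ z in codiscrete ℂ, ∀ w ∈ shiftStencil τ η n m z, P w := by
  have hall : ∀ᶠ z in codiscrete ℂ, ∀ α ∈ Finset.Icc (-n : ℤ) n, ∀ β ∈ Finset.Icc (-m : ℤ) m,
      P (z + (α * η + β * (τ / 2))) := by
    simp only [eventually_all_finset]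
    exact fun α _ β _ => eventually_codiscrete_add h _
  filter_upwards [hall] with z hz
  rintro w ⟨α, β, hα, hβ, rfl⟩
  exact hz α (Finset.mem_Icc.2 (abs_le.1 hα)) β (Finset.mem_Icc.2 (abs_le.1 hβ))

lemma Incommensurate.eventually_injOn_cos (hinc : Incommensurate τ η) (n m : ℕ) :
    ∀ᶠ z in codiscrete ℂ, (shiftStencil τ η n m z).InjOn fun x => Complex.cos (2 * π * x) := by
  have hgen : ∀ᶠ z in codiscrete ℂ, ∀ x ∈ shiftStencil τ η n m 0, ∀ y ∈ shiftStencil τ η n m 0,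
      ee (2 * z + (x + y)) ≠ 1 := by
    have hfin := finite_shiftStencil τ η n m 0
    simp only [hfin.eventually_all]
    exact fun x _ y _ => eventually_codiscrete_iff.2 fun z₀ =>
      eventually_ee_ne_one 2 _ z₀ two_ne_zero
  filter_upwards [hgen] with z hz
  rintro _ ⟨α, β, hα, hβ, rfl⟩ _ ⟨α', β', hα', hβ', rfl⟩ hxy
  have hpi : (2 * π : ℂ) ≠ 0 := mul_ne_zero two_ne_zero (Complex.ofReal_ne_zero.2 Real.pi_ne_zero)
  obtain ⟨j, hj | hj⟩ := Complex.cos_eq_cos_iff.1 hxy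
  · obtain ⟨hα, hβ⟩ := hinc (-2 * j) (α' - α) (β' - β) (mul_left_cancel₀ hpi (by
      push_cast
      linear_combination 2 * hj))
    rw [sub_eq_zero.1 hα, sub_eq_zero.1 hβ]
  · refine absurd ((ee_eq_one_iff _).2 ⟨j, mul_left_cancel₀ hpi ?_⟩)
      (hz _ ⟨α, β, hα, hβ, rfl⟩ _ ⟨α', β', hα', hβ', rfl⟩)
    linear_combination hj

/-! ### The factored operators -/

lemma shiftStencil_swap (n m : ℕ) (z : ℂ) :
    shiftStencil (2 * η) (τ / 2) m n z = shiftStencil τ η n m z := by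
  have h (α β : ℤ) : z + (β * (τ / 2) + α * (2 * η / 2)) = z + (α * η + β * (τ / 2)) := by ring
  ext w
  constructor
  · rintro ⟨β, α, hβ, hα, rfl⟩
    exact ⟨α, β, hα, hβ, (h α β).symm⟩
  · rintro ⟨α, β, hα, hβ, rfl⟩
    exact ⟨β, α, hβ, hα, h α β⟩

lemma self_mem_shiftStencil (τ η : ℂ) (n m : ℕ) (z : ℂ) : z ∈ shiftStencil τ η n m z :=
  ⟨0, 0, by simp, by simp, by simp⟩

lemma shiftStencil_add_subset (n m : ℕ) (z : ℂ) :
    shiftStencil τ η n m (z + η) ⊆ shiftStencil τ η (n + 1) m z := by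
  rintro _ ⟨α, β, hα, hβ, rfl⟩
  refine ⟨α + 1, β, ?_, hβ, by push_cast; ring⟩
  rw [abs_le] at hα ⊢
  push_cast
  constructor <;> linarith

lemma shiftStencil_sub_subset (n m : ℕ) (z : ℂ) :
    shiftStencil τ η n m (z - η) ⊆ shiftStencil τ η (n + 1) m z := by
  rintro _ ⟨α, β, hα, hβ, rfl⟩
  refine ⟨α - 1, β, ?_, hβ, by push_cast; ring⟩
  rw [abs_le] at hα ⊢
  push_cast
  constructor <;> linarith

lemma opB_eq_opA (k : ThetaIndex) (g : ℂ) (Φ : ℂ → ℂ) :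
    opB τ η k g Φ = opA (2 * η) (τ / 2) k g Φ := by
  funext z
  have e : ∀ w : ℂ, 2 * π * Complex.I * w ^ 2 / τ = π * Complex.I * w ^ 2 / (τ / 2) := fun w => by
    rw [div_div_eq_mul_div]; ring
  simp only [opB, opA, e, mul_div_cancel_left₀ η (two_ne_zero' ℂ)]

lemma prodB_eq_prodA (k : ThetaIndex) (s : ℂ) (m : ℕ) (Φ : ℂ → ℂ) :
    prodB τ η k s m Φ = prodA (2 * η) (τ / 2) k s m Φ := by
  induction m with
  | zero => rfl
  | succ m ih => rw [prodB, prodA, opB_eq_opA, ih]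

lemma opA_congr (k : ThetaIndex) (g : ℂ) {Φ Ψ : ℂ → ℂ} {z : ℂ} (h1 : Φ (z + η) = Ψ (z + η))
    (h2 : Φ (z - η) = Ψ (z - η)) : opA τ η k g Φ z = opA τ η k g Ψ z := by
  simp only [opA, h1, h2]

lemma prodA_congr (k : ThetaIndex) (s : ℂ) {Φ Ψ : ℂ → ℂ} {n : ℕ} {z : ℂ}
    (h : Set.EqOn Φ Ψ (shiftStencil τ η n 0 z)) :
    prodA τ η k s n Φ z = prodA τ η k s n Ψ z := by
  induction n generalizing z with
  | zero => exact h (self_mem_shiftStencil τ η 0 0 z)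
  | succ n ih =>
    exact opA_congr k _ (ih (h.mono (shiftStencil_add_subset n 0 z)))
      (ih (h.mono (shiftStencil_sub_subset n 0 z)))

lemma prodA_prodB_congr (k : ThetaIndex) (s s' : ℂ) {Φ Ψ : ℂ → ℂ} {n m : ℕ} {z : ℂ}
    (h : Set.EqOn Φ Ψ (shiftStencil τ η n m z)) :
    prodA τ η k s n (prodB τ η k s' m Φ) z = prodA τ η k s n (prodB τ η k s' m Ψ) z := by
  induction n generalizing z with
  | zero =>
    rw [← shiftStencil_swap] at h
    simpa only [prodA, prodB_eq_prodA] using prodA_congr k s' h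
  | succ n ih =>
    exact opA_congr k _ (ih (h.mono (shiftStencil_add_subset n m z)))
      (ih (h.mono (shiftStencil_sub_subset n m z)))

lemma factoredM_congr (k : ThetaIndex) {Φ Ψ : ℂ → ℂ} {n m : ℕ} {z : ℂ}
    (h : Set.EqOn Φ Ψ (shiftStencil τ η n m z)) :
    factoredM τ η k n m Φ z = factoredM τ η k n m Ψ z :=
  prodA_prodB_congr k _ _ fun w hw => by simp only [h hw]

lemma factoredM_succ (k : ThetaIndex) (n m : ℕ) (Φ : ℂ → ℂ) :
    factoredM τ η k (n + 1) m Φ = opA τ η k (n * η + m * (τ / 2))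
      (factoredM τ η k n m fun x => (theta k x (τ / 2))⁻¹ * Φ x) := by
  simp only [factoredM, prodA, pow_succ, mul_inv, mul_assoc, add_comm (m * (τ / 2) : ℂ)]

lemma factoredM_swap (k : ThetaIndex) (m : ℕ) (Φ : ℂ → ℂ) :
    factoredM (2 * η) (τ / 2) k m 0 Φ = factoredM τ η k 0 m Φ := by
  simp only [factoredM, prodA, prodB, prodB_eq_prodA, Nat.cast_zero, zero_mul, pow_zero, inv_one,
    one_mul, mul_one, mul_div_cancel_left₀ η (two_ne_zero' ℂ)]

/-- `M(nη + mτ/2)` and `M^{(k)}(nη + mτ/2)` agree on even test functions, outside a closed discrete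
set. This is the induction hypothesis on `n` and `m`; the exceptional set does not depend on the
test function, so that the recurrence can be applied to an interpolating one. -/
def IsFactored (τ η : ℂ) (n m : ℕ) : Prop :=
  ∀ᶠ z in codiscrete ℂ, ∀ (k : ThetaIndex) (Φ : ℂ → ℂ), IsTestFunction Φ → (∀ x, Φ (-x) = Φ x) →
    intertwiner τ η (n * η + m * (τ / 2)) Φ z = factoredM τ η k n m Φ z

lemma isFactored_zero (hτ : 0 < τ.im) (hη : 0 < η.im) : IsFactored τ η 0 0 := by
  filter_upwards [intertwiner_zero hτ hη] with z hz k Φ hΦ he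
  simp only [Nat.cast_zero, zero_mul, add_zero]
  rw [hz Φ hΦ he]
  simp [factoredM, prodA, prodB]

lemma IsFactored.succ (hτ : 0 < τ.im) (hη : 0 < η.im) (hinc : Incommensurate τ η) {n m : ℕ}
    (h : IsFactored τ η n m) : IsFactored τ η (n + 1) m := by
  have hθ (k : ThetaIndex) := eventually_forall_mem_shiftStencil (τ := τ) (η := η)
    (eventually_theta_ne_zero k (im_half_pos hτ)) (n + 1) m
  have hreg := eventually_analyticAt_intertwiner hτ hη (hinc.spinGeneric m n)
  have hreg' := eventually_analyticAt_intertwiner hτ hη (hinc.spinGeneric m (n + 1))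
  have hloc := eventually_intertwiner_eq_of_eqOn hτ hη (hinc.spinGeneric m (n + 1))
  have hg : ((n + 1 : ℕ) : ℂ) * η + m * (τ / 2) = n * η + m * (τ / 2) + η := by push_cast; ring
  rw [hg] at hreg' hloc
  filter_upwards [eventually_codiscrete_add h η, eventually_codiscrete_add h (-η),
    eventually_codiscrete_add hreg η, eventually_codiscrete_add hreg (-η), hreg', hloc, hθ .three,
    hθ .four, eventually_theta1_two_mul_ne_zero hτ, hinc.eventually_injOn_cos (n + 1) m]
    with z hp hm hregp hregm hreg hloc hθ₃ hθ₄ hz hinj k Φ hΦ he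
  rw [← sub_eq_add_neg] at hm hregm
  have hθ : ∀ w ∈ shiftStencil τ η (n + 1) m z, theta k w (τ / 2) ≠ 0 := by cases k <;> assumption
  obtain ⟨Ψ, hΨ, hΨe, hΨv⟩ := exists_even_testFunction_eqOn (finite_shiftStencil τ η (n + 1) m z)
    hinj fun x => (theta k x (τ / 2))⁻¹ * Φ x
  have hΘ := hΨ.theta_mul hτ k
  have hΦΨ : Set.EqOn Φ (fun x => theta k x (τ / 2) * Ψ x) (shiftStencil τ η (n + 1) m z) :=
    fun w hw => by simp only [hΨv hw, mul_inv_cancel_left₀ (hθ w hw)]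
  rw [hg]
  calc intertwiner τ η (n * η + m * (τ / 2) + η) Φ z
      = intertwiner τ η (n * η + m * (τ / 2) + η) (fun x => theta k x (τ / 2) * Ψ x) z :=
        hloc _ _ hΦ hΘ he (fun x => by rw [theta_neg, hΨe]) hΦΨ
    _ = opA τ η k (n * η + m * (τ / 2)) (intertwiner τ η (n * η + m * (τ / 2)) Ψ) z :=
        intertwiner_add_eta_of_analyticAt hτ hη k hΨ hz (hreg _ hΘ) (hregp Ψ hΨ) (hregm Ψ hΨ)
    _ = opA τ η k (n * η + m * (τ / 2)) (factoredM τ η k n m Ψ) z :=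
        opA_congr k _ (hp k Ψ hΨ hΨe) (hm k Ψ hΨ hΨe)
    _ = factoredM τ η k (n + 1) m Φ z := by
        rw [factoredM_succ]
        exact opA_congr k _ (factoredM_congr k (hΨv.mono (shiftStencil_add_subset n m z)))
          (factoredM_congr k (hΨv.mono (shiftStencil_sub_subset n m z)))

theorem isFactored (hτ : 0 < τ.im) (hη : 0 < η.im) (hinc : Incommensurate τ η) (n m : ℕ) :
    IsFactored τ η n m := by
  have h0 : ∀ {τ η : ℂ}, 0 < τ.im → 0 < η.im → Incommensurate τ η → ∀ n, IsFactored τ η n 0 :=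
    fun hτ hη hinc n => by
      induction n with
      | zero => exact isFactored_zero hτ hη
      | succ n ih => exact ih.succ hτ hη hinc
  induction n with
  | zero =>
    filter_upwards [h0 (im_two_mul_pos hη) (im_half_pos hτ) hinc.swap m] with z hz k Φ hΦ he
    have := hz k Φ hΦ he
    rw [intertwiner_swap hτ hη hΦ, factoredM_swap] at this
    rw [← this]
    simp
  | succ n ih => exact ih.succ hτ hη hinc

/-! ### Shifts of the spin by one half -/

lemma opA_add_half (k : ThetaIndex) (g : ℂ) (Φ : ℂ → ℂ) :
    opA τ η k (g + 1 / 2) Φ = opA τ η k.swap g Φ := by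
  funext z
  have e1 : z + (g + 1 / 2) + η = z + g + η + 1 / 2 := by ring
  have e2 : z - (g + 1 / 2) - η = z - g - η - 1 / 2 := by ring
  rw [opA, opA, e1, e2, theta_add_half, theta_sub_half]

lemma opB_add_half (k : ThetaIndex) (g : ℂ) (Φ : ℂ → ℂ) :
    opB τ η k (g + 1 / 2) Φ = opB τ η k.swap g Φ := by
  rw [opB_eq_opA, opB_eq_opA, opA_add_half]

lemma prodA_add_half (k : ThetaIndex) (s : ℂ) (n : ℕ) (Φ : ℂ → ℂ) :
    prodA τ η k (s + 1 / 2) n Φ = prodA τ η k.swap s n Φ := by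
  induction n with
  | zero => rfl
  | succ n ih => rw [prodA, prodA, ih, add_right_comm, opA_add_half]

theorem factoredMHalf_eq_factoredM_swap (k : ThetaIndex) (n m : ℕ) (Φ : ℂ → ℂ) :
    factoredMHalf τ η k n m Φ = factoredM τ η k.swap n m (halfShift Φ) := by
  have h := prodA_add_half (τ := 2 * η) (η := τ / 2) k 0 m
  rw [zero_add] at h
  simp only [factoredMHalf, factoredM, prodB_eq_prodA, prodA_add_half, h, theta_add_half]

lemma analyticAt_intertwiner_add_half (hτ : 0 < τ.im) (hη : 0 < η.im) {Φ : ℂ → ℂ}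
    (hΦ : IsTestFunction Φ) {g z : ℂ}
    (h : AnalyticAt ℂ (fun g => intertwiner τ η g (halfShift Φ) z) g) :
    AnalyticAt ℂ (fun g => intertwiner τ η g Φ z) (g + 1 / 2) := by
  have hshift : (fun g => intertwiner τ η g Φ z) =
      (fun g => intertwiner τ η g (halfShift Φ) z) ∘ fun g => g - 1 / 2 := by
    funext g
    rw [Function.comp_apply, ← intertwiner_add_half hτ hη hΦ, sub_add_cancel]
  rw [hshift]
  refine AnalyticAt.comp (𝕜 := ℂ) (g := fun g => intertwiner τ η g (halfShift Φ) z)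
    (f := fun g : ℂ => g - 1 / 2) ?_ (analyticAt_id.sub analyticAt_const)
  rwa [add_sub_cancel_right]

lemma eventually_intertwiner_one_half (hτ : 0 < τ.im) (hη : 0 < η.im) :
    ∀ᶠ z in codiscrete ℂ, ∀ Φ, IsTestFunction Φ → (∀ x, Φ (-x) = Φ x) →
      AnalyticAt ℂ (fun g => intertwiner τ η g Φ z) (1 / 2) ∧
        intertwiner τ η (1 / 2) Φ z = halfShift Φ z := by
  have hreg := eventually_analyticAt_intertwiner hτ hη (spinGeneric_zero hτ hη)
  simp only [Nat.cast_zero, zero_mul, zero_add] at hreg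
  filter_upwards [intertwiner_zero hτ hη, hreg] with z hzero hreg Φ hΦ he
  have han := analyticAt_intertwiner_add_half hτ hη hΦ (hreg _ hΦ.halfShift)
  have hval := intertwiner_add_half hτ hη hΦ 0 z
  rw [hzero _ hΦ.halfShift (halfShift_even hΦ.2 he)] at hval
  rw [zero_add] at han hval
  exact ⟨han, hval⟩

/-! ### Continuity in the parameters -/

lemma continuousAt_theta (k : ThetaIndex) {z τ : ℂ} (hτ : 0 < τ.im) :
    ContinuousAt (fun p : ℂ × ℂ => theta k p.1 p.2) (z, τ) := by
  cases k
  · simp only [theta, theta3_eq_jacobiTheta₂]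
    exact continuousAt_jacobiTheta₂ z hτ
  · simp only [theta, theta4_eq_jacobiTheta₂]
    exact ContinuousAt.comp (g := fun p : ℂ × ℂ => jacobiTheta₂ p.1 p.2) (x := (z, τ))
      (f := fun p : ℂ × ℂ => (p.1 + 1 / 2, p.2))
      (continuousAt_jacobiTheta₂ (z + 1 / 2) hτ) (by fun_prop)

lemma continuousAt_theta1 {z τ : ℂ} (hτ : 0 < τ.im) :
    ContinuousAt (fun p : ℂ × ℂ => theta1 p.1 p.2) (z, τ) := by
  simp only [theta1_eq_jacobiTheta₂, ee]
  refine (ContinuousAt.mul (by fun_prop) ?_).neg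
  exact ContinuousAt.comp (g := fun p : ℂ × ℂ => jacobiTheta₂ p.1 p.2) (x := (z, τ))
    (f := fun p : ℂ × ℂ => (p.1 + 1 / 2 + p.2 / 2, p.2))
    (continuousAt_jacobiTheta₂ (z + 1 / 2 + τ / 2) hτ) (by fun_prop)

lemma continuousAt_constR (hτ : 0 < τ.im) : ContinuousAt constR τ := by
  have hp := norm_ee_lt_one hτ
  have h1 : ContinuousAt (fun q : ℂ => qPoch q q) (ee τ) := by
    have := (ModularForm.differentiableOn_tprod_one_sub_pow.differentiableAt
      (Metric.isOpen_ball.mem_nhds (mem_ball_zero_iff.2 hp))).continuousAt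
    refine this.congr (Eventually.of_forall fun q => tprod_congr fun n => ?_)
    rw [pow_succ']
  have h2 : ContinuousAt (fun τ => qPoch (base τ) (base τ)) τ :=
    ContinuousAt.comp (f := base) h1 differentiable_ee.continuous.continuousAt
  unfold constR
  exact ContinuousAt.div (by fun_prop) (continuousAt_const.mul h2)
    (mul_ne_zero Complex.I_ne_zero (qPoch_self_ne_zero hp))

section
variable {X : Type*} [TopologicalSpace X] {T E g Z : X → ℂ} {Φ : X → ℂ → ℂ} {x : X}

lemma continuousAt_theta_comp (k : ThetaIndex) (hZ : ContinuousAt Z x) (hT : ContinuousAt T x)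
    (hTx : 0 < (T x).im) : ContinuousAt (fun x => theta k (Z x) (T x)) x :=
  ContinuousAt.comp (f := fun x => (Z x, T x)) (continuousAt_theta k hTx) (hZ.prodMk hT)

lemma continuousAt_theta1_comp (hZ : ContinuousAt Z x) (hT : ContinuousAt T x)
    (hTx : 0 < (T x).im) : ContinuousAt (fun x => theta1 (Z x) (T x)) x :=
  ContinuousAt.comp (f := fun x => (Z x, T x)) (continuousAt_theta1 hTx) (hZ.prodMk hT)

lemma continuousAt_coeffA (k : ThetaIndex) (hT : ContinuousAt T x) (hE : ContinuousAt E x)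
    (hg : ContinuousAt g x) (hZ : ContinuousAt Z x) (hTx : 0 < (T x).im)
    (hZx : theta1 (2 * Z x) (T x) ≠ 0) :
    ContinuousAt (fun x => coeffA (T x) (E x) k (g x) (Z x)) x := by
  have hθ := continuousAt_theta_comp k (hZ.add (hg.add hE)) (hT.div_const 2) (im_half_pos hTx)
  have hee : ContinuousAt (fun x => ee (-Z x)) x :=
    ContinuousAt.comp (f := fun x => -Z x) differentiable_ee.continuous.continuousAt hZ.neg
  have hR : ContinuousAt (fun x => constR (T x)) x :=
    ContinuousAt.comp (f := T) (continuousAt_constR hTx) hT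
  have hθ₁ := continuousAt_theta1_comp (hZ.const_mul 2) hT hTx
  exact (hθ.mul hee).div (hR.mul hθ₁) (mul_ne_zero (constR_ne_zero hTx) hZx)

lemma continuousAt_opA (k : ThetaIndex) (hT : ContinuousAt T x) (hE : ContinuousAt E x)
    (hg : ContinuousAt g x) (hZ : ContinuousAt Z x) (hTx : 0 < (T x).im) (hEx : 0 < (E x).im)
    (hZx : theta1 (2 * Z x) (T x) ≠ 0) (hp : ContinuousAt (fun x => Φ x (Z x + E x)) x)
    (hm : ContinuousAt (fun x => Φ x (Z x - E x)) x) :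
    ContinuousAt (fun x => opA (T x) (E x) k (g x) (Φ x) (Z x)) x := by
  have hneg : theta1 (2 * -Z x) (T x) ≠ 0 := by rwa [mul_neg, theta1_neg, neg_ne_zero]
  refine (((continuousAt_coeffA k hT hE hg hZ hTx hZx).mul hp).add
    ((continuousAt_coeffA k hT hE hg hZ.neg hTx hneg).mul hm)).congr ?_
  filter_upwards [hE.eventually_ne (fun h => by simp [h] at hEx : E x ≠ 0)] with x hx
  exact (opA_eq_coeffA hx k (g x) (Φ x) (Z x)).symm

lemma continuousAt_prodA (k : ThetaIndex) {n : ℕ} (hT : ContinuousAt T x)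
    (hE : ContinuousAt E x) (hg : ContinuousAt g x) (hZ : ContinuousAt Z x) (hTx : 0 < (T x).im)
    (hEx : 0 < (E x).im) (hZx : ∀ α : ℤ, |α| ≤ n → theta1 (2 * (Z x + α * E x)) (T x) ≠ 0)
    (hΦ : ∀ α : ℤ, |α| ≤ n → ContinuousAt (fun x => Φ x (Z x + α * E x)) x) :
    ContinuousAt (fun x => prodA (T x) (E x) k (g x) n (Φ x) (Z x)) x := by
  induction n generalizing Z with
  | zero => simpa only [prodA, Int.cast_zero, zero_mul, add_zero] using hΦ 0 (by simp)
  | succ n ih =>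
    have hε (ε : ℤ) (hε : |ε| ≤ 1) :
        ContinuousAt (fun x => prodA (T x) (E x) k (g x) n (Φ x) (Z x + ε * E x)) x := by
      have hshift (α : ℤ) (x : X) : Z x + ε * E x + α * E x = Z x + (ε + α : ℤ) * E x := by
        push_cast; ring
      have hle (α : ℤ) (hα : |α| ≤ n) : |ε + α| ≤ (n + 1 : ℕ) := by
        have := abs_add_le ε α
        push_cast
        linarith
      refine ih (hZ.add (hE.const_mul _)) (fun α hα => ?_) fun α hα => ?_
      · rw [hshift]; exact hZx _ (hle α hα)
      · simp only [hshift]; exact hΦ _ (hle α hα)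
    refine continuousAt_opA (Φ := fun x => prodA (T x) (E x) k (g x) n (Φ x)) k hT hE
      (hg.add (hE.const_mul _)) hZ hTx hEx ?_ ?_ ?_
    · simpa only [Int.cast_zero, zero_mul, add_zero] using hZx 0 (by rw [abs_zero]; positivity)
    · simpa only [Int.cast_one, one_mul] using hε 1 (by simp)
    · simpa only [Int.cast_neg, Int.cast_one, neg_mul, one_mul, ← sub_eq_add_neg]
        using hε (-1) (by simp)

end

/-- No denominator of the operators `M^{(k)}(nη + mτ/2)`, `k = 3, 4`, vanishes at `z`: none of
their theta functions has a zero on the stencil of shifts of `z`. -/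
def FactoredRegular (τ η : ℂ) (n m : ℕ) (z : ℂ) : Prop :=
  ∀ w ∈ shiftStencil τ η n m z, theta1 (2 * w) τ ≠ 0 ∧ theta1 (2 * w) (2 * η) ≠ 0 ∧
    ∀ k, theta k w η ≠ 0 ∧ theta k w (τ / 2) ≠ 0

lemma eventually_factoredRegular (hτ : 0 < τ.im) (hη : 0 < η.im) (n m : ℕ) :
    ∀ᶠ z in codiscrete ℂ, FactoredRegular τ η n m z := by
  refine eventually_forall_mem_shiftStencil ?_ n m
  filter_upwards [eventually_theta1_two_mul_ne_zero hτ,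
    eventually_theta1_two_mul_ne_zero (im_two_mul_pos hη), eventually_theta_ne_zero .three hη,
    eventually_theta_ne_zero .four hη, eventually_theta_ne_zero .three (im_half_pos hτ),
    eventually_theta_ne_zero .four (im_half_pos hτ)] with w h1 h1' h3 h4 h3' h4'
  refine ⟨h1, h1', fun k => ?_⟩
  cases k
  · exact ⟨h3, h3'⟩
  · exact ⟨h4, h4'⟩

lemma continuousAt_factoredM (hτ : 0 < τ.im) (hη : 0 < η.im) (k : ThetaIndex) {n m : ℕ} {z : ℂ}
    (hz : FactoredRegular τ η n m z) {Φ : ℂ → ℂ} (hΦ : Continuous Φ) :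
    ContinuousAt (fun p : ℂ × ℂ => factoredM τ p.1 k n m Φ p.2) (η, z) := by
  have hfst : ContinuousAt (Prod.fst : ℂ × ℂ → ℂ) (η, z) := continuousAt_fst
  have hsnd : ContinuousAt (Prod.snd : ℂ × ℂ → ℂ) (η, z) := continuousAt_snd
  simp only [factoredM, prodB_eq_prodA]
  refine continuousAt_prodA (T := fun _ => τ) (g := fun _ => m * (τ / 2))
    (Φ := fun p => prodA (2 * p.1) (τ / 2) k 0 m fun z =>
      (theta k z p.1 ^ m)⁻¹ * (theta k z (τ / 2) ^ n)⁻¹ * Φ z) k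
    continuousAt_const hfst continuousAt_const hsnd hτ hη
    (fun α hα => (hz _ ⟨α, 0, hα, by simp, by simp⟩).1) fun α hα => ?_
  have hZ : ContinuousAt (fun p : ℂ × ℂ => p.2 + α * p.1) (η, z) := hsnd.add (hfst.const_mul _)
  have hmem (β : ℤ) (hβ : |β| ≤ m) : z + α * η + β * (τ / 2) ∈ shiftStencil τ η n m z :=
    ⟨α, β, hα, hβ, (add_assoc _ _ _).symm⟩
  refine continuousAt_prodA (T := fun p : ℂ × ℂ => 2 * p.1) (E := fun _ => τ / 2) (g := fun _ => 0)
    (Φ := fun p z => (theta k z p.1 ^ m)⁻¹ * (theta k z (τ / 2) ^ n)⁻¹ * Φ z) k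
    (hfst.const_mul 2) continuousAt_const continuousAt_const hZ (im_two_mul_pos hη)
    (im_half_pos hτ) (fun β hβ => (hz _ (hmem β hβ)).2.1) fun β hβ => ?_
  have hw : ContinuousAt (fun p : ℂ × ℂ => p.2 + α * p.1 + β * (τ / 2)) (η, z) :=
    hZ.add continuousAt_const
  obtain ⟨-, -, hθ⟩ := hz _ (hmem β hβ)
  have hw' : ContinuousAt (fun p : ℂ × ℂ => Φ (p.2 + α * p.1 + β * (τ / 2))) (η, z) :=
    ContinuousAt.comp (f := fun p : ℂ × ℂ => p.2 + α * p.1 + β * (τ / 2)) hΦ.continuousAt hw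
  have hη' := continuousAt_theta_comp k hw hfst hη
  have hτ' := continuousAt_theta_comp k hw continuousAt_const (im_half_pos hτ)
  exact (((hη'.pow m).inv₀ (pow_ne_zero m (hθ k).1)).mul
    ((hτ'.pow n).inv₀ (pow_ne_zero n (hθ k).2))).mul hw'

/-! ### Independence of `k` -/

lemma countable_not_incommensurate (hτ : 0 < τ.im) : {η | ¬Incommensurate τ η}.Countable := by
  refine (Set.countable_range fun abc : ℤ × ℤ × ℤ =>
    -((abc.1 : ℂ) + abc.2.2 * τ) / (2 * abc.2.1)).mono fun η hη => ?_
  simp only [Set.mem_ofPred_eq, Incommensurate, not_forall] at hη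
  obtain ⟨a, b, c, h, hbc⟩ := hη
  have hb : b ≠ 0 := by
    rintro rfl
    have him : c = 0 ∨ τ.im = 0 := by simpa using congrArg Complex.im h
    exact hbc ⟨rfl, him.resolve_right hτ.ne'⟩
  refine ⟨(a, b, c), ?_⟩
  simp only
  rw [div_eq_iff (by simpa using hb)]
  linear_combination -h

lemma dense_incommensurate (hτ : 0 < τ.im) : Dense {η | Incommensurate τ η} := by
  simpa [Set.compl_ofPred] using (countable_not_incommensurate hτ).dense_compl ℂ

lemma factoredM_eq_of_incommensurate (hτ : 0 < τ.im) (hη : 0 < η.im) (hinc : Incommensurate τ η)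
    (k k' : ThetaIndex) (n m : ℕ) :
    ∀ᶠ z in codiscrete ℂ, ∀ Φ : ℂ → ℂ, factoredM τ η k n m Φ z = factoredM τ η k' n m Φ z := by
  filter_upwards [isFactored hτ hη hinc n m, hinc.eventually_injOn_cos n m] with z hM hinj Φ
  obtain ⟨Ψ, hΨ, he, hv⟩ :=
    exists_even_testFunction_eqOn (finite_shiftStencil τ η n m z) hinj Φ
  rw [factoredM_congr k hv.symm, factoredM_congr k' hv.symm, ← hM k Ψ hΨ he, ← hM k' Ψ hΨ he]

lemma frequently_factoredM_eq (hτ : 0 < τ.im) (hη : 0 < η.im) (k k' : ThetaIndex) (n m : ℕ)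
    (z : ℂ) (Φ : ℂ → ℂ) :
    ∃ᶠ p : ℂ × ℂ in 𝓝 (η, z), factoredM τ p.1 k n m Φ p.2 = factoredM τ p.1 k' n m Φ p.2 := by
  rw [nhds_prod_eq, frequently_iff]
  intro U hU
  obtain ⟨V, hV, W, hW, hVW⟩ := mem_prod_iff.1 hU
  obtain ⟨η', ⟨hη'V, hη'⟩, hinc⟩ := mem_closure_iff_nhds.1 (dense_incommensurate hτ η) _
    (inter_mem hV ((isOpen_lt continuous_const Complex.continuous_im).mem_nhds hη))
  have heq := eventually_codiscrete_iff.1 (factoredM_eq_of_incommensurate hτ hη' hinc k k' n m) z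
  obtain ⟨z', hz', hz'W⟩ := (heq.and (mem_nhdsWithin_of_mem_nhds hW)).exists
  exact ⟨(η', z'), hVW ⟨hη'V, hz'W⟩, hz' Φ⟩

lemma exists_continuous_eqOn {s : Set ℂ} (hs : s.Finite) (v : ℂ → ℂ) :
    ∃ Φ : ℂ → ℂ, Continuous Φ ∧ s.EqOn Φ v :=
  ⟨_, (Lagrange.interpolate hs.toFinset id v).continuous, fun _ hx =>
    Lagrange.eval_interpolate_at_node v (Set.injOn_id _) (hs.mem_toFinset.2 hx)⟩

theorem factoredM_eq_of_factoredRegular (hτ : 0 < τ.im) (hη : 0 < η.im) (k k' : ThetaIndex)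
    {n m : ℕ} {z : ℂ} (hz : FactoredRegular τ η n m z) (Φ : ℂ → ℂ) :
    factoredM τ η k n m Φ z = factoredM τ η k' n m Φ z := by
  obtain ⟨Ψ, hΨ, hv⟩ := exists_continuous_eqOn (finite_shiftStencil τ η n m z) Φ
  rw [factoredM_congr k hv.symm, factoredM_congr k' hv.symm]
  exact tendsto_nhds_unique_of_frequently_eq (continuousAt_factoredM hτ hη k hz hΨ)
    (continuousAt_factoredM hτ hη k' hz hΨ) (frequently_factoredM_eq hτ hη k k' n m z Ψ)

end

end EllipticDouble

end

theorem mainTheorem7 (τ η : ℂ) (hτ : 0 < τ.im) (hη : 0 < η.im) :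
    -- for every test function and every `z` the continuation in `g` exists and is unique
    (∀ Φ : ℂ → ℂ, IsTestFunction Φ → ∀ z : ℂ, ∃! F : ℂ → ℂ, IsSpinContinuation τ η Φ z F) ∧
    -- `M(1/2) = P` on even test functions
    (∀ Φ : ℂ → ℂ, IsTestFunction Φ → (∀ x, Φ (-x) = Φ x) →
      ∀ᶠ z in Filter.codiscrete ℂ,
        AnalyticAt ℂ (fun g => intertwiner τ η g Φ z) (1 / 2) ∧
        intertwiner τ η (1 / 2) Φ z = halfShift Φ z) ∧
    -- the swaps of `A_3, A_4` and of `B_3, B_4`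
    (∀ (k : ThetaIndex) (g : ℂ) (Φ : ℂ → ℂ),
      opA τ η k (g + 1 / 2) Φ = opA τ η k.swap g Φ ∧
      opB τ η k (g + 1 / 2) Φ = opB τ η k.swap g Φ) ∧
    ∀ n m : ℕ,
      -- `M(nη + mτ/2 + 1/2) = M(nη + mτ/2) P` for the intertwining operator
      (∀ Φ : ℂ → ℂ, IsTestFunction Φ → ∀ z : ℂ,
        intertwiner τ η (n * η + m * (τ / 2) + 1 / 2) Φ z =
          intertwiner τ η (n * η + m * (τ / 2)) (halfShift Φ) z) ∧
      -- `M^{(3,4)}(nη + mτ/2 + 1/2) = M^{(4,3)}(nη + mτ/2) P`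
      (∀ (k : ThetaIndex) (Φ : ℂ → ℂ),
        factoredMHalf τ η k n m Φ = factoredM τ η k.swap n m (halfShift Φ)) ∧
      -- independence of `k`
      (∀ (k : ThetaIndex) (Φ : ℂ → ℂ),
        factoredMHalf τ η k n m Φ =ᶠ[Filter.codiscrete ℂ] factoredM τ η k n m (halfShift Φ)) ∧
      -- for incommensurate `1, 2η, τ`: `M(g)` is regular at both lattice points and equals
      -- the factored difference operators there
      (LinearIndependent ℚ ![(1 : ℂ), 2 * η, τ] →
        ∀ Φ : ℂ → ℂ, IsTestFunction Φ →
          ∀ᶠ z in Filter.codiscrete ℂ,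
            AnalyticAt ℂ (fun g => intertwiner τ η g Φ z) (n * η + m * (τ / 2)) ∧
            AnalyticAt ℂ (fun g => intertwiner τ η g Φ z) (n * η + m * (τ / 2) + 1 / 2) ∧
            ((∀ x, Φ (-x) = Φ x) → ∀ k : ThetaIndex,
              intertwiner τ η (n * η + m * (τ / 2)) Φ z = factoredM τ η k n m Φ z ∧
              intertwiner τ η (n * η + m * (τ / 2) + 1 / 2) Φ z =
                factoredMHalf τ η k n m Φ z)) := by
  refine ⟨fun Φ hΦ z => ?_, fun Φ hΦ he => ?_, fun k g Φ => ⟨opA_add_half k g Φ,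
    opB_add_half k g Φ⟩, fun n m => ⟨fun Φ hΦ z => intertwiner_add_half hτ hη hΦ _ z,
    fun k Φ => factoredMHalf_eq_factoredM_swap k n m Φ, fun k Φ => ?_, fun hind Φ hΦ => ?_⟩⟩
  · exact ⟨_, isSpinContinuation_intertwiner hτ hη hΦ z, fun F hF =>
      hF.unique hτ hη (isSpinContinuation_intertwiner hτ hη hΦ z)⟩
  · filter_upwards [eventually_intertwiner_one_half hτ hη] with z hz using hz Φ hΦ he
  · filter_upwards [eventually_factoredRegular hτ hη n m] with z hz
    rw [factoredMHalf_eq_factoredM_swap]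
    exact factoredM_eq_of_factoredRegular hτ hη _ _ hz _
  · have hinc := incommensurate_of_linearIndependent hind
    filter_upwards [eventually_analyticAt_intertwiner hτ hη (hinc.spinGeneric m n),
      isFactored hτ hη hinc n m] with z hreg hM
    refine ⟨hreg Φ hΦ, analyticAt_intertwiner_add_half hτ hη hΦ (hreg _ hΦ.halfShift),
      fun he k => ⟨hM k Φ hΦ he, ?_⟩⟩
    rw [intertwiner_add_half hτ hη hΦ, factoredMHalf_eq_factoredM_swap]
    exact hM k.swap _ hΦ.halfShift (halfShift_even hΦ.2 he)
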